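/- **Setting.** Let $G$ be a finite group and $\mathcal{S}et^G$ the category of finite $G$-sets. An *indexing category* is a wide, pullback-stable, finite-coproduct-complete subcategory $\mathcal O\subseteq\mathcal{S}et^G$ (it contains all maps $\emptyset\to X$, the inclusions into disjoint unions, and with $f\colon X\to Z$, $g\colon Y\to Z$ also $X\amalg Y\to Z$). A pair $(\mathcal O_a,\mathcal O_m)$ of indexing categories is *compatible* if for every $g\colon S\to T$ in $\mathcal O_m$ the dependent product $\Pi_g$ (right adjoint to pullback along $g$) sends objects $X\to S$ of $(\mathcal O_a)_{/S}$ to objects of $(\mathcal O_a)_{/T}$. Let $\mathcal P^G$ be the category of finite $G$-sets whose morphisms $S\to T$ are the isomorphism classes of polynomials $T_h N_g R_f=[S\xleftarrow{f}U_1\xrightarrow{g}U_2\xrightarrow{h}T]$, with the usual composition by pullbacks and dependent products. For a compatible pair, let $\mathcal P^G_{\mathcal O_a,\mathcal O_m}$ be the wide subcategory of the classes with $g\in\mathcal O_m$ and $h\in\mathcal O_a$; disjoint union is its categorical product. An *$(\mathcal O_a,\mathcal O_m)$-Tambara functor* is a product-preserving functor $R\colon\mathcal P^G_{\mathcal O_a,\mathcal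 O_m}\to\mathcal{S}et$ such that every $R(X)$, with the addition given by transfer along the fold map $X\amalg X\to X$, is an abelian group; morphisms are natural transformations. Multiplication on $R(X)$ is given by the norm along the fold map. Let $\mathcal A_{\mathcal O_a}$ be the category of finite $G$-sets whose morphisms $S\to T$ are the isomorphism classes of spans $[S\leftarrow U\xrightarrow{h}T]$ with $h\in\mathcal O_a$. An *$\mathcal O_a$-Mackey functor* is a product-preserving functor $\mathcal A_{\mathcal O_a}\to\mathcal{S}et$ whose values are groups under the addition given by transfer along fold maps; equivalently it is regarded as a functor to abelian groups. Every Tambara functor $R$ has an underlying $\mathcal O_a$-Mackey functor $UR$, by restriction along $[S\leftarrow U\xrightarrow{h}T]\mapsto[S\leftarrow U\xrightarrow{=}U\xrightarrow{h}T]$. The *box product* $M\,\Box\,N$ of $\mathcal O_a$-Mackey functors is the left Kan extension of $M\otimes N\colon\mathcal A_{\mathcal O_a}\times\mathcal A_{\mathcal O_a}\to\mathcal{A}b$ along the Cartesian product $\times\colon\mathcal A_{\mathcal O_a}\times\mathcal A_{\mathcal O_a}\to\mathcal A_{\mathcal O_a}$. **Theorem.** Let $(\mathcal O_a,\mathcal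 O_m)$ be a compatible pair of indexing categories. 1. The category of $(\mathcal O_a,\mathcal O_m)$-Tambara functors is cocomplete: it has all small colimits (in particular all coproducts, coequalizers and filtered colimits). 2. Coproducts are given by the box product of $\mathcal O_a$-Mackey functors: if $R\xrightarrow{i}Q\xleftarrow{j}S$ is a coproduct diagram of $(\mathcal O_a,\mathcal O_m)$-Tambara functors, then $UQ$ is the box product $UR\,\Box\,US$, with universal natural transformation $$R(X)\otimes S(Y)\to Q(X\times Y),\qquad x\otimes y\mapsto R_{\mathrm{pr}_1}(i(x))\cdot R_{\mathrm{pr}_2}(j(y)).$$ -/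

import Mathlib

open CategoryTheory Limits

universe u w

/-- The category of finite `G`-sets. -/
abbrev FinGSet (G : Type u) [Group G] := Action FintypeCat.{0} G

namespace FinGSet

section
variable {G : Type u} [Group G]

/-- The function underlying a map of finite `G`-sets. -/
def ap {X Y : FinGSet G} (f : X ⟶ Y) (x : X.V) : Y.V := f.hom x

@[simp] lemma ap_id {X : FinGSet G} (x : X.V) : ap (𝟙 X) x = x := rfl

@[simp] lemma ap_comp {X Y Z : FinGSet G} (f : X ⟶ Y) (g : Y ⟶ Z) (x : X.V) :
    ap (f ≫ g) x = ap g (ap f x) := rfl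

@[simp] lemma ap_smul {X Y : FinGSet G} (f : X ⟶ Y) (a : G) (x : X.V) :
    ap f (a • x) = a • ap f x := ConcreteCategory.congr_hom (f.comm a) x

@[ext] lemma hom_ext {X Y : FinGSet G} {f g : X ⟶ Y} (h : ∀ x, ap f x = ap g x) : f = g := by
  apply Action.Hom.ext
  apply FintypeCat.hom_ext
  exact h

lemma ap_congr {X Y : FinGSet G} {f g : X ⟶ Y} (h : f = g) (x : X.V) : ap f x = ap g x := by
  rw [h]

/-- The map of finite `G`-sets given by an equivariant function. -/
def mkHom {X Y : FinGSet G} (f : X.V → Y.V) (hf : ∀ (a : G) x, f (a • x) = a • f x) : X ⟶ Y where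
  hom := FintypeCat.homMk f
  comm a := by
    apply FintypeCat.hom_ext
    exact fun x => hf a x

@[simp] lemma ap_mkHom {X Y : FinGSet G} (f : X.V → Y.V) (hf : ∀ (a : G) x, f (a • x) = a • f x)
    (x : X.V) : ap (mkHom f hf) x = f x := rfl

/-- A finite type with a `G`-action, as a finite `G`-set. -/
abbrev of (X : Type) [Finite X] [MulAction G X] : FinGSet G :=
  Action.FintypeCat.ofMulAction G (FintypeCat.of X)

/-- The isomorphism of finite `G`-sets given by a pair of mutually inverse functions, one of
which is equivariant. -/
def mkIso {X Y : FinGSet G} (f : X ⟶ Y) (i : Y.V → X.V)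
    (h₁ : ∀ x, i (ap f x) = x) (h₂ : ∀ y, ap f (i y) = y) : X ≅ Y where
  hom := f
  inv := mkHom i fun a y => by
    rw [← h₁ (a • i y), ap_smul, h₂]
  hom_inv_id := hom_ext h₁
  inv_hom_id := hom_ext h₂

@[simp] lemma mkIso_hom {X Y : FinGSet G} (f : X ⟶ Y) (i : Y.V → X.V)
    (h₁ : ∀ x, i (ap f x) = x) (h₂ : ∀ y, ap f (i y) = y) : (mkIso f i h₁ h₂).hom = f := rfl

@[simp] lemma ap_mkIso_inv {X Y : FinGSet G} (f : X ⟶ Y) (i : Y.V → X.V)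
    (h₁ : ∀ x, i (ap f x) = x) (h₂ : ∀ y, ap f (i y) = y) (y : Y.V) :
    ap (mkIso f i h₁ h₂).inv y = i y := rfl

@[simp] lemma ap_hom_inv {X Y : FinGSet G} (e : X ≅ Y) (x : X.V) : ap e.inv (ap e.hom x) = x := by
  rw [← ap_comp, e.hom_inv_id, ap_id]

@[simp] lemma ap_inv_hom {X Y : FinGSet G} (e : X ≅ Y) (y : Y.V) : ap e.hom (ap e.inv y) = y := by
  rw [← ap_comp, e.inv_hom_id, ap_id]

/-- A square of finite `G`-sets is a pullback square iff it is one on underlying sets. -/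
lemma isPullback_of {P X Y Z : FinGSet G} {p : P ⟶ X} {q : P ⟶ Y} {f : X ⟶ Z} {g : Y ⟶ Z}
    (w : ∀ z, ap f (ap p z) = ap g (ap q z))
    (inj : ∀ z z', ap p z = ap p z' → ap q z = ap q z' → z = z')
    (surj : ∀ x y, ap f x = ap g y → ∃ z, ap p z = x ∧ ap q z = y) :
    IsPullback p q f g := by
  refine ⟨⟨hom_ext w⟩, ⟨PullbackCone.IsLimit.mk _ (fun s => ?_) ?_ ?_ ?_⟩⟩
  · have h := fun x => surj (ap s.fst x) (ap s.snd x) (ap_congr s.condition x)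
    exact mkHom (fun x => (h x).choose) fun a x => by
      apply inj
      · rw [(h (a • x)).choose_spec.1, ap_smul, ap_smul, (h x).choose_spec.1]
      · rw [(h (a • x)).choose_spec.2, ap_smul, ap_smul, (h x).choose_spec.2]
  · intro s
    ext x
    exact (surj (ap s.fst x) (ap s.snd x) (ap_congr s.condition x)).choose_spec.1
  · intro s
    ext x
    exact (surj (ap s.fst x) (ap s.snd x) (ap_congr s.condition x)).choose_spec.2
  · intro s m h₁ h₂
    have h := fun x => (surj (ap s.fst x) (ap s.snd x) (ap_congr s.condition x)).choose_spec
    ext x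
    apply inj
    · exact (ap_congr h₁ x).trans (h x).1.symm
    · exact (ap_congr h₂ x).trans (h x).2.symm

lemma isPullback_types {P X Y Z : FinGSet G} {p : P ⟶ X} {q : P ⟶ Y} {f : X ⟶ Z} {g : Y ⟶ Z}
    (h : IsPullback p q f g) :
    (∀ z z', ap p z = ap p z' → ap q z = ap q z' → z = z') ∧
    (∀ x y, ap f x = ap g y → ∃ z, ap p z = x ∧ ap q z = y) := by
  have := (Types.isPullback_iff _ _ _ _).1
    (h.map (Action.forget FintypeCat G ⋙ FintypeCat.incl))
  exact ⟨fun z z' h₁ h₂ => this.2.1 z z' ⟨h₁, h₂⟩, this.2.2⟩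

/-- The finite `G`-set with no elements. -/
def empty (G : Type u) [Group G] : FinGSet G :=
  letI : MulAction G PEmpty.{1} :=
    { smul := fun _ x => x, one_smul := fun _ => rfl, mul_smul := fun _ _ _ => rfl }
  of PEmpty.{1}

instance : IsEmpty (empty G).V := inferInstanceAs (IsEmpty PEmpty)

/-- The map out of the empty `G`-set. -/
def fromEmpty (X : FinGSet G) : empty G ⟶ X := mkHom (fun x => isEmptyElim x) fun _ x => isEmptyElim x

instance sumAction (X Y : FinGSet G) : MulAction G (X.V ⊕ Y.V) where
  smul a := Sum.map (a • ·) (a • ·)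
  one_smul x := by
    rcases x with x | x
    · exact congrArg Sum.inl (one_smul G x)
    · exact congrArg Sum.inr (one_smul G x)
  mul_smul a b x := by
    rcases x with x | x
    · exact congrArg Sum.inl (mul_smul a b x)
    · exact congrArg Sum.inr (mul_smul a b x)

/-- The disjoint union of two finite `G`-sets. -/
def sum (X Y : FinGSet G) : FinGSet G := of (X.V ⊕ Y.V)

/-- The inclusion of the first summand. -/
def inl (X Y : FinGSet G) : X ⟶ sum X Y := mkHom (Y := sum X Y) Sum.inl fun _ _ => rfl

/-- The inclusion of the second summand. -/
def inr (X Y : FinGSet G) : Y ⟶ sum X Y := mkHom (Y := sum X Y) Sum.inr fun _ _ => rfl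

/-- The map out of a disjoint union with given restrictions to the summands. -/
def desc {X Y Z : FinGSet G} (f : X ⟶ Z) (g : Y ⟶ Z) : sum X Y ⟶ Z :=
  mkHom (X := sum X Y) (fun x => Sum.elim (ap f) (ap g) x) fun a x => by
    rcases x with x | x
    · exact ap_smul f a x
    · exact ap_smul g a x

lemma sum_cases {X Y : FinGSet G} (z : (sum X Y).V) :
    (∃ x, z = ap (inl X Y) x) ∨ (∃ y, z = ap (inr X Y) y) := by
  rcases z with x | y
  · exact Or.inl ⟨x, rfl⟩
  · exact Or.inr ⟨y, rfl⟩

lemma inl_inj {X Y : FinGSet G} {x x' : X.V} (h : ap (inl X Y) x = ap (inl X Y) x') : x = x' :=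
  Sum.inl_injective h

lemma inr_inj {X Y : FinGSet G} {x x' : Y.V} (h : ap (inr X Y) x = ap (inr X Y) x') : x = x' :=
  Sum.inr_injective h

lemma inl_ne_inr {X Y : FinGSet G} {x : X.V} {y : Y.V} : ap (inl X Y) x ≠ ap (inr X Y) y :=
  Sum.inl_ne_inr

@[simp] lemma ap_desc_inl {X Y Z : FinGSet G} (f : X ⟶ Z) (g : Y ⟶ Z) (x : X.V) :
    ap (desc f g) (ap (inl X Y) x) = ap f x := rfl

@[simp] lemma ap_desc_inr {X Y Z : FinGSet G} (f : X ⟶ Z) (g : Y ⟶ Z) (y : Y.V) :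
    ap (desc f g) (ap (inr X Y) y) = ap g y := rfl

/-- The disjoint union of two maps. -/
def sumMap {X X' Y Y' : FinGSet G} (f : X ⟶ X') (g : Y ⟶ Y') : sum X Y ⟶ sum X' Y' :=
  desc (f ≫ inl X' Y') (g ≫ inr X' Y')

/-- The fold map. -/
def fold (X : FinGSet G) : sum X X ⟶ X := desc (𝟙 X) (𝟙 X)

instance prodAction (X Y : FinGSet G) : MulAction G (X.V × Y.V) where
  smul a x := (a • x.1, a • x.2)
  one_smul x := Prod.ext (one_smul G x.1) (one_smul G x.2)
  mul_smul a b x := Prod.ext (mul_smul a b x.1) (mul_smul a b x.2)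

/-- The cartesian product of two finite `G`-sets, with the diagonal action. -/
def prod (X Y : FinGSet G) : FinGSet G := of (X.V × Y.V)

/-- The first projection. -/
def fst (X Y : FinGSet G) : prod X Y ⟶ X := mkHom (X := prod X Y) (fun x => x.1) fun _ _ => rfl

/-- The second projection. -/
def snd (X Y : FinGSet G) : prod X Y ⟶ Y := mkHom (X := prod X Y) (fun x => x.2) fun _ _ => rfl

/-- The product of two maps. -/
def prodMap {X X' Y Y' : FinGSet G} (f : X ⟶ X') (g : Y ⟶ Y') : prod X Y ⟶ prod X' Y' :=
  mkHom (X := prod X Y) (Y := prod X' Y') (fun x => (ap f x.1, ap g x.2)) fun a x =>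
    Prod.ext (ap_smul f a x.1) (ap_smul g a x.2)

end

section
variable {G : Type u} [Group G]

/-- For `q : C ⟶ D`, `p : C ⟶ T` and `h : B ⟶ T`, the pairs of a point `d` of `D` and a function
`s` from the fibre of `q` over `d` to `B` such that `h (s c) = p c`. -/
structure Sec {B C D T : FinGSet G} (q : C ⟶ D) (p : C ⟶ T) (h : B ⟶ T) where
  pt : D.V
  sec : ∀ c : C.V, ap q c = pt → B.V
  lies : ∀ c hc, ap h (sec c hc) = ap p c

namespace Sec

variable {B C D T : FinGSet G} {q : C ⟶ D} {p : C ⟶ T} {h : B ⟶ T}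

lemma ext' {x y : Sec q p h} (h₁ : x.pt = y.pt)
    (h₂ : ∀ c hx hy, x.sec c hx = y.sec c hy) : x = y := by
  obtain ⟨d, s, hs⟩ := x
  obtain ⟨d', s', hs'⟩ := y
  obtain rfl : d = d' := h₁
  obtain rfl : s = s' := by
    funext c hc
    exact h₂ c hc hc
  rfl

lemma sec_congr (x : Sec q p h) {c c' : C.V} (e : c = c') (hc : ap q c = x.pt)
    (hc' : ap q c' = x.pt) : x.sec c hc = x.sec c' hc' := by
  subst e
  rfl

lemma sec_congr' {x y : Sec q p h} (e : x = y) {c c' : C.V} (e' : c = c') (hc : ap q c = x.pt)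
    (hc' : ap q c' = y.pt) : x.sec c hc = y.sec c' hc' := by
  subst e e'
  rfl

instance : Finite (Sec q p h) := by
  let φ : Sec q p h → Σ d : D.V, ({c : C.V // ap q c = d} → B.V) :=
    fun x => ⟨x.pt, fun c => x.sec c.1 c.2⟩
  refine Finite.of_injective φ fun x y e => ?_
  obtain ⟨d, s, hs⟩ := x
  obtain ⟨d', s', hs'⟩ := y
  have e₁ : d = d' := congrArg Sigma.fst e
  subst e₁
  have e₂ := eq_of_heq (Sigma.mk.inj e).2
  refine ext' rfl fun c hc _ => congrFun e₂ ⟨c, hc⟩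

/-- `G` acts by conjugation on sections. -/
instance : MulAction G (Sec q p h) where
  smul a x :=
    { pt := a • x.pt
      sec := fun c hc => a • x.sec (a⁻¹ • c) (by rw [ap_smul, hc, inv_smul_smul])
      lies := fun c hc => by rw [ap_smul, x.lies, ap_smul, smul_inv_smul] }
  one_smul x := ext' (one_smul G x.pt) fun c hx hy =>
    (one_smul G _).trans (x.sec_congr (by simp) _ _)
  mul_smul a b x := ext' (mul_smul a b x.pt) fun c hx hy =>
    (mul_smul a b _).trans (congrArg (fun z => a • b • z) (x.sec_congr (by simp [mul_smul]) _ _))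

@[simp] lemma smul_pt (a : G) (x : Sec q p h) : (a • x).pt = a • x.pt := rfl

lemma smul_sec (a : G) (x : Sec q p h) (c : C.V) (hc : ap q c = (a • x).pt) :
    (a • x).sec c hc =
      a • x.sec (a⁻¹ • c) (by rw [ap_smul, hc, smul_pt, inv_smul_smul]) := rfl

lemma smul_sec_smul (a : G) (x : Sec q p h) (c : C.V) (hc : ap q (a • c) = (a • x).pt)
    (hc' : ap q c = x.pt) : (a • x).sec (a • c) hc = a • x.sec c hc' := by
  rw [smul_sec]
  exact congrArg (a • ·) (x.sec_congr (by simp) _ _)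

end Sec

/-- The finite `G`-set of sections. -/
def secObj {B C D T : FinGSet G} (q : C ⟶ D) (p : C ⟶ T) (h : B ⟶ T) : FinGSet G :=
  of (Sec q p h)

/-- The projection sending `(d, s)` to `d`. -/
def secPt {B C D T : FinGSet G} (q : C ⟶ D) (p : C ⟶ T) (h : B ⟶ T) : secObj q p h ⟶ D :=
  mkHom (X := secObj q p h) (fun x => Sec.pt x) fun _ _ => rfl

/-- The dependent product `Π_g (X → S)` along `g : S ⟶ T` of `h : X ⟶ S`: its points over `t` are
the sections of `h` over the fibre of `g` over `t`. -/
def depProd {X S T : FinGSet G} (g : S ⟶ T) (h : X ⟶ S) : FinGSet G := secObj g (𝟙 S) h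

/-- The structure map `Π_g X ⟶ T`. -/
def depProdHom {X S T : FinGSet G} (g : S ⟶ T) (h : X ⟶ S) : depProd g h ⟶ T := secPt g (𝟙 S) h

/-- The triples of an element `(d, s)` of `Sec q p h`, an element `c` of the fibre of `q` over `d`
and an element `a` of the fibre of `n` over `s c`. -/
structure Pos {A B C D T : FinGSet G} (q : C ⟶ D) (p : C ⟶ T) (n : A ⟶ B) (h : B ⟶ T) where
  sh : Sec q p h
  c : C.V
  hc : ap q c = sh.pt
  a : A.V
  ha : ap n a = sh.sec c hc

namespace Pos

variable {A B C D T : FinGSet G} {q : C ⟶ D} {p : C ⟶ T} {n : A ⟶ B} {h : B ⟶ T}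

lemma ext' {x y : Pos q p n h} (h₁ : x.sh = y.sh) (h₂ : x.c = y.c) (h₃ : x.a = y.a) : x = y := by
  cases x
  cases y
  cases h₁
  cases h₂
  cases h₃
  rfl

lemma eq_mk {z : Pos q p n h} {s : Sec q p h} (e : z.sh = s) (hc : ap q z.c = s.pt)
    (ha : ap n z.a = s.sec z.c hc) : z = ⟨s, z.c, hc, z.a, ha⟩ := by
  subst e
  rfl

instance : Finite (Pos q p n h) := by
  let φ : Pos q p n h → Sec q p h × C.V × A.V := fun x => (x.sh, x.c, x.a)
  refine Finite.of_injective φ fun x y e => ?_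
  simp only [φ, Prod.mk.injEq] at e
  exact ext' e.1 e.2.1 e.2.2

instance : MulAction G (Pos q p n h) where
  smul b x :=
    { sh := b • x.sh
      c := b • x.c
      hc := by rw [ap_smul, x.hc, Sec.smul_pt]
      a := b • x.a
      ha := by rw [Sec.smul_sec_smul _ _ _ _ x.hc, ap_smul, x.ha] }
  one_smul x := ext' (one_smul G x.sh) (one_smul G x.c) (one_smul G x.a)
  mul_smul a b x := ext' (mul_smul a b x.sh) (mul_smul a b x.c) (mul_smul a b x.a)

end Pos

/-- The finite `G`-set of triples as above. -/
def posObj {A B C D T : FinGSet G} (q : C ⟶ D) (p : C ⟶ T) (n : A ⟶ B) (h : B ⟶ T) :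
    FinGSet G := of (Pos q p n h)

end

end FinGSet

open FinGSet

section
variable {G : Type u} [Group G]

/-- A polynomial (bispan) `S ←f U₁ →g U₂ →h T` of finite `G`-sets. -/
structure Bispan (S T : FinGSet G) where
  U₁ : FinGSet G
  U₂ : FinGSet G
  f : U₁ ⟶ S
  g : U₁ ⟶ U₂
  h : U₂ ⟶ T

namespace Bispan

/-- Two polynomials are isomorphic if there are isomorphisms `U₁ ≅ U₁'` and `U₂ ≅ U₂'`
commuting with all the structure maps. -/
def IsIso {S T : FinGSet G} (P Q : Bispan S T) : Prop :=
  ∃ (e₁ : P.U₁ ≅ Q.U₁) (e₂ : P.U₂ ≅ Q.U₂),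
    e₁.hom ≫ Q.f = P.f ∧ e₁.hom ≫ Q.g = P.g ≫ e₂.hom ∧ e₂.hom ≫ Q.h = P.h

lemma IsIso.refl {S T : FinGSet G} (P : Bispan S T) : IsIso P P :=
  ⟨Iso.refl _, Iso.refl _, by simp, by simp, by simp⟩

lemma IsIso.symm {S T : FinGSet G} {P Q : Bispan S T} : IsIso P Q → IsIso Q P := by
  rintro ⟨e₁, e₂, hf, hg, hh⟩
  refine ⟨e₁.symm, e₂.symm, ?_, ?_, ?_⟩
  · simp [← hf]
  · simp only [Iso.symm_hom, Iso.inv_comp_eq]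
    rw [reassoc_of% hg, e₂.hom_inv_id, Category.comp_id]
  · simp [← hh]

lemma IsIso.trans {S T : FinGSet G} {P Q R : Bispan S T} : IsIso P Q → IsIso Q R → IsIso P R := by
  rintro ⟨e₁, e₂, hf, hg, hh⟩ ⟨e₁', e₂', hf', hg', hh'⟩
  refine ⟨e₁ ≪≫ e₁', e₂ ≪≫ e₂', ?_, ?_, ?_⟩
  · simp [hf, hf']
  · simp [hg', reassoc_of% hg]
  · simp [hh, hh']

instance setoid (S T : FinGSet G) : Setoid (Bispan S T) where
  r := IsIso
  iseqv := ⟨IsIso.refl, IsIso.symm, IsIso.trans⟩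

/-- The identity polynomial. -/
def id (S : FinGSet G) : Bispan S S := ⟨S, S, 𝟙 S, 𝟙 S, 𝟙 S⟩

/-- The composite of `S ← A → B → T` and `T ← C → D → U`. Its `U₂` is the dependent product along
`C ⟶ D` of the pullback of `B` to `C`, and its `U₁` is the pullback of `A` along the evaluation
map from `U₂ ×_D C` to `B`. -/
def comp {S T U : FinGSet G} (P : Bispan S T) (Q : Bispan T U) : Bispan S U where
  U₁ := posObj Q.g Q.f P.g P.h
  U₂ := secObj Q.g Q.f P.h
  f := mkHom (X := posObj Q.g Q.f P.g P.h) (fun x => ap P.f (Pos.a x)) fun a x =>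
    ap_smul P.f a (Pos.a x)
  g := mkHom (X := posObj Q.g Q.f P.g P.h) (Y := secObj Q.g Q.f P.h) (fun x => Pos.sh x)
    fun _ _ => rfl
  h := secPt Q.g Q.f P.h ≫ Q.h

/-- To give an isomorphism of polynomials it suffices to give two maps and inverse functions. -/
lemma IsIso.mk' {S T : FinGSet G} {P Q : Bispan S T} (F₁ : P.U₁ ⟶ Q.U₁) (F₂ : P.U₂ ⟶ Q.U₂)
    (I₁ : Q.U₁.V → P.U₁.V) (I₂ : Q.U₂.V → P.U₂.V)
    (a₁ : ∀ x, I₁ (ap F₁ x) = x) (b₁ : ∀ y, ap F₁ (I₁ y) = y)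
    (a₂ : ∀ x, I₂ (ap F₂ x) = x) (b₂ : ∀ y, ap F₂ (I₂ y) = y)
    (hf : ∀ x, ap Q.f (ap F₁ x) = ap P.f x) (hg : ∀ x, ap Q.g (ap F₁ x) = ap F₂ (ap P.g x))
    (hh : ∀ x, ap Q.h (ap F₂ x) = ap P.h x) : IsIso P Q :=
  ⟨mkIso F₁ I₁ a₁ b₁, mkIso F₂ I₂ a₂ b₂, hom_ext hf, hom_ext hg, hom_ext hh⟩

lemma id_comp {S T : FinGSet G} (Q : Bispan S T) : IsIso (comp (id S) Q) Q := by
  refine IsIso.mk'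
    (mkHom (X := posObj _ _ _ _) (fun x => Pos.c x) fun _ _ => rfl)
    (secPt _ _ _)
    (fun c => (⟨⟨ap Q.g c, fun c _ => ap Q.f c, fun _ _ => rfl⟩, c, rfl, ap Q.f c, rfl⟩ :
      Pos Q.g Q.f (𝟙 S) (𝟙 S)))
    (fun d => (⟨d, fun c _ => ap Q.f c, fun _ _ => rfl⟩ : Sec Q.g Q.f (𝟙 S)))
    ?_ (fun _ => rfl) ?_ (fun _ => rfl) ?_ ?_ (fun _ => rfl)
  · intro x
    change Pos _ _ _ _ at x
    have key : ∀ c hc, x.sh.sec c hc = ap Q.f c := x.sh.lies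
    refine Pos.ext' (Sec.ext' x.hc fun c _ _ => (key c _).symm) rfl ?_
    exact ((key _ x.hc).symm.trans x.ha.symm)
  · intro x
    change Sec _ _ _ at x
    exact Sec.ext' rfl fun c _ hy => (x.lies c hy).symm
  · intro x
    change Pos _ _ _ _ at x
    exact ((x.sh.lies _ x.hc).symm.trans x.ha.symm)
  · intro x
    exact Pos.hc x

lemma comp_id {S T : FinGSet G} (P : Bispan S T) : IsIso (comp P (id T)) P := by
  refine IsIso.mk'
    (mkHom (X := posObj _ _ _ _) (fun x => Pos.a x) fun _ _ => rfl)
    (mkHom (X := secObj _ _ _) (fun x => Sec.sec x (Sec.pt x) rfl) fun a x =>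
      Sec.smul_sec_smul a x _ _ _)
    (fun a => (⟨⟨ap P.h (ap P.g a), fun _ _ => ap P.g a, fun _ hc => hc.symm⟩,
      ap P.h (ap P.g a), rfl, a, rfl⟩ : Pos (𝟙 T) (𝟙 T) P.g P.h))
    (fun b => (⟨ap P.h b, fun _ _ => b, fun _ hc => hc.symm⟩ : Sec (𝟙 T) (𝟙 T) P.h))
    ?_ (fun _ => rfl) ?_ (fun _ => rfl) (fun _ => rfl) ?_ ?_
  · intro x
    change Pos _ _ _ _ at x
    have h₁ : ap P.h (ap P.g x.a) = x.c := by rw [x.ha, x.sh.lies]; rfl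
    have h₂ : x.c = x.sh.pt := x.hc
    refine Pos.ext' (Sec.ext' (h₁.trans h₂) fun c _ hy => ?_) h₁ rfl
    exact x.ha.trans (Sec.sec_congr _ (h₂.trans hy.symm) _ _)
  · intro x
    change Sec _ _ _ at x
    refine Sec.ext' (x.lies _ _) fun c _ hy => ?_
    exact Sec.sec_congr _ hy.symm _ _
  · intro x
    change Pos _ _ _ _ at x
    exact x.ha.trans (Sec.sec_congr _ x.hc _ _)
  · intro x
    change Sec _ _ _ at x
    exact x.lies _ _

lemma assoc {S T U V : FinGSet G} (P : Bispan S T) (Q : Bispan T U) (R : Bispan U V) :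
    IsIso (comp (comp P Q) R) (comp P (comp Q R)) := by
  let F : Sec R.g R.f (comp P Q).h → Sec (comp Q R).g (comp Q R).f P.h := fun x =>
    { pt := (⟨x.pt, fun e he => (x.sec e he).pt, fun e he => x.lies e he⟩ : Sec R.g R.f Q.h)
      sec := fun (z : Pos R.g R.f Q.g Q.h) (hz : z.sh = _) =>
        (x.sec z.c (z.hc.trans (congrArg Sec.pt hz))).sec z.a
          (z.ha.trans (Sec.sec_congr' hz rfl _ _))
      lies := fun z hz => Sec.lies _ _ _ }
  let I : Sec (comp Q R).g (comp Q R).f P.h → Sec R.g R.f (comp P Q).h := fun y =>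
    { pt := Sec.pt y.pt
      sec := fun e he => (⟨(y.pt : Sec R.g R.f Q.h).sec e he, fun c hc =>
        y.sec (⟨y.pt, e, he, c, hc⟩ : Pos R.g R.f Q.g Q.h) rfl, fun c hc => y.lies _ _⟩ :
          Sec Q.g Q.f P.h)
      lies := fun e he => (y.pt : Sec R.g R.f Q.h).lies e he }
  have IF : ∀ x, I (F x) = x := fun x => rfl
  have FI : ∀ y, F (I y) = y := fun y => by
    refine Sec.ext' rfl fun z hx hy => ?_
    change Pos R.g R.f Q.g Q.h at z
    refine Sec.sec_congr y ?_ _ _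
    exact Pos.ext' hy.symm rfl rfl
  have Fsm : ∀ (a : G) x, F (a • x) = a • F x := by
    intro a x
    refine Sec.ext' (Sec.ext' rfl fun e _ _ => rfl) fun z hx hy => ?_
    rfl
  let F₁ : Pos R.g R.f (comp P Q).g (comp P Q).h →
      Pos (comp Q R).g (comp Q R).f P.g P.h := fun x =>
    { sh := F x.sh
      c := (⟨(F x.sh).pt, x.c, x.hc, (x.a : Pos Q.g Q.f P.g P.h).c,
        (x.a : Pos Q.g Q.f P.g P.h).hc.trans (congrArg Sec.pt x.ha)⟩ : Pos R.g R.f Q.g Q.h)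
      hc := rfl
      a := (x.a : Pos Q.g Q.f P.g P.h).a
      ha := (x.a : Pos Q.g Q.f P.g P.h).ha.trans (Sec.sec_congr' x.ha rfl _ _) }
  let I₁ : Pos (comp Q R).g (comp Q R).f P.g P.h →
      Pos R.g R.f (comp P Q).g (comp P Q).h := fun y =>
    { sh := I y.sh
      c := (y.c : Pos R.g R.f Q.g Q.h).c
      hc := (y.c : Pos R.g R.f Q.g Q.h).hc.trans (congrArg Sec.pt y.hc)
      a := (⟨(I y.sh).sec (y.c : Pos R.g R.f Q.g Q.h).c
          ((y.c : Pos R.g R.f Q.g Q.h).hc.trans (congrArg Sec.pt y.hc)),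
        (y.c : Pos R.g R.f Q.g Q.h).a,
        (y.c : Pos R.g R.f Q.g Q.h).ha.trans (Sec.sec_congr' y.hc rfl _ _), y.a,
        y.ha.trans (Sec.sec_congr y.sh (c := y.c) (Pos.eq_mk (z := y.c) (s := y.sh.pt) y.hc _ _) _ _)⟩ : Pos Q.g Q.f P.g P.h)
      ha := rfl }
  refine IsIso.mk' (P := comp (comp P Q) R) (Q := comp P (comp Q R))
    (mkHom (X := posObj _ _ _ _) (Y := posObj _ _ _ _) F₁ ?_)
    (mkHom (X := secObj _ _ _) (Y := secObj _ _ _) F Fsm) I₁ I ?_ ?_ IF FI ?_ ?_ ?_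
  · intro a x
    exact Pos.ext' (Fsm a x.sh) (Pos.ext' rfl rfl rfl) rfl
  · intro x
    exact Pos.ext' rfl rfl (Pos.ext' (Pos.ha x).symm rfl rfl)
  · intro y
    exact Pos.ext' (FI _) (Pos.ext' (Pos.hc y).symm rfl rfl) rfl
  · intro x
    rfl
  · intro x
    rfl
  · intro x
    rfl

lemma comp_congr {S T U : FinGSet G} {P P' : Bispan S T} {Q Q' : Bispan T U}
    (hP : IsIso P P') (hQ : IsIso Q Q') : IsIso (comp P Q) (comp P' Q') := by
  obtain ⟨a₁, a₂, hf, hg, hh⟩ := hP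
  obtain ⟨b₁, b₂, kf, kg, kh⟩ := hQ
  have hf := ap_congr hf
  have hg := ap_congr hg
  have hh := ap_congr hh
  have kf := ap_congr kf
  have kg := ap_congr kg
  have kh := ap_congr kh
  simp only [ap_comp] at hf hg hh kf kg kh
  have kg' : ∀ c, ap b₂.inv (ap Q'.g c) = ap Q.g (ap b₁.inv c) := fun c => by
    rw [← ap_hom_inv b₂ (ap Q.g _), ← kg, ap_inv_hom]
  have kf' : ∀ c, ap Q'.f c = ap Q.f (ap b₁.inv c) := fun c => by
    rw [← kf, ap_inv_hom]
  have hg' : ∀ c, ap a₂.inv (ap P'.g c) = ap P.g (ap a₁.inv c) := fun c => by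
    rw [← ap_hom_inv a₂ (ap P.g _), ← hg, ap_inv_hom]
  have hh' : ∀ c, ap P'.h c = ap P.h (ap a₂.inv c) := fun c => by
    rw [← hh, ap_inv_hom]
  let F : Sec Q.g Q.f P.h → Sec Q'.g Q'.f P'.h := fun x =>
    { pt := ap b₂.hom x.pt
      sec := fun c hc => ap a₂.hom (x.sec (ap b₁.inv c) (by rw [← kg', hc, ap_hom_inv]))
      lies := fun c hc => by rw [hh, x.lies, kf'] }
  let I : Sec Q'.g Q'.f P'.h → Sec Q.g Q.f P.h := fun x =>
    { pt := ap b₂.inv x.pt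
      sec := fun c hc => ap a₂.inv (x.sec (ap b₁.hom c) (by rw [kg, hc, ap_inv_hom]))
      lies := fun c hc => by rw [← hh', x.lies, kf] }
  have IF : ∀ x, I (F x) = x := fun x => by
    refine Sec.ext' (ap_hom_inv b₂ _) fun c _ hy => ?_
    exact (ap_hom_inv a₂ _).trans (Sec.sec_congr _ (ap_hom_inv b₁ _) _ _)
  have FI : ∀ x, F (I x) = x := fun x => by
    refine Sec.ext' (ap_inv_hom b₂ _) fun c _ hy => ?_
    exact (ap_inv_hom a₂ _).trans (Sec.sec_congr _ (ap_inv_hom b₁ _) _ _)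
  have Fsm : ∀ (a : G) x, F (a • x) = a • F x := by
    intro a x
    refine Sec.ext' (ap_smul b₂.hom a x.pt) fun c _ _ => ?_
    exact (ap_smul a₂.hom a _).trans
      (congrArg (a • ·) (congrArg (ap a₂.hom) (Sec.sec_congr _ (ap_smul b₁.inv _ _).symm _ _)))
  let F₁ : Pos Q.g Q.f P.g P.h → Pos Q'.g Q'.f P'.g P'.h := fun x =>
    { sh := F x.sh
      c := ap b₁.hom x.c
      hc := by rw [kg, x.hc]
      a := ap a₁.hom x.a
      ha := by
        rw [hg, x.ha]
        exact congrArg (ap a₂.hom) (Sec.sec_congr _ (ap_hom_inv b₁ _).symm _ _) }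
  let I₁ : Pos Q'.g Q'.f P'.g P'.h → Pos Q.g Q.f P.g P.h := fun x =>
    { sh := I x.sh
      c := ap b₁.inv x.c
      hc := by rw [← kg', x.hc]
      a := ap a₁.inv x.a
      ha := by
        rw [← hg', x.ha]
        exact congrArg (ap a₂.inv) (Sec.sec_congr _ (ap_inv_hom b₁ _).symm _ _) }
  refine IsIso.mk' (P := comp P Q) (Q := comp P' Q')
    (mkHom (X := posObj _ _ _ _) (Y := posObj _ _ _ _) F₁ ?_)
    (mkHom (X := secObj _ _ _) (Y := secObj _ _ _) F Fsm) I₁ I ?_ ?_ IF FI ?_ ?_ ?_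
  · intro a x
    exact Pos.ext' (Fsm a x.sh) (ap_smul b₁.hom a _) (ap_smul a₁.hom a _)
  · intro x
    exact Pos.ext' (IF _) (ap_hom_inv b₁ _) (ap_hom_inv a₁ _)
  · intro y
    exact Pos.ext' (FI _) (ap_inv_hom b₁ _) (ap_inv_hom a₁ _)
  · intro x
    exact hf _
  · intro x
    rfl
  · intro x
    exact kh _

end Bispan

variable (G) in
/-- The category of polynomials: objects are finite `G`-sets, and morphisms are isomorphism classes
of polynomials. -/
structure PolyCat where
  obj : FinGSet G

namespace PolyCat

instance : Category (PolyCat G) where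
  Hom X Y := Quotient (Bispan.setoid X.obj Y.obj)
  id X := ⟦Bispan.id X.obj⟧
  comp := Quotient.map₂ Bispan.comp fun _ _ hP _ _ hQ => Bispan.comp_congr hP hQ
  id_comp := by
    rintro X Y ⟨Q⟩
    exact Quotient.sound (Bispan.id_comp Q)
  comp_id := by
    rintro X Y ⟨P⟩
    exact Quotient.sound (Bispan.comp_id P)
  assoc := by
    rintro X Y Z W ⟨P⟩ ⟨Q⟩ ⟨R⟩
    exact Quotient.sound (Bispan.assoc P Q R)

/-- The morphism represented by a polynomial. -/
def ofBispan {X Y : PolyCat G} (P : Bispan X.obj Y.obj) : X ⟶ Y := Quotient.mk _ P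

end PolyCat
end

section
variable {G : Type u} [Group G]

/-- An indexing category: a wide, pullback stable, finite coproduct complete subcategory of the
category of finite `G`-sets, given by its class of morphisms. -/
class IsIndexingCategory (O : MorphismProperty (FinGSet G)) : Prop
    extends O.IsMultiplicative, O.IsStableUnderBaseChange where
  fromEmpty_mem : ∀ X, O (fromEmpty X)
  inl_mem : ∀ X Y, O (inl X Y)
  inr_mem : ∀ X Y, O (inr X Y)
  desc_mem : ∀ {X Y Z : FinGSet G} (f : X ⟶ Z) (g : Y ⟶ Z), O f → O g → O (desc f g)

/-- The pair `(Oa, Om)` is compatible if `Om` distributes over `Oa`: the dependent product along a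
map `g : S ⟶ T` of `Om` sends objects `h : X ⟶ S` of `(Oa)_{/S}` to objects of `(Oa)_{/T}`. -/
class Compatible (Oa Om : MorphismProperty (FinGSet G)) : Prop where
  depProdHom_mem : ∀ {X S T : FinGSet G} (g : S ⟶ T) (h : X ⟶ S), Om g → Oa h →
    Oa (depProdHom g h)

namespace IsIndexingCategory

variable (O : MorphismProperty (FinGSet G)) [IsIndexingCategory O]

lemma fold_mem (X : FinGSet G) : O (fold X) := desc_mem _ _ (O.id_mem X) (O.id_mem X)

variable {O}

lemma sumMap_mem {X X' Y Y' : FinGSet G} {f : X ⟶ X'} {g : Y ⟶ Y'} (hf : O f) (hg : O g) :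
    O (sumMap f g) :=
  desc_mem _ _ (O.comp_mem _ _ hf (inl_mem _ _)) (O.comp_mem _ _ hg (inr_mem _ _))

lemma prodMap_mem {X X' Y Y' : FinGSet G} {f : X ⟶ X'} {g : Y ⟶ Y'} (hf : O f) (hg : O g) :
    O (prodMap f g) := by
  have h₁ : IsPullback (fst X Y) (prodMap f (𝟙 Y)) f (fst X' Y) := by
    refine isPullback_of (fun _ => rfl) ?_ ?_
    · rintro z z' h h'
      exact Prod.ext h ((Prod.ext_iff (α := X'.V) (β := Y.V)).1 h').2
    · rintro x y h
      exact ⟨(x, y.2), rfl, Prod.ext h rfl⟩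
  have h₂ : IsPullback (snd X' Y) (prodMap (𝟙 X') g) g (snd X' Y') := by
    refine isPullback_of (fun _ => rfl) ?_ ?_
    · rintro z z' h h'
      exact Prod.ext ((Prod.ext_iff (α := X'.V) (β := Y'.V)).1 h').1 h
    · rintro x y h
      exact ⟨(y.1, x), rfl, Prod.ext rfl h⟩
  exact O.comp_mem _ _ (O.of_isPullback h₁ hf) (O.of_isPullback h₂ hg)

end IsIndexingCategory

namespace FinGSet

instance pbAction {X Y Z : FinGSet G} (f : X ⟶ Z) (g : Y ⟶ Z) :
    MulAction G {z : X.V × Y.V // ap f z.1 = ap g z.2} where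
  smul a z := ⟨(a • z.1.1, a • z.1.2), by rw [ap_smul, ap_smul, z.2]⟩
  one_smul z := Subtype.ext (one_smul G z.1)
  mul_smul a b z := Subtype.ext (mul_smul a b z.1)

/-- The fibre product of finite `G`-sets. -/
def pb {X Y Z : FinGSet G} (f : X ⟶ Z) (g : Y ⟶ Z) : FinGSet G :=
  of {z : X.V × Y.V // ap f z.1 = ap g z.2}

/-- The first projection of the fibre product. -/
def pbFst {X Y Z : FinGSet G} (f : X ⟶ Z) (g : Y ⟶ Z) : pb f g ⟶ X :=
  mkHom (X := pb f g) (fun z => z.1.1) fun _ _ => rfl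

/-- The second projection of the fibre product. -/
def pbSnd {X Y Z : FinGSet G} (f : X ⟶ Z) (g : Y ⟶ Z) : pb f g ⟶ Y :=
  mkHom (X := pb f g) (fun z => z.1.2) fun _ _ => rfl

lemma isPullback_pb {X Y Z : FinGSet G} (f : X ⟶ Z) (g : Y ⟶ Z) :
    IsPullback (pbFst f g) (pbSnd f g) f g := by
  refine isPullback_of (fun z => z.2) ?_ ?_
  · intro z z' h h'
    exact Subtype.ext (Prod.ext h h')
  · intro x y h
    exact ⟨⟨(x, y), h⟩, rfl, rfl⟩

/-- The universal property of the dependent product, as right adjoint to pullback along `g`: maps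
`Y ⟶ Π_g X` over `T` correspond to maps `Y ×_T S ⟶ X` over `S`. -/
def depProdEquiv {X Y S T : FinGSet G} (g : S ⟶ T) (h : X ⟶ S) (y : Y ⟶ T) :
    {k : Y ⟶ depProd g h // k ≫ depProdHom g h = y} ≃
      {l : pb y g ⟶ X // l ≫ h = pbSnd y g} where
  toFun k := ⟨mkHom (X := pb y g)
      (fun z => Sec.sec (ap k.1 z.1.1) z.1.2 (z.2.symm.trans (ap_congr k.2 z.1.1).symm))
      fun a z => (Sec.sec_congr' (ap_smul k.1 a z.1.1) rfl _ ((congrArg (ap g) rfl).trans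
        ((ap_smul g a z.1.2).trans (congrArg (a • ·)
          (z.2.symm.trans (ap_congr k.2 z.1.1).symm))))).trans (Sec.smul_sec_smul a _ _ _ _),
    hom_ext fun z => Sec.lies (ap k.1 z.1.1) z.1.2 _⟩
  invFun l := ⟨mkHom (Y := depProd g h)
      (fun v => (⟨ap y v, fun s hs => ap l.1 ⟨(v, s), hs.symm⟩, fun s hs => ap_congr l.2 _⟩ :
        Sec g (𝟙 S) h))
      fun a v => Sec.ext' (ap_smul y a v) fun s hs hs' => by
        refine Eq.trans (congrArg (ap l.1) (?_ : _ = a • (⟨(v, a⁻¹ • s), _⟩ : {z : Y.V × S.V // _}))) (ap_smul l.1 a _)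
        exact Subtype.ext (Prod.ext rfl (smul_inv_smul a s).symm), hom_ext fun v => rfl⟩
  left_inv k := Subtype.ext (hom_ext fun v => Sec.ext' (ap_congr k.2 v).symm fun _ _ _ => rfl)
  right_inv l := rfl

lemma secPt_mem {Oa Om : MorphismProperty (FinGSet G)} [IsIndexingCategory Oa] [Compatible Oa Om]
    {B C D T : FinGSet G} (q : C ⟶ D) (p : C ⟶ T) (h : B ⟶ T) (hq : Om q) (hh : Oa h) :
    Oa (secPt q p h) := by
  have h₁ : Oa (pbFst p h) := Oa.of_isPullback (isPullback_pb p h).flip hh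
  have h₂ := Compatible.depProdHom_mem q _ hq h₁
  let F : secObj q p h ⟶ depProd q (pbFst p h) :=
    mkHom (X := secObj q p h) (Y := depProd q (pbFst p h))
      (fun (x : Sec q p h) => (⟨x.pt, fun c hc => ⟨(c, x.sec c hc), (x.lies c hc).symm⟩,
        fun _ _ => rfl⟩ : Sec q (𝟙 C) (pbFst p h)))
      fun a x => Sec.ext' rfl fun c hx hy =>
        Subtype.ext (Prod.ext (smul_inv_smul a c).symm rfl)
  let I : (depProd q (pbFst p h)).V → (secObj q p h).V := fun (y : Sec q (𝟙 C) (pbFst p h)) =>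
    (⟨y.pt, fun c hc => (y.sec c hc).1.2, fun c hc =>
      (y.sec c hc).2.symm.trans (congrArg (ap p) (y.lies c hc))⟩ : Sec q p h)
  let e := mkIso F I (fun _ => rfl) fun y => Sec.ext' rfl fun c hx hy =>
    Subtype.ext (Prod.ext (Sec.lies y c hx).symm rfl)
  have : secPt q p h = e.hom ≫ depProdHom q (pbFst p h) := rfl
  rw [this]
  exact Oa.comp_mem _ _ (MorphismProperty.of_isIso Oa _) h₂

lemma posHom_mem {Om : MorphismProperty (FinGSet G)} [IsIndexingCategory Om]
    {S T U : FinGSet G} (P : Bispan S T) (Q : Bispan T U) (hP : Om P.g) (hQ : Om Q.g) :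
    Om (P.comp Q).g := by
  let M := pb (secPt Q.g Q.f P.h) Q.g
  have h₁ : Om (pbFst (secPt Q.g Q.f P.h) Q.g) := Om.of_isPullback (isPullback_pb _ _).flip hQ
  let ev : M ⟶ P.U₂ := mkHom (X := M)
    (fun z => Sec.sec (z.1.1 : Sec Q.g Q.f P.h) z.1.2 z.2.symm) fun a z =>
      Sec.smul_sec_smul a z.1.1 _ _ _
  let k : (P.comp Q).U₁ ⟶ M := mkHom (X := (P.comp Q).U₁) (Y := M)
    (fun (x : Pos Q.g Q.f P.g P.h) => ⟨(x.sh, x.c), x.hc.symm⟩) fun _ _ => rfl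
  let l : (P.comp Q).U₁ ⟶ P.U₁ := mkHom (X := (P.comp Q).U₁)
    (fun (x : Pos Q.g Q.f P.g P.h) => x.a) fun _ _ => rfl
  have hk : IsPullback l k P.g ev := by
    refine isPullback_of (fun x => Pos.ha x) ?_ ?_
    · intro x x' h h'
      have h' := congrArg Subtype.val h'
      exact Pos.ext' (congrArg Prod.fst h') (congrArg Prod.snd h') h
    · intro a z h
      exact ⟨(⟨z.1.1, z.1.2, z.2.symm, a, h⟩ : Pos Q.g Q.f P.g P.h), rfl, rfl⟩
  exact Om.comp_mem k _ (Om.of_isPullback hk hP) h₁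

end FinGSet

/-- The morphisms of `PolyCat G` represented by a polynomial `X ← U₁ →g U₂ →h Y` with `g` in `Om`
and `h` in `Oa`. -/
def polyProp (Oa Om : MorphismProperty (FinGSet G)) : MorphismProperty (PolyCat G) :=
  fun X Y φ => ∃ P : Bispan X.obj Y.obj, Om P.g ∧ Oa P.h ∧ PolyCat.ofBispan P = φ

instance (Oa Om : MorphismProperty (FinGSet G)) [IsIndexingCategory Oa] [IsIndexingCategory Om]
    [Compatible Oa Om] : (polyProp Oa Om).IsMultiplicative where
  id_mem X := ⟨Bispan.id X.obj, Om.id_mem _, Oa.id_mem _, rfl⟩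
  comp_mem := by
    rintro X Y Z _ _ ⟨P, hP, hP', rfl⟩ ⟨Q, hQ, hQ', rfl⟩
    exact ⟨P.comp Q, posHom_mem P Q hP hQ, Oa.comp_mem _ _ (secPt_mem (Om := Om) _ _ _ hQ hP') hQ',
      rfl⟩

/-- The category of polynomials with norms in `Om` and transfers in `Oa`, as a wide subcategory of
the category of all polynomials. -/
abbrev BiPoly (Oa Om : MorphismProperty (FinGSet G)) [IsIndexingCategory Oa] [IsIndexingCategory Om]
    [Compatible Oa Om] := WideSubcategory (polyProp Oa Om)

end

section
variable {G : Type u} [Group G]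

namespace FinGSet

lemma isPullback_inl {X X' Y Y' : FinGSet G} (f : X ⟶ X') (g : Y ⟶ Y') :
    IsPullback (inl X Y) f (sumMap f g) (inl X' Y') := by
  refine isPullback_of (fun _ => rfl) (fun _ _ h _ => inl_inj h) fun z x h => ?_
  rcases sum_cases z with ⟨y, rfl⟩ | ⟨y, rfl⟩
  · exact ⟨y, rfl, inl_inj h⟩
  · exact (inl_ne_inr h.symm).elim

lemma isPullback_inr {X X' Y Y' : FinGSet G} (f : X ⟶ X') (g : Y ⟶ Y') :
    IsPullback (inr X Y) g (sumMap f g) (inr X' Y') := by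
  refine isPullback_of (fun _ => rfl) (fun _ _ h _ => inr_inj h) fun z x h => ?_
  rcases sum_cases z with ⟨y, rfl⟩ | ⟨y, rfl⟩
  · exact (inl_ne_inr h).elim
  · exact ⟨y, rfl, inr_inj h⟩

lemma isPullback_fold {X Y : FinGSet G} (f : X ⟶ Y) :
    IsPullback (sumMap f f) (fold X) (fold Y) f := by
  refine isPullback_of (fun z => ?_) (fun z z' h h' => ?_) fun z x h => ?_
  · rcases sum_cases z with ⟨y, rfl⟩ | ⟨y, rfl⟩ <;> rfl
  · rcases sum_cases z with ⟨y, rfl⟩ | ⟨y, rfl⟩ <;> rcases sum_cases z' with ⟨y', rfl⟩ | ⟨y', rfl⟩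
    · exact congrArg _ h'
    · exact (inl_ne_inr h).elim
    · exact (inl_ne_inr h.symm).elim
    · exact congrArg _ h'
  · rcases sum_cases z with ⟨y, rfl⟩ | ⟨y, rfl⟩
    · exact ⟨ap (inl X X) x, congrArg (ap (inl Y Y)) h.symm, rfl⟩
    · exact ⟨ap (inr X X) x, congrArg (ap (inr Y Y)) h.symm, rfl⟩

lemma isPullback_prodMap {P X Y Z P' X' Y' Z' : FinGSet G}
    {p : P ⟶ X} {q : P ⟶ Y} {f : X ⟶ Z} {g : Y ⟶ Z}
    {p' : P' ⟶ X'} {q' : P' ⟶ Y'} {f' : X' ⟶ Z'} {g' : Y' ⟶ Z'}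
    (h : IsPullback p q f g) (h' : IsPullback p' q' f' g') :
    IsPullback (prodMap p p') (prodMap q q') (prodMap f f') (prodMap g g') := by
  obtain ⟨i, s⟩ := isPullback_types h
  obtain ⟨i', s'⟩ := isPullback_types h'
  refine isPullback_of (fun z => Prod.ext (ap_congr h.w _) (ap_congr h'.w _)) ?_ ?_
  · intro z z' e e'
    have e := (Prod.ext_iff (α := X.V) (β := X'.V)).1 e
    have e' := (Prod.ext_iff (α := Y.V) (β := Y'.V)).1 e'
    exact Prod.ext (i _ _ e.1 e'.1) (i' _ _ e.2 e'.2)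
  · intro x y e
    have e := (Prod.ext_iff (α := Z.V) (β := Z'.V)).1 e
    obtain ⟨z, hz⟩ := s x.1 y.1 e.1
    obtain ⟨z', hz'⟩ := s' x.2 y.2 e.2
    exact ⟨(z, z'), Prod.ext hz.1 hz'.1, Prod.ext hz.2 hz'.2⟩

end FinGSet

namespace Bispan

lemma IsIso.of_bijective {S T : FinGSet G} {P Q : Bispan S T} (F₁ : P.U₁ ⟶ Q.U₁) (F₂ : P.U₂ ⟶ Q.U₂)
    (h₁ : Function.Bijective (ap F₁)) (h₂ : Function.Bijective (ap F₂))
    (hf : ∀ x, ap Q.f (ap F₁ x) = ap P.f x) (hg : ∀ x, ap Q.g (ap F₁ x) = ap F₂ (ap P.g x))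
    (hh : ∀ x, ap Q.h (ap F₂ x) = ap P.h x) : IsIso P Q := by
  obtain ⟨I₁, a₁, b₁⟩ := Function.bijective_iff_has_inverse.1 h₁
  obtain ⟨I₂, a₂, b₂⟩ := Function.bijective_iff_has_inverse.1 h₂
  exact IsIso.mk' F₁ F₂ I₁ I₂ a₁ b₁ a₂ b₂ hf hg hh

/-- The polynomial `R_f`. -/
def res {X Y : FinGSet G} (f : X ⟶ Y) : Bispan Y X := ⟨X, X, f, 𝟙 X, 𝟙 X⟩

/-- The polynomial `N_g`. -/
def nm {X Y : FinGSet G} (g : X ⟶ Y) : Bispan X Y := ⟨X, Y, 𝟙 X, g, 𝟙 Y⟩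

lemma comp_res {W X Z : FinGSet G} (P : Bispan W Z) (i : X ⟶ Z) (P' : Bispan W X)
    (j₁ : P'.U₁ ⟶ P.U₁) (j₂ : P'.U₂ ⟶ P.U₂) (hf : j₁ ≫ P.f = P'.f)
    (hg : IsPullback j₁ P'.g P.g j₂) (hh : IsPullback j₂ P'.h P.h i) :
    IsIso P' (P.comp (res i)) := by
  obtain ⟨ig, sg⟩ := isPullback_types hg
  obtain ⟨ih, sh⟩ := isPullback_types hh
  have wg := ap_congr hg.w
  have wh := ap_congr hh.w
  let F₂ : P'.U₂.V → Sec (𝟙 X) i P.h := fun v =>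
    ⟨ap P'.h v, fun _ _ => ap j₂ v, fun c hc => (wh v).trans (congrArg (ap i) hc.symm)⟩
  let F₁ : P'.U₁.V → Pos (𝟙 X) i P.g P.h := fun v =>
    ⟨F₂ (ap P'.g v), ap P'.h (ap P'.g v), rfl, ap j₁ v, wg v⟩
  have F₂sm : ∀ (a : G) v, F₂ (a • v) = a • F₂ v := fun a v =>
    Sec.ext' (ap_smul P'.h a v) fun _ _ _ => ap_smul j₂ a v
  refine IsIso.of_bijective (P := P') (Q := P.comp (res i))
    (mkHom (Y := posObj _ _ _ _) F₁ fun a v => ?_) (mkHom (Y := secObj _ _ _) F₂ F₂sm)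
    ⟨?_, ?_⟩ ⟨?_, ?_⟩ (ap_congr hf) (fun _ => rfl) fun _ => rfl
  · exact Pos.ext' ((congrArg F₂ (ap_smul P'.g a v)).trans (F₂sm a _))
      ((congrArg (ap P'.h) (ap_smul P'.g a v)).trans (ap_smul P'.h a _)) (ap_smul j₁ a v)
  · intro v v' e
    have e₁ : F₂ (ap P'.g v) = F₂ (ap P'.g v') := congrArg Pos.sh e
    have e₂ : ap j₁ v = ap j₁ v' := congrArg Pos.a e
    refine ig _ _ e₂ (ih _ _ ?_ (congrArg Sec.pt e₁))
    exact (wg v).symm.trans ((congrArg (ap P.g) e₂).trans (wg v'))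
  · intro (x : Pos (𝟙 X) i P.g P.h)
    obtain ⟨v, hv, hv'⟩ := sh _ _ (x.sh.lies x.c x.hc)
    obtain ⟨u, hu, hu'⟩ := sg _ _ (x.ha.trans hv.symm)
    have hx : x.c = x.sh.pt := x.hc
    refine ⟨u, Pos.ext' (Sec.ext' ?_ fun c hc hc' => ?_) ?_ hu⟩
    · exact (congrArg (ap P'.h) hu').trans (hv'.trans hx)
    · refine (congrArg (ap j₂) hu').trans (hv.trans (Sec.sec_congr _ (hx.trans hc'.symm) _ _))
    · exact (congrArg (ap P'.h) hu').trans hv'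
  · intro v v' e
    refine ih _ _ ?_ (congrArg Sec.pt e)
    exact Sec.sec_congr' (q := 𝟙 X) (p := i) (h := P.h) (x := F₂ v) (y := F₂ v') e
      (c := ap P'.h v) (c' := ap P'.h v') (congrArg Sec.pt e) rfl rfl
  · intro (x : Sec (𝟙 X) i P.h)
    obtain ⟨v, hv, hv'⟩ := sh _ _ (x.lies x.pt rfl)
    refine ⟨v, Sec.ext' hv' fun c hc hc' => ?_⟩
    exact hv.trans (Sec.sec_congr _ (Eq.symm hc') _ _)

/-- The polynomial `W ← U₁ ⨿ V₁ → U₂ ⨿ V₂ → X ⨿ Y`. -/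
def pairing {W X Y : FinGSet G} (P : Bispan W X) (Q : Bispan W Y) : Bispan W (sum X Y) :=
  ⟨sum P.U₁ Q.U₁, sum P.U₂ Q.U₂, desc P.f Q.f, sumMap P.g Q.g, sumMap P.h Q.h⟩

lemma pairing_inl {W X Y : FinGSet G} (P : Bispan W X) (Q : Bispan W Y) :
    IsIso P ((pairing P Q).comp (res (inl X Y))) :=
  comp_res (pairing P Q) (inl X Y) P (inl _ _) (inl _ _) rfl (isPullback_inl _ _)
    (isPullback_inl _ _)

lemma pairing_inr {W X Y : FinGSet G} (P : Bispan W X) (Q : Bispan W Y) :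
    IsIso Q ((pairing P Q).comp (res (inr X Y))) :=
  comp_res (pairing P Q) (inr X Y) Q (inr _ _) (inr _ _) rfl (isPullback_inr _ _)
    (isPullback_inr _ _)

lemma desc_bijective {X Y Z : FinGSet G} (f : X ⟶ Z) (g : Y ⟶ Z)
    (hf : Function.Injective (ap f)) (hg : Function.Injective (ap g))
    (hfg : ∀ x y, ap f x ≠ ap g y) (s : ∀ z, (∃ x, ap f x = z) ∨ ∃ y, ap g y = z) :
    Function.Bijective (ap (desc f g)) := by
  constructor
  · intro z z' h
    rcases sum_cases z with ⟨y, rfl⟩ | ⟨y, rfl⟩ <;> rcases sum_cases z' with ⟨y', rfl⟩ | ⟨y', rfl⟩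
    · exact congrArg _ (hf h)
    · exact (hfg _ _ h).elim
    · exact (hfg _ _ h.symm).elim
    · exact congrArg _ (hg h)
  · intro z
    rcases s z with ⟨x, rfl⟩ | ⟨y, rfl⟩
    · exact ⟨ap (inl X Y) x, rfl⟩
    · exact ⟨ap (inr X Y) y, rfl⟩

/-- The restriction of a polynomial along `i : X ⟶ Z`. -/
def restrict {W X Z : FinGSet G} (P : Bispan W Z) (i : X ⟶ Z) : Bispan W X :=
  ⟨pb P.g (pbFst P.h i), pb P.h i, pbFst _ _ ≫ P.f, pbSnd _ _, pbSnd _ _⟩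

lemma comp_res_restrict {W X Z : FinGSet G} (P : Bispan W Z) (i : X ⟶ Z) :
    IsIso (P.restrict i) (P.comp (res i)) :=
  comp_res P i (P.restrict i) (pbFst _ _) (pbFst _ _) rfl (isPullback_pb _ _) (isPullback_pb _ _)

lemma pairing_restrict {W X Y : FinGSet G} (P : Bispan W (sum X Y)) :
    IsIso (pairing (P.restrict (inl X Y)) (P.restrict (inr X Y))) P := by
  refine IsIso.of_bijective (desc (pbFst _ _) (pbFst _ _)) (desc (pbFst _ _) (pbFst _ _)) ?_ ?_
    ?_ ?_ ?_
  · refine desc_bijective _ _ ?_ ?_ ?_ ?_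
    · intro x y h
      refine Subtype.ext (Prod.ext h (Subtype.ext (Prod.ext ?_ (inl_inj (Y := Y) ?_))))
      · exact x.2.symm.trans ((congrArg (ap P.g) h).trans y.2)
      · exact x.1.2.2.symm.trans ((congrArg (ap P.h)
          (x.2.symm.trans ((congrArg (ap P.g) h).trans y.2))).trans y.1.2.2)
    · intro x y h
      refine Subtype.ext (Prod.ext h (Subtype.ext (Prod.ext ?_ (inr_inj (X := X) ?_))))
      · exact x.2.symm.trans ((congrArg (ap P.g) h).trans y.2)
      · exact x.1.2.2.symm.trans ((congrArg (ap P.h)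
          (x.2.symm.trans ((congrArg (ap P.g) h).trans y.2))).trans y.1.2.2)
    · intro x y h
      exact inl_ne_inr (x.1.2.2.symm.trans ((congrArg (ap P.h)
          (x.2.symm.trans ((congrArg (ap P.g) h).trans y.2))).trans y.1.2.2))
    · intro z
      rcases sum_cases (ap P.h (ap P.g z)) with ⟨x, hx⟩ | ⟨x, hx⟩
      · exact Or.inl ⟨⟨(z, ⟨(ap P.g z, x), hx⟩), rfl⟩, rfl⟩
      · exact Or.inr ⟨⟨(z, ⟨(ap P.g z, x), hx⟩), rfl⟩, rfl⟩
  · refine desc_bijective _ _ ?_ ?_ ?_ ?_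
    · intro x y h
      exact Subtype.ext (Prod.ext h (inl_inj (x.2.symm.trans ((congrArg (ap P.h) h).trans y.2))))
    · intro x y h
      exact Subtype.ext (Prod.ext h (inr_inj (x.2.symm.trans ((congrArg (ap P.h) h).trans y.2))))
    · intro x y h
      exact inl_ne_inr (x.2.symm.trans ((congrArg (ap P.h) h).trans y.2))
    · intro z
      rcases sum_cases (ap P.h z) with ⟨x, hx⟩ | ⟨x, hx⟩
      · exact Or.inl ⟨⟨(z, x), hx⟩, rfl⟩
      · exact Or.inr ⟨⟨(z, x), hx⟩, rfl⟩
  · intro z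
    rcases sum_cases z with ⟨x, rfl⟩ | ⟨x, rfl⟩ <;> rfl
  · intro z
    rcases sum_cases z with ⟨x, rfl⟩ | ⟨x, rfl⟩
    · exact x.2
    · exact x.2
  · intro z
    rcases sum_cases z with ⟨x, rfl⟩ | ⟨x, rfl⟩
    · exact x.2
    · exact x.2

lemma pairing_congr {W X Y : FinGSet G} {P P' : Bispan W X} {Q Q' : Bispan W Y}
    (hP : IsIso P P') (hQ : IsIso Q Q') : IsIso (pairing P Q) (pairing P' Q') := by
  obtain ⟨a₁, a₂, hf, hg, hh⟩ := hP
  obtain ⟨b₁, b₂, kf, kg, kh⟩ := hQ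
  refine IsIso.mk' (sumMap a₁.hom b₁.hom) (sumMap a₂.hom b₂.hom) (ap (sumMap a₁.inv b₁.inv))
    (ap (sumMap a₂.inv b₂.inv)) ?_ ?_ ?_ ?_ ?_ ?_ ?_
  all_goals
    intro z
    rcases sum_cases z with ⟨x, rfl⟩ | ⟨x, rfl⟩
  · exact congrArg (ap (inl _ _)) (ap_hom_inv a₁ x)
  · exact congrArg (ap (inr _ _)) (ap_hom_inv b₁ x)
  · exact congrArg (ap (inl _ _)) (ap_inv_hom a₁ x)
  · exact congrArg (ap (inr _ _)) (ap_inv_hom b₁ x)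
  · exact congrArg (ap (inl _ _)) (ap_hom_inv a₂ x)
  · exact congrArg (ap (inr _ _)) (ap_hom_inv b₂ x)
  · exact congrArg (ap (inl _ _)) (ap_inv_hom a₂ x)
  · exact congrArg (ap (inr _ _)) (ap_inv_hom b₂ x)
  · exact ap_congr hf x
  · exact ap_congr kf x
  · exact congrArg (ap (inl _ _)) (ap_congr hg x)
  · exact congrArg (ap (inr _ _)) (ap_congr kg x)
  · exact congrArg (ap (inl _ _)) (ap_congr hh x)
  · exact congrArg (ap (inr _ _)) (ap_congr kh x)

lemma isIso_of_empty {W : FinGSet G} (P Q : Bispan W (empty G)) : IsIso P Q := by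
  have hP₂ : IsEmpty P.U₂.V := ⟨fun x => isEmptyElim (ap P.h x)⟩
  have hP₁ : IsEmpty P.U₁.V := ⟨fun x => isEmptyElim (ap P.g x)⟩
  have hQ₂ : IsEmpty Q.U₂.V := ⟨fun x => isEmptyElim (ap Q.h x)⟩
  have hQ₁ : IsEmpty Q.U₁.V := ⟨fun x => isEmptyElim (ap Q.g x)⟩
  exact IsIso.mk' (mkHom (fun x => isEmptyElim x) fun _ x => isEmptyElim x)
    (mkHom (fun x => isEmptyElim x) fun _ x => isEmptyElim x)
    (fun x => isEmptyElim x) (fun x => isEmptyElim x)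
    (fun x => isEmptyElim x) (fun x => isEmptyElim x)
    (fun x => isEmptyElim x) (fun x => isEmptyElim x)
    (fun x => isEmptyElim x) (fun x => isEmptyElim x)
    (fun x => isEmptyElim x)

end Bispan

namespace PolyCat

lemma sum_hom_ext {W : PolyCat G} {X Y : FinGSet G} {m m' : W ⟶ ⟨sum X Y⟩}
    (h₁ : m ≫ ofBispan (Y := ⟨X⟩) (Bispan.res (inl X Y)) =
      m' ≫ ofBispan (Y := ⟨X⟩) (Bispan.res (inl X Y)))
    (h₂ : m ≫ ofBispan (Y := ⟨Y⟩) (Bispan.res (inr X Y)) =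
      m' ≫ ofBispan (Y := ⟨Y⟩) (Bispan.res (inr X Y))) : m = m' := by
  obtain ⟨P⟩ := m
  obtain ⟨P'⟩ := m'
  have h₁ : (P.comp (Bispan.res (inl X Y))).IsIso (P'.comp (Bispan.res (inl X Y))) :=
    Quotient.exact h₁
  have h₂ : (P.comp (Bispan.res (inr X Y))).IsIso (P'.comp (Bispan.res (inr X Y))) :=
    Quotient.exact h₂
  refine Quotient.sound (P.pairing_restrict.symm.trans (.trans ?_ P'.pairing_restrict))
  exact Bispan.pairing_congr
    ((P.comp_res_restrict _).trans (h₁.trans (P'.comp_res_restrict _).symm))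
    ((P.comp_res_restrict _).trans (h₂.trans (P'.comp_res_restrict _).symm))

lemma empty_hom_ext {W : PolyCat G} (m m' : W ⟶ ⟨empty G⟩) : m = m' := by
  obtain ⟨P⟩ := m
  obtain ⟨P'⟩ := m'
  exact Quotient.sound (Bispan.isIso_of_empty P P')

end PolyCat

namespace BiPoly

variable {Oa Om : MorphismProperty (FinGSet G)} [IsIndexingCategory Oa] [IsIndexingCategory Om]
    [Compatible Oa Om]

/-- The morphism of `BiPoly Oa Om` represented by a polynomial. -/
def ofBispan {X Y : BiPoly Oa Om} (P : Bispan X.obj.obj Y.obj.obj) (hg : Om P.g) (hh : Oa P.h) :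
    X ⟶ Y := ⟨PolyCat.ofBispan P, P, hg, hh, rfl⟩

variable (Oa Om) in
/-- A finite `G`-set as an object of `BiPoly Oa Om`. -/
abbrev mk (X : FinGSet G) : BiPoly Oa Om := ⟨⟨X⟩⟩

variable (Oa Om) in
/-- The restriction `R_f`. -/
def res {X Y : FinGSet G} (f : X ⟶ Y) : mk Oa Om Y ⟶ mk Oa Om X :=
  ofBispan (Bispan.res f) (Om.id_mem _) (Oa.id_mem _)

variable (Oa) in
/-- The norm `N_g`. -/
def nm {X Y : FinGSet G} (g : X ⟶ Y) (hg : Om g) : mk Oa Om X ⟶ mk Oa Om Y :=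
  ofBispan (Bispan.nm g) hg (Oa.id_mem _)

/-- The disjoint union is the categorical product in `BiPoly Oa Om`. -/
noncomputable def isLimitSum (X Y : FinGSet G) :
    IsLimit (BinaryFan.mk (res Oa Om (inl X Y)) (res Oa Om (inr X Y))) := by
  have ex : ∀ {W : BiPoly Oa Om} (p : W ⟶ mk Oa Om X) (q : W ⟶ mk Oa Om Y),
      ∃ l : W ⟶ mk Oa Om (sum X Y), l ≫ res Oa Om (inl X Y) = p ∧
        l ≫ res Oa Om (inr X Y) = q := by
    rintro W ⟨_, P, hP, hP', rfl⟩ ⟨_, Q, hQ, hQ', rfl⟩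
    refine ⟨ofBispan (P.pairing Q) (IsIndexingCategory.sumMap_mem hP hQ)
      (IsIndexingCategory.sumMap_mem hP' hQ'), ?_, ?_⟩
    · apply WideSubcategory.hom_ext
      exact (Quotient.sound (P.pairing_inl Q)).symm
    · apply WideSubcategory.hom_ext
      exact (Quotient.sound (P.pairing_inr Q)).symm
  refine BinaryFan.IsLimit.mk _ (fun p q => (ex p q).choose)
    (fun p q => (ex p q).choose_spec.1) (fun p q => (ex p q).choose_spec.2) ?_
  intro W p q m h₁ h₂
  apply WideSubcategory.hom_ext
  apply PolyCat.sum_hom_ext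
  · exact congrArg (fun f => f.hom) (h₁.trans (ex p q).choose_spec.1.symm)
  · exact congrArg (fun f => f.hom) (h₂.trans (ex p q).choose_spec.2.symm)

/-- The empty `G`-set is terminal in `BiPoly Oa Om`. -/
def isTerminalEmpty : IsTerminal (mk Oa Om (empty G)) :=
  IsTerminal.ofUniqueHom
    (fun _ => ofBispan ⟨empty G, empty G, fromEmpty _, 𝟙 _, 𝟙 _⟩ (Om.id_mem _) (Oa.id_mem _))
    fun _ _ => WideSubcategory.hom_ext _ (PolyCat.empty_hom_ext _ _)

end BiPoly

end

section
variable {G : Type u} [Group G]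

/-- The objects of the category `A_O` of spans `S ← U →h T` with `h` in `O`: these are the finite
`G`-sets. -/
structure SpanCat (O : MorphismProperty (FinGSet G)) where
  obj : FinGSet G

namespace SpanCat

variable {O : MorphismProperty (FinGSet G)}

/-- A span `S ← U →h T` with `h` in `O`, as a polynomial. -/
def toBispan {S T : FinGSet G} (s : Span ⊤ O S T) : Bispan S T :=
  ⟨s.apex, s.apex, s.l, 𝟙 s.apex, s.r⟩

lemma toBispan_isIso_iff {S T : FinGSet G} (s t : Span ⊤ O S T) :
    (toBispan s).IsIso (toBispan t) ↔ IsIsomorphic s t := by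
  constructor
  · rintro ⟨e₁, e₂, hf, hg, hh⟩
    have h : e₁.hom = e₂.hom := by
      have := hg
      simp only [toBispan, Category.comp_id, Category.id_comp] at this
      exact this
    exact ⟨Span.mkIso e₁ hf (by rw [h]; exact hh)⟩
  · rintro ⟨e⟩
    refine ⟨⟨e.hom.hom, e.inv.hom, ?_, ?_⟩, ⟨e.hom.hom, e.inv.hom, ?_, ?_⟩, e.hom.hom_l, ?_,
      e.hom.hom_r⟩
    · exact congrArg Span.Hom.hom e.hom_inv_id
    · exact congrArg Span.Hom.hom e.inv_hom_id
    · exact congrArg Span.Hom.hom e.hom_inv_id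
    · exact congrArg Span.Hom.hom e.inv_hom_id
    · exact (Category.comp_id _).trans (Category.id_comp _).symm

/-- The polynomial represented by an isomorphism class of spans. -/
def homToPoly {S T : FinGSet G} : Quotient (isIsomorphicSetoid (Span ⊤ O S T)) →
    (PolyCat.mk S ⟶ PolyCat.mk T) :=
  Quotient.map toBispan fun s t h => (toBispan_isIso_iff s t).2 h

lemma homToPoly_injective {S T : FinGSet G} :
    Function.Injective (homToPoly (O := O) (S := S) (T := T)) := by
  rintro ⟨s⟩ ⟨t⟩ h
  exact Quotient.sound ((toBispan_isIso_iff s t).1 (Quotient.exact h))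

variable [IsIndexingCategory O]

lemma toBispan_comp {S T U : FinGSet G} (s : Span ⊤ O S T) (t : Span ⊤ O T U) :
    (toBispan (s.comp t)).IsIso ((toBispan s).comp (toBispan t)) := by
  obtain ⟨i, sj⟩ := isPullback_types (IsPullback.of_hasPullback s.r t.l)
  have w := ap_congr (pullback.condition (f := s.r) (g := t.l))
  let F₂ : (pullback s.r t.l).V → Sec (𝟙 t.apex) t.l s.r := fun v =>
    ⟨ap (pullback.snd s.r t.l) v, fun _ _ => ap (pullback.fst s.r t.l) v,
      fun c hc => (w v).trans (congrArg (ap t.l) hc.symm)⟩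
  have F₂sm : ∀ (a : G) v, F₂ (a • v) = a • F₂ v := fun a v =>
    Sec.ext' (ap_smul (pullback.snd s.r t.l) a v) fun _ _ _ => ap_smul (pullback.fst s.r t.l) a v
  let F₁ : (pullback s.r t.l).V → Pos (𝟙 t.apex) t.l (𝟙 s.apex) s.r := fun v =>
    ⟨F₂ v, ap (pullback.snd s.r t.l) v, rfl, ap (pullback.fst s.r t.l) v, rfl⟩
  have b₂ : Function.Bijective F₂ := by
    constructor
    · intro v v' e
      refine i _ _ ?_ (congrArg Sec.pt e)
      exact Sec.sec_congr' e (c := ap (pullback.snd s.r t.l) v)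
        (c' := ap (pullback.snd s.r t.l) v') (congrArg Sec.pt e) rfl rfl
    · intro x
      obtain ⟨v, hv, hv'⟩ := sj _ _ (x.lies x.pt rfl)
      exact ⟨v, Sec.ext' hv' fun c hc hc' => hv.trans (Sec.sec_congr _ (Eq.symm hc') _ _)⟩
  refine Bispan.IsIso.of_bijective (P := toBispan (s.comp t)) (Q := (toBispan s).comp (toBispan t))
    (mkHom (Y := posObj _ _ _ _) F₁ fun a v => ?_) (mkHom (Y := secObj _ _ _) F₂ F₂sm)
    ⟨?_, ?_⟩ b₂ (fun _ => rfl) (fun _ => rfl) fun _ => rfl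
  · exact Pos.ext' (F₂sm a v) (ap_smul (pullback.snd s.r t.l) a v)
      (ap_smul (pullback.fst s.r t.l) a v)
  · intro v v' e
    exact b₂.1 (congrArg Pos.sh e)
  · intro (x : Pos (𝟙 t.apex) t.l (𝟙 s.apex) s.r)
    obtain ⟨v, hv⟩ := b₂.2 x.sh
    have hc : x.c = x.sh.pt := x.hc
    refine ⟨v, Pos.ext' hv ((congrArg Sec.pt hv).trans hc.symm) ?_⟩
    exact (Sec.sec_congr' hv (c := ap (pullback.snd s.r t.l) v) (c' := x.c)
      ((congrArg Sec.pt hv).trans hc.symm) rfl x.hc).trans x.ha.symm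

/-- Composition of isomorphism classes of spans, by pullback. -/
noncomputable def compHom {S T U : FinGSet G} :
    Quotient (isIsomorphicSetoid (Span ⊤ O S T)) → Quotient (isIsomorphicSetoid (Span ⊤ O T U)) →
      Quotient (isIsomorphicSetoid (Span ⊤ O S U)) :=
  Quotient.map₂ Span.comp fun s s' hs t t' ht => by
    refine (toBispan_isIso_iff _ _).1 ((toBispan_comp s t).trans (.trans ?_
      (toBispan_comp s' t').symm))
    exact Bispan.comp_congr ((toBispan_isIso_iff _ _).2 hs) ((toBispan_isIso_iff _ _).2 ht)

lemma homToPoly_compHom {S T U : FinGSet G} (s : Quotient (isIsomorphicSetoid (Span ⊤ O S T)))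
    (t : Quotient (isIsomorphicSetoid (Span ⊤ O T U))) :
    homToPoly (compHom s t) = homToPoly s ≫ homToPoly t := by
  obtain ⟨s⟩ := s
  obtain ⟨t⟩ := t
  exact Quotient.sound (toBispan_comp s t)

lemma homToPoly_id (S : FinGSet G) :
    homToPoly (Quotient.mk (isIsomorphicSetoid (Span ⊤ O S S)) (Span.id S)) = 𝟙 (PolyCat.mk S) :=
  rfl

/-- The category `A_O`: morphisms are isomorphism classes of spans `S ← U →h T` with `h` in `O`,
composed by pullback. -/
noncomputable instance : Category (SpanCat O) where
  Hom X Y := Quotient (isIsomorphicSetoid (Span ⊤ O X.obj Y.obj))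
  id X := Quotient.mk _ (Span.id X.obj)
  comp := compHom
  id_comp f := homToPoly_injective (by
    rw [homToPoly_compHom, homToPoly_id, Category.id_comp])
  comp_id f := homToPoly_injective (by
    rw [homToPoly_compHom, homToPoly_id, Category.comp_id])
  assoc f g h := homToPoly_injective (by
    rw [homToPoly_compHom, homToPoly_compHom, homToPoly_compHom, homToPoly_compHom,
      Category.assoc])

/-- The morphism represented by `S ←l A →r T`. -/
def ofSpan {S T A : FinGSet G} (l : A ⟶ S) (r : A ⟶ T) (hr : O r) :
    (⟨S⟩ : SpanCat O) ⟶ ⟨T⟩ := Quotient.mk _ ⟨A, l, r, trivial, hr⟩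

lemma exists_ofSpan {X Y : SpanCat O} (f : X ⟶ Y) :
    ∃ (A : FinGSet G) (l : A ⟶ X.obj) (r : A ⟶ Y.obj) (hr : O r), f = ofSpan l r hr := by
  obtain ⟨s⟩ := f
  exact ⟨s.apex, s.l, s.r, s.wr, rfl⟩

lemma ofSpan_eq {S T A B : FinGSet G} {l : A ⟶ S} {r : A ⟶ T} {hr : O r} {l' : B ⟶ S}
    {r' : B ⟶ T} {hr' : O r'} (e : A ≅ B) (hl : e.hom ≫ l' = l) (hr₂ : e.hom ≫ r' = r) :
    ofSpan l r hr = ofSpan l' r' hr' :=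
  Quotient.sound ⟨Span.mkIso e hl hr₂⟩

lemma ofSpan_comp {S T U A B C : FinGSet G} {l : A ⟶ S} {r : A ⟶ T} {hr : O r} {l' : B ⟶ T}
    {r' : B ⟶ U} {hr' : O r'} {p : C ⟶ A} {q : C ⟶ B} (h : IsPullback p q r l') :
    ofSpan l r hr ≫ ofSpan l' r' hr' =
      ofSpan (p ≫ l) (q ≫ r') (O.comp_mem _ _ (O.of_isPullback h hr) hr') := by
  refine Quotient.sound ⟨Span.mkIso h.isoPullback.symm ?_ ?_⟩
  · change h.isoPullback.inv ≫ p ≫ l = pullback.fst r l' ≫ l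
    simp
  · change h.isoPullback.inv ≫ q ≫ r' = pullback.snd r l' ≫ r'
    simp

variable (O) in
/-- The restriction `R_f`. -/
def res {X Y : FinGSet G} (f : X ⟶ Y) : (⟨Y⟩ : SpanCat O) ⟶ ⟨X⟩ := ofSpan f (𝟙 X) (O.id_mem _)

/-- The transfer `T_h`. -/
def tr {X Y : FinGSet G} (h : X ⟶ Y) (hh : O h) : (⟨X⟩ : SpanCat O) ⟶ ⟨Y⟩ := ofSpan (𝟙 X) h hh

lemma ofSpan_tr {S T U A : FinGSet G} {l : A ⟶ S} {r : A ⟶ T} {hr : O r} {h : T ⟶ U} (hh : O h) :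
    ofSpan l r hr ≫ tr h hh = ofSpan l (r ≫ h) (O.comp_mem _ _ hr hh) :=
  ofSpan_comp (IsPullback.of_id_fst (f := r))

lemma res_ofSpan {S T U A : FinGSet G} {l : A ⟶ S} {r : A ⟶ T} {hr : O r} (f : S ⟶ U) :
    res O f ≫ ofSpan l r hr = ofSpan (l ≫ f) r hr :=
  ofSpan_comp (IsPullback.of_id_snd (f := l))

lemma ofSpan_res {S T U A C : FinGSet G} {l : A ⟶ S} {r : A ⟶ T} {hr : O r} {f : U ⟶ T}
    {p : C ⟶ A} {q : C ⟶ U} (h : IsPullback p q r f) :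
    ofSpan l r hr ≫ res O f = ofSpan (p ≫ l) q (O.of_isPullback h hr) := by
  rw [res, ofSpan_comp h]
  rfl

lemma tr_ofSpan {S T U A C : FinGSet G} {l : A ⟶ S} {r : A ⟶ T} {hr : O r} {h : U ⟶ S} {hh : O h}
    {p : C ⟶ U} {q : C ⟶ A} (e : IsPullback p q h l) :
    tr h hh ≫ ofSpan l r hr = ofSpan p (q ≫ r) (O.comp_mem _ _ (O.of_isPullback e hh) hr) := by
  rw [tr, ofSpan_comp e]
  rfl

variable (O) in
/-- The disjoint union is the categorical product in `A_O`. -/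
noncomputable def isLimitSum (X Y : FinGSet G) :
    IsLimit (BinaryFan.mk (res O (inl X Y)) (res O (inr X Y))) := by
  have ex : ∀ {W : SpanCat O} (p : W ⟶ ⟨X⟩) (q : W ⟶ ⟨Y⟩),
      ∃ l : W ⟶ ⟨sum X Y⟩, l ≫ res O (inl X Y) = p ∧ l ≫ res O (inr X Y) = q := by
    intro W p q
    obtain ⟨A, l, r, hr, rfl⟩ := exists_ofSpan p
    obtain ⟨B, l', r', hr', rfl⟩ := exists_ofSpan q
    exact ⟨ofSpan (desc l l') (sumMap r r') (IsIndexingCategory.sumMap_mem hr hr'),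
      ofSpan_res (isPullback_inl r r'), ofSpan_res (isPullback_inr r r')⟩
  refine BinaryFan.IsLimit.mk _ (fun p q => (ex p q).choose)
    (fun p q => (ex p q).choose_spec.1) (fun p q => (ex p q).choose_spec.2) ?_
  intro W p q m h₁ h₂
  apply homToPoly_injective
  apply PolyCat.sum_hom_ext
  · exact (homToPoly_compHom _ _).symm.trans ((congrArg homToPoly
      (h₁.trans (ex p q).choose_spec.1.symm)).trans (homToPoly_compHom _ _))
  · exact (homToPoly_compHom _ _).symm.trans ((congrArg homToPoly
      (h₂.trans (ex p q).choose_spec.2.symm)).trans (homToPoly_compHom _ _))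

variable (O) in
/-- The empty `G`-set is terminal in `A_O`. -/
noncomputable def isTerminalEmpty : IsTerminal (⟨empty G⟩ : SpanCat O) :=
  IsTerminal.ofUniqueHom (fun _ => ofSpan (fromEmpty _) (𝟙 _) (O.id_mem _))
    fun _ _ => homToPoly_injective (PolyCat.empty_hom_ext _ _)

instance : HasFiniteProducts (SpanCat O) := by
  have : HasTerminal (SpanCat O) := (isTerminalEmpty O).hasTerminal
  have : HasBinaryProducts (SpanCat O) := by
    have (X Y : SpanCat O) : HasLimit (pair X Y) := ⟨⟨_, isLimitSum O X.obj Y.obj⟩⟩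
    exact hasBinaryProducts_of_hasLimit_pair _
  exact hasFiniteProducts_of_has_binary_and_terminal

variable (O) in
/-- The cartesian product of finite `G`-sets as a functor `A_O × A_O ⥤ A_O`. -/
noncomputable def prodFunctor : SpanCat O × SpanCat O ⥤ SpanCat O where
  obj X := ⟨FinGSet.prod X.1.obj X.2.obj⟩
  map {X Y} f := Quotient.map₂
    (fun (s : Span ⊤ O X.1.obj Y.1.obj) (t : Span ⊤ O X.2.obj Y.2.obj) =>
      (⟨FinGSet.prod s.apex t.apex, prodMap s.l t.l, prodMap s.r t.r, trivial,
        IsIndexingCategory.prodMap_mem s.wr t.wr⟩ :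
          Span ⊤ O (FinGSet.prod X.1.obj X.2.obj) (FinGSet.prod Y.1.obj Y.2.obj)))
    (by
      rintro s s' ⟨e⟩ t t' ⟨e'⟩
      refine ⟨Span.mkIso ⟨prodMap e.hom.hom e'.hom.hom, prodMap e.inv.hom e'.inv.hom, ?_, ?_⟩
        ?_ ?_⟩
      · ext x
        exact Prod.ext (ap_congr (congrArg Span.Hom.hom e.hom_inv_id) x.1)
          (ap_congr (congrArg Span.Hom.hom e'.hom_inv_id) x.2)
      · ext x
        exact Prod.ext (ap_congr (congrArg Span.Hom.hom e.inv_hom_id) x.1)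
          (ap_congr (congrArg Span.Hom.hom e'.inv_hom_id) x.2)
      · ext x
        exact Prod.ext (ap_congr e.hom.hom_l x.1) (ap_congr e'.hom.hom_l x.2)
      · ext x
        exact Prod.ext (ap_congr e.hom.hom_r x.1) (ap_congr e'.hom.hom_r x.2)) f.1 f.2
  map_id X := rfl
  map_comp := by
    rintro ⟨X, X'⟩ ⟨Y, Y'⟩ ⟨Z, Z'⟩ ⟨f, f'⟩ ⟨g, g'⟩
    obtain ⟨A, l, r, hr, rfl⟩ := exists_ofSpan f
    obtain ⟨A', l', r', hr', rfl⟩ := exists_ofSpan f'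
    obtain ⟨B, m, s, hs, rfl⟩ := exists_ofSpan g
    obtain ⟨B', m', s', hs', rfl⟩ := exists_ofSpan g'
    refine Eq.trans ?_ (ofSpan_comp (l := prodMap l l') (r' := prodMap s s')
      (hr := IsIndexingCategory.prodMap_mem hr hr') (hr' := IsIndexingCategory.prodMap_mem hs hs')
      (isPullback_prodMap (IsPullback.of_hasPullback r m)
        (IsPullback.of_hasPullback r' m'))).symm
    rfl

section

variable (Oa Om : MorphismProperty (FinGSet G)) [IsIndexingCategory Oa] [IsIndexingCategory Om]
    [Compatible Oa Om]

/-- The inclusion `A_Oa ⥤ BiPoly Oa Om`, sending `[S ← U → T]` to `[S ← U = U → T]`. -/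
noncomputable def toBiPoly : SpanCat Oa ⥤ BiPoly Oa Om where
  obj X := ⟨⟨X.obj⟩⟩
  map f := ⟨homToPoly f, by
    obtain ⟨s⟩ := f
    exact ⟨toBispan s, Om.id_mem _, s.wr, rfl⟩⟩
  map_comp f g := WideSubcategory.hom_ext _ (homToPoly_compHom f g)

instance : PreservesFiniteProducts (toBiPoly Oa Om) := by
  have : PreservesLimitsOfShape (Discrete WalkingPair) (toBiPoly Oa Om) := by
    have (X Y : SpanCat Oa) : PreservesLimit (pair X Y) (toBiPoly Oa Om) := by
      refine preservesLimit_of_preserves_limit_cone (isLimitSum Oa X.obj Y.obj) ?_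
      exact (isLimitMapConeBinaryFanEquiv _ _ _).symm (BiPoly.isLimitSum X.obj Y.obj)
    exact ⟨fun {K} => preservesLimit_of_iso_diagram _ (diagramIsoPair K).symm⟩
  have : PreservesLimitsOfShape (Discrete PEmpty.{1}) (toBiPoly Oa Om) := by
    have : PreservesLimit (Functor.empty.{0} (SpanCat Oa)) (toBiPoly Oa Om) := by
      refine preservesLimit_of_preserves_limit_cone (isTerminalEmpty Oa) ?_
      exact (isLimitMapConeEmptyConeEquiv _ _).symm BiPoly.isTerminalEmpty
    exact preservesLimitsOfShape_pempty_of_preservesTerminal _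
  exact PreservesFiniteProducts.of_preserves_binary_and_terminal _

end

end SpanCat

end

section
variable {G : Type u} [Group G]

lemma existsUnique_of_isLimit_binaryFan {A B C : Type w} {p : C ⟶ A} {q : C ⟶ B}
    (h : IsLimit (BinaryFan.mk p q)) (x : A) (y : B) : ∃! z : C, p z = x ∧ q z = y := by
  obtain ⟨l, h₁, h₂⟩ := BinaryFan.IsLimit.lift' h
    (↾fun _ : PUnit.{w + 1} => x) (↾fun _ : PUnit.{w + 1} => y)
  refine ⟨l PUnit.unit, ⟨ConcreteCategory.congr_hom h₁ PUnit.unit,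
    ConcreteCategory.congr_hom h₂ PUnit.unit⟩, fun z hz => ?_⟩
  have : (↾fun _ : PUnit.{w + 1} => z) = l := by
    apply BinaryFan.IsLimit.hom_ext h
    · rw [h₁]
      ext
      exact hz.1
    · rw [h₂]
      ext
      exact hz.2
  exact ConcreteCategory.congr_hom this PUnit.unit

namespace SpanCat

variable {O : MorphismProperty (FinGSet G)} [IsIndexingCategory O]
  (M : SpanCat O ⥤ Type w)

lemma map_map {X Y Z : SpanCat O} (f : X ⟶ Y) (g : Y ⟶ Z) (x : M.obj X) :
    M.map g (M.map f x) = M.map (f ≫ g) x := by simp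

variable [PreservesFiniteProducts M]

lemma existsUnique_pair {X Y : FinGSet G} (x : M.obj ⟨X⟩) (y : M.obj ⟨Y⟩) :
    ∃! z : M.obj ⟨sum X Y⟩, M.map (res O (inl X Y)) z = x ∧ M.map (res O (inr X Y)) z = y :=
  existsUnique_of_isLimit_binaryFan (mapIsLimitOfPreservesOfIsLimit M _ _ (isLimitSum O X Y)) x y

/-- The element of `M (X ⨿ Y)` with given restrictions to `X` and `Y`. -/
noncomputable def pair {X Y : FinGSet G} (x : M.obj ⟨X⟩) (y : M.obj ⟨Y⟩) : M.obj ⟨sum X Y⟩ :=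
  (existsUnique_pair M x y).choose

@[simp] lemma pair_inl {X Y : FinGSet G} (x : M.obj ⟨X⟩) (y : M.obj ⟨Y⟩) :
    M.map (res O (inl X Y)) (pair M x y) = x := (existsUnique_pair M x y).choose_spec.1.1

@[simp] lemma pair_inr {X Y : FinGSet G} (x : M.obj ⟨X⟩) (y : M.obj ⟨Y⟩) :
    M.map (res O (inr X Y)) (pair M x y) = y := (existsUnique_pair M x y).choose_spec.1.2

lemma eq_pair {X Y : FinGSet G} {z : M.obj ⟨sum X Y⟩} {x : M.obj ⟨X⟩} {y : M.obj ⟨Y⟩}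
    (h₁ : M.map (res O (inl X Y)) z = x) (h₂ : M.map (res O (inr X Y)) z = y) :
    z = pair M x y :=
  (existsUnique_pair M x y).choose_spec.2 z ⟨h₁, h₂⟩

/-- `M ∅` is a point. -/
noncomputable abbrev uniqueEmpty : Unique (M.obj ⟨empty G⟩) :=
  Types.isTerminalEquivUnique _ ((isTerminalEmpty O).isTerminalObj M)

/-- The addition on `M X`, given by the transfer along the fold map `X ⨿ X ⟶ X`. -/
noncomputable def add {X : FinGSet G} (x y : M.obj ⟨X⟩) : M.obj ⟨X⟩ :=
  M.map (tr (fold X) (IsIndexingCategory.fold_mem O X)) (pair M x y)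

/-- The zero of `M X`, given by the transfer along `∅ ⟶ X`. -/
noncomputable def zero (X : FinGSet G) : M.obj ⟨X⟩ :=
  M.map (tr (fromEmpty X) (IsIndexingCategory.fromEmpty_mem X)) (uniqueEmpty M).default

lemma map_add {X Y : SpanCat O} (φ : X ⟶ Y) (x y : M.obj X) :
    M.map φ (add M (X := X.obj) x y) = add M (X := Y.obj) (M.map φ x) (M.map φ y) := by
  obtain ⟨X⟩ := X
  obtain ⟨Y⟩ := Y
  obtain ⟨A, l, r, hr, rfl⟩ := exists_ofSpan φ
  let ψ : (⟨sum X X⟩ : SpanCat O) ⟶ ⟨sum Y Y⟩ :=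
    ofSpan (sumMap l l) (sumMap r r) (IsIndexingCategory.sumMap_mem hr hr)
  have h₁ : tr (fold X) (IsIndexingCategory.fold_mem O X) ≫ ofSpan l r hr =
      ψ ≫ tr (fold Y) (IsIndexingCategory.fold_mem O Y) := by
    rw [tr_ofSpan (isPullback_fold l).flip.flip, ofSpan_tr]
    exact ofSpan_eq (Iso.refl _) (Category.id_comp _)
      ((Category.id_comp _).trans (isPullback_fold r).w)
  have h₂ : ψ ≫ res O (inl Y Y) = res O (inl X X) ≫ ofSpan l r hr := by
    rw [ofSpan_res (isPullback_inl r r), res_ofSpan]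
    rfl
  have h₃ : ψ ≫ res O (inr Y Y) = res O (inr X X) ≫ ofSpan l r hr := by
    rw [ofSpan_res (isPullback_inr r r), res_ofSpan]
    rfl
  have h₄ : M.map ψ (pair M x y) = pair M (M.map (ofSpan l r hr) x) (M.map (ofSpan l r hr) y) := by
    apply eq_pair
    · rw [map_map, h₂, ← map_map, pair_inl]
    · rw [map_map, h₃, ← map_map, pair_inr]
  change M.map _ (M.map _ (pair M x y)) = M.map _ _
  rw [map_map, h₁, ← map_map, h₄]

lemma map_zero {X Y : SpanCat O} (φ : X ⟶ Y) : M.map φ (zero M X.obj) = zero M Y.obj := by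
  obtain ⟨X⟩ := X
  obtain ⟨Y⟩ := Y
  obtain ⟨A, l, r, hr, rfl⟩ := exists_ofSpan φ
  have h : IsPullback (𝟙 (empty G)) (fromEmpty A) (fromEmpty X) l :=
    isPullback_of (fun x => isEmptyElim x) (fun x => isEmptyElim x) fun x => isEmptyElim x
  change M.map _ (M.map _ _) = M.map _ _
  rw [map_map, tr_ofSpan h]
  exact congrArg (fun f => M.map f (uniqueEmpty M).default) (ofSpan_eq (Iso.refl _) (by rfl)
    (hom_ext fun x => isEmptyElim x))

lemma add_zero {X : FinGSet G} (x : M.obj ⟨X⟩) : add M x (zero M X) = x := by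
  have h : M.map (tr (inl X X) (IsIndexingCategory.inl_mem X X)) x = pair M x (zero M X) := by
    apply eq_pair
    · have e : IsPullback (𝟙 X) (𝟙 X) (inl X X) (inl X X) :=
        isPullback_of (fun _ => rfl) (fun _ _ h _ => h) fun x y h => ⟨x, rfl, inl_inj h⟩
      rw [map_map, tr, ofSpan_res e]
      exact Functor.map_id_apply M _ x
    · have e : IsPullback (fromEmpty X) (fromEmpty X) (inl X X) (inr X X) :=
        isPullback_of (fun x => isEmptyElim x) (fun x => isEmptyElim x)
          fun x y h => (inl_ne_inr h).elim
      have e' : tr (inl X X) (IsIndexingCategory.inl_mem X X) ≫ res O (inr X X) =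
          res O (fromEmpty X) ≫ tr (fromEmpty X) (IsIndexingCategory.fromEmpty_mem X) := by
        rw [tr, ofSpan_res e, tr, res_ofSpan]
        rfl
      rw [map_map, e', ← map_map]
      exact congrArg _ ((uniqueEmpty M).uniq _)
  rw [add, ← h, map_map, tr, ofSpan_tr]
  exact Functor.map_id_apply M _ x

lemma zero_add {X : FinGSet G} (x : M.obj ⟨X⟩) : add M (zero M X) x = x := by
  have h : M.map (tr (inr X X) (IsIndexingCategory.inr_mem X X)) x = pair M (zero M X) x := by
    apply eq_pair
    · have e : IsPullback (fromEmpty X) (fromEmpty X) (inr X X) (inl X X) :=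
        isPullback_of (fun x => isEmptyElim x) (fun x => isEmptyElim x)
          fun x y h => (inl_ne_inr h.symm).elim
      have e' : tr (inr X X) (IsIndexingCategory.inr_mem X X) ≫ res O (inl X X) =
          res O (fromEmpty X) ≫ tr (fromEmpty X) (IsIndexingCategory.fromEmpty_mem X) := by
        rw [tr, ofSpan_res e, tr, res_ofSpan]
        rfl
      rw [map_map, e', ← map_map]
      exact congrArg _ ((uniqueEmpty M).uniq _)
    · have e : IsPullback (𝟙 X) (𝟙 X) (inr X X) (inr X X) :=
        isPullback_of (fun _ => rfl) (fun _ _ h _ => h) fun x y h => ⟨x, rfl, inr_inj h⟩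
      rw [map_map, tr, ofSpan_res e]
      exact Functor.map_id_apply M _ x
  rw [add, ← h, map_map, tr, ofSpan_tr]
  exact Functor.map_id_apply M _ x

lemma add_add_add_comm {X : FinGSet G} (x y z t : M.obj ⟨X⟩) :
    add M (add M x y) (add M z t) = add M (add M x z) (add M y t) := by
  have h : pair M (add M x y) (add M z t) = add M (pair M x z) (pair M y t) := by
    symm
    apply eq_pair <;> rw [map_add] <;> simp
  rw [add, h, map_add]
  rfl

/-- The commutative monoid structure on `M X`. -/
noncomputable abbrev addCommMonoid (X : FinGSet G) : AddCommMonoid (M.obj ⟨X⟩) where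
  add x y := add M x y
  zero := zero M X
  zero_add x := zero_add M x
  add_zero x := add_zero M x
  add_comm x y := by
    change add M x y = add M y x
    have := add_add_add_comm M (zero M X) x y (zero M X)
    simpa only [zero_add, add_zero] using this
  add_assoc x y z := by
    change add M (add M x y) z = add M x (add M y z)
    have := add_add_add_comm M x y (zero M X) z
    simpa only [zero_add, add_zero] using this
  nsmul := @nsmulRec _ ⟨zero M X⟩ ⟨add M⟩

end SpanCat

/-- An `O`-Mackey functor is a product preserving functor `A_O ⥤ Type` all of whose values are
groups under addition. -/
class IsMackey {O : MorphismProperty (FinGSet G)} [IsIndexingCategory O]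
    (M : SpanCat O ⥤ Type w) : Prop extends PreservesFiniteProducts M where
  exists_neg : ∀ (X : FinGSet G) (x : M.obj ⟨X⟩), ∃ y, SpanCat.add M x y = SpanCat.zero M X

/-- The category of `O`-Mackey functors. -/
abbrev MackeyFunctor (O : MorphismProperty (FinGSet G)) [IsIndexingCategory O] :=
  ObjectProperty.FullSubcategory fun M : SpanCat O ⥤ Type w => IsMackey M

namespace MackeyFunctor

variable {O : MorphismProperty (FinGSet G)} [IsIndexingCategory O] (M : MackeyFunctor.{u, w} O)

instance : IsMackey M.obj := M.property

/-- The abelian group `M X`. -/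
noncomputable abbrev addCommGroup (X : FinGSet G) : AddCommGroup (M.obj.obj ⟨X⟩) :=
  { SpanCat.addCommMonoid M.obj X with
    neg := fun x => (IsMackey.exists_neg X x).choose
    zsmul := letI := SpanCat.addCommMonoid M.obj X
      @zsmulRec _ _ _ ⟨fun x => (IsMackey.exists_neg X x).choose⟩ fun n x => n • x
    neg_add_cancel := fun x => ((SpanCat.addCommMonoid M.obj X).add_comm _ _).trans
      (IsMackey.exists_neg X x).choose_spec }

/-- A Mackey functor, as a functor to abelian groups. -/
noncomputable def toAb : SpanCat O ⥤ AddCommGrpCat.{w} where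
  obj X := letI := addCommGroup M X.obj; AddCommGrpCat.of (M.obj.obj ⟨X.obj⟩)
  map {X Y} f := letI := addCommGroup M X.obj; letI := addCommGroup M Y.obj
    AddCommGrpCat.ofHom
      { toFun := fun x => M.obj.map f x
        map_zero' := SpanCat.map_zero M.obj f
        map_add' := SpanCat.map_add M.obj f }
  map_id X := by
    apply ConcreteCategory.hom_ext
    intro x
    exact Functor.map_id_apply M.obj X x
  map_comp f g := by
    apply ConcreteCategory.hom_ext
    intro x
    exact Functor.map_comp_apply M.obj f g x

end MackeyFunctor

end

section
variable {G : Type u} [Group G]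

/-- The external tensor product of functors to abelian groups, `(X, Y) ↦ F X ⊗ F' Y`. -/
noncomputable def externalTensor {C D : Type*} [Category* C] [Category* D]
    (F : C ⥤ AddCommGrpCat.{w}) (F' : D ⥤ AddCommGrpCat.{w}) : C × D ⥤ AddCommGrpCat.{w} where
  obj X := AddCommGrpCat.of (TensorProduct ℤ (F.obj X.1) (F'.obj X.2))
  map f := AddCommGrpCat.ofHom (TensorProduct.map (F.map f.1).hom.toIntLinearMap
    (F'.map f.2).hom.toIntLinearMap).toAddMonoidHom
  map_id X := by
    have h₁ : (F.map (𝟙 X.1)).hom.toIntLinearMap = LinearMap.id := by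
      rw [F.map_id]
      rfl
    have h₂ : (F'.map (𝟙 X.2)).hom.toIntLinearMap = LinearMap.id := by
      rw [F'.map_id]
      rfl
    rw [prod_id_fst, prod_id_snd, h₁, h₂, TensorProduct.map_id]
    rfl
  map_comp f g := by
    have h₁ : (F.map (f ≫ g).1).hom.toIntLinearMap =
        (F.map g.1).hom.toIntLinearMap ∘ₗ (F.map f.1).hom.toIntLinearMap := by
      rw [prod_comp_fst, F.map_comp]
      rfl
    have h₂ : (F'.map (f ≫ g).2).hom.toIntLinearMap =
        (F'.map g.2).hom.toIntLinearMap ∘ₗ (F'.map f.2).hom.toIntLinearMap := by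
      rw [prod_comp_snd, F'.map_comp]
      rfl
    rw [h₁, h₂, TensorProduct.map_comp]
    rfl

namespace MackeyFunctor

variable {O : MorphismProperty (FinGSet G)} [IsIndexingCategory O]

/-- The functor `M ⊗ N` on `A_O × A_O` sending `(X, Y)` to `M X ⊗ N Y`. -/
noncomputable def tensor (M N : MackeyFunctor.{u, w} O) :
    SpanCat O × SpanCat O ⥤ AddCommGrpCat.{w} :=
  externalTensor (toAb M) (toAb N)

/-- The pure tensor `x ⊗ y`. -/
noncomputable def tmul (M N : MackeyFunctor.{u, w} O) {X Y : FinGSet G} (x : M.obj.obj ⟨X⟩)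
    (y : N.obj.obj ⟨Y⟩) : (tensor M N).obj (⟨X⟩, ⟨Y⟩) :=
  TensorProduct.tmul (M := (toAb M).obj ⟨X⟩) (N := (toAb N).obj ⟨Y⟩) ℤ x y

/-- The Mackey functor `P`, with the natural transformation `α` from `M X ⊗ N Y` to `P (X × Y)`, is
the box product of `M` and `N`: it is the left Kan extension of `M ⊗ N` along the cartesian
product `A_O × A_O ⥤ A_O`. -/
def IsBoxProduct (M N P : MackeyFunctor.{u, w} O)
    (α : tensor M N ⟶ SpanCat.prodFunctor O ⋙ toAb P) : Prop :=
  (toAb P).IsLeftKanExtension α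

end MackeyFunctor

section

variable (Oa Om : MorphismProperty (FinGSet G)) [IsIndexingCategory Oa] [IsIndexingCategory Om]
    [Compatible Oa Om]

/-- An `(Oa, Om)`-Tambara functor is a product preserving functor `BiPoly Oa Om ⥤ Type` all of whose
values are groups under the addition given by transfers along fold maps. -/
class IsTambara (F : BiPoly Oa Om ⥤ Type w) : Prop extends PreservesFiniteProducts F where
  exists_neg : ∀ (X : FinGSet G) (x : F.obj (BiPoly.mk Oa Om X)),
    ∃ y, SpanCat.add (SpanCat.toBiPoly Oa Om ⋙ F) x y = SpanCat.zero (SpanCat.toBiPoly Oa Om ⋙ F) X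

/-- The category of `(Oa, Om)`-Tambara functors and natural transformations. -/
abbrev TambaraFunctor := ObjectProperty.FullSubcategory fun F : BiPoly Oa Om ⥤ Type w =>
  IsTambara Oa Om F

end

namespace TambaraFunctor

variable {Oa Om : MorphismProperty (FinGSet G)} [IsIndexingCategory Oa] [IsIndexingCategory Om]
    [Compatible Oa Om]

instance (F : TambaraFunctor.{u, w} Oa Om) : IsTambara Oa Om F.obj := F.property

instance (F : BiPoly Oa Om ⥤ Type w) [IsTambara Oa Om F] :
    IsMackey (SpanCat.toBiPoly Oa Om ⋙ F) where
  toPreservesFiniteProducts := inferInstance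
  exists_neg := IsTambara.exists_neg

/-- The underlying `Oa`-Mackey functor of an `(Oa, Om)`-Tambara functor. -/
noncomputable def underlying (F : TambaraFunctor.{u, w} Oa Om) : MackeyFunctor.{u, w} Oa :=
  ⟨SpanCat.toBiPoly Oa Om ⋙ F.obj, inferInstance⟩

variable (F : TambaraFunctor.{u, w} Oa Om)

/-- The restriction `F Y → F X` along `f : X ⟶ Y`. -/
def res {X Y : FinGSet G} (f : X ⟶ Y) (y : F.obj.obj (BiPoly.mk Oa Om Y)) :
    F.obj.obj (BiPoly.mk Oa Om X) := F.obj.map (BiPoly.res Oa Om f) y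

/-- The multiplication on `F X`, given by the norm along the fold map `X ⨿ X ⟶ X`. -/
noncomputable def mul {X : FinGSet G} (x y : F.obj.obj (BiPoly.mk Oa Om X)) :
    F.obj.obj (BiPoly.mk Oa Om X) :=
  F.obj.map (BiPoly.nm Oa (fold X) (IsIndexingCategory.fold_mem Om X))
    (SpanCat.pair (SpanCat.toBiPoly Oa Om ⋙ F.obj) x y)

end TambaraFunctor

end

/-! Cocompleteness. Being a Tambara functor is an orthogonality condition on a functor `F` from
polynomials to sets. Write `y` for corepresentable functors. Then `F` preserves finite products iff
it is local for the maps `y X ⨿ y Y ⟶ y (X ⨿ Y)` and for the map from the initial functor to `y ∅`.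
The commutative monoid `F X` is a group iff the shear `(x, y) ↦ (x, x + y)` is bijective, that is,
iff `F` is local for an endomorphism of `y (X ⨿ X)`; see `exists_neg_iff_bijective_map_shear` and
`isTambara_iff`. Since `G` is finite, a small set of finite `G`-sets suffices for these tests, and
all functors involved are finitely presentable. So Tambara functors form a reflective subcategory of
the functor category and inherit its colimits.

Coproducts. For product preserving `R` and `S` on a category with finite products, the coproduct
among product preserving functors is the left Kan extension `joint R S` of `R X × S Y` along the
product: its elements at `Z` are classes of triples `(φ : X ⨿ Y ⟶ Z, x, y)`. For polynomials,
`exists_factorization` writes every such `φ` as `p ⨿ q`, followed by the external multiplication `V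
⨿ W ⟶ V × W`, followed by a span `k`: the norm part of `φ` splits over the two summands. Hence every
element of `joint R S` at `Z` has the form `k (u ⊠ v)` with one `u` in `R V` and one `v` in `S W`.
Its negative is `k (-u ⊠ v)`, so `joint R S` is a Tambara functor, and it is the coproduct.

Box product. The external product is biadditive and natural for spans (`extMul_naturality`), which
gives the transformation `α`. Conversely, a natural pairing `β` into a functor `H` must induce `k (u
⊠ v) ↦ k (β (u, v))`. This is well defined because a polynomial determines its factorization up to
moving spans across the multiplication, and `β` is natural for such moves (`IsValue.unique`). It is
additive because a sum of two elements `k (u ⊠ v)` is again one such element, by a formula that does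
not depend on the pairing (`exists_add_pairing`). This is the universal property of the Kan
extension. The formula for `α` holds because the product of the two restrictions to `X × Y` is the
external product (`nm_fold_prodPair`). -/

section
variable {G : Type u} [Group G]

/-! ### Splitting over disjoint unions, and composites of explicit polynomials. -/

namespace FinGSet

/-- The map to a product with given components. -/
def prodLift {W X Y : FinGSet G} (f : W ⟶ X) (g : W ⟶ Y) : W ⟶ prod X Y :=
  mkHom (Y := prod X Y) (fun w => (ap f w, ap g w)) fun a w => Prod.ext (ap_smul f a w) (ap_smul g a w)

lemma sum_hom_ext {X Y Z : FinGSet G} {f g : sum X Y ⟶ Z} (h₁ : inl X Y ≫ f = inl X Y ≫ g)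
    (h₂ : inr X Y ≫ f = inr X Y ≫ g) : f = g := by
  ext z
  rcases sum_cases z with ⟨x, rfl⟩ | ⟨x, rfl⟩
  · exact ap_congr h₁ x
  · exact ap_congr h₂ x

lemma isIso_of_bijective {X Y : FinGSet G} (f : X ⟶ Y) (h : Function.Bijective (ap f)) :
    IsIso f := by
  obtain ⟨i, h₁, h₂⟩ := Function.bijective_iff_has_inverse.1 h
  exact (mkIso f i h₁ h₂).isIso_hom

/-- `A` and `B` are the preimages of the two summands, realised as fibre products. -/
lemma exists_sum_iso {U X Y : FinGSet G} (f : U ⟶ sum X Y) :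
    ∃ (A B : FinGSet G) (f₁ : A ⟶ X) (f₂ : B ⟶ Y) (e : sum A B ≅ U), e.hom ≫ f = sumMap f₁ f₂ := by
  have h : IsIso (desc (pbFst f (inl X Y)) (pbFst f (inr X Y))) := by
    apply isIso_of_bijective
    refine Bispan.desc_bijective _ _ ?_ ?_ ?_ ?_
    · intro x y h
      exact Subtype.ext (Prod.ext h (inl_inj (x.2.symm.trans ((congrArg (ap f) h).trans y.2))))
    · intro x y h
      exact Subtype.ext (Prod.ext h (inr_inj (x.2.symm.trans ((congrArg (ap f) h).trans y.2))))
    · intro x y h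
      exact inl_ne_inr (x.2.symm.trans ((congrArg (ap f) h).trans y.2))
    · intro z
      rcases sum_cases (ap f z) with ⟨x, hx⟩ | ⟨x, hx⟩
      · exact Or.inl ⟨⟨(z, x), hx⟩, rfl⟩
      · exact Or.inr ⟨⟨(z, x), hx⟩, rfl⟩
  refine ⟨_, _, pbSnd f (inl X Y), pbSnd f (inr X Y), asIso (desc (pbFst f _) (pbFst f _)), ?_⟩
  apply sum_hom_ext
  · exact (isPullback_pb f (inl X Y)).w
  · exact (isPullback_pb f (inr X Y)).w

end FinGSet

namespace Bispan

/-- The leg `f` of the first factor does not enter the dependent product, so the isomorphism of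
`id_comp` applies unchanged. The same remark on the last leg gives `comp_tr` from `comp_id`. -/
lemma res_comp {X Y Z : FinGSet G} (f : X ⟶ Y) (Q : Bispan X Z) :
    IsIso ((res f).comp Q) ⟨Q.U₁, Q.U₂, Q.f ≫ f, Q.g, Q.h⟩ := by
  obtain ⟨e₁, e₂, hf, hg, hh⟩ := id_comp Q
  exact ⟨e₁, e₂, (reassoc_of% hf) f, hg, hh⟩

/-- The polynomial `T_h`. -/
def tr {X Y : FinGSet G} (h : X ⟶ Y) : Bispan X Y := ⟨X, X, 𝟙 X, 𝟙 X, h⟩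

lemma comp_tr {X Y Z : FinGSet G} (P : Bispan X Y) (k : Y ⟶ Z) :
    IsIso (P.comp (tr k)) ⟨P.U₁, P.U₂, P.f, P.g, P.h ≫ k⟩ := by
  obtain ⟨e₁, e₂, hf, hg, hh⟩ := comp_id P
  exact ⟨e₁, e₂, hf, hg, (reassoc_of% hh) k⟩

/-- The first factor has no transfer, so the only section over a fibre of `k` is its inclusion into
`B`, and the dependent product collapses to `C`. -/
lemma comp_nm {X A B C : FinGSet G} (f : A ⟶ X) (g : A ⟶ B) (k : B ⟶ C) :
    IsIso ⟨A, C, f, g ≫ k, 𝟙 C⟩ ((⟨A, B, f, g, 𝟙 B⟩ : Bispan X B).comp (nm k)) := by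
  let F₂ : C.V → Sec k (𝟙 B) (𝟙 B) := fun c => ⟨c, fun b _ => b, fun _ _ => rfl⟩
  have F₂sm : ∀ (a : G) c, F₂ (a • c) = a • F₂ c := fun a c =>
    Sec.ext' rfl fun b _ _ => (smul_inv_smul a b).symm
  let F₁ : A.V → Pos k (𝟙 B) g (𝟙 B) := fun a => ⟨F₂ (ap k (ap g a)), ap g a, rfl, a, rfl⟩
  have hF : ∀ x : Sec k (𝟙 B) (𝟙 B), F₂ x.pt = x := fun x =>
    Sec.ext' rfl fun b _ hb => (x.lies b hb).symm
  refine IsIso.of_bijective (P := ⟨A, C, f, g ≫ k, 𝟙 C⟩)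
    (Q := (⟨A, B, f, g, 𝟙 B⟩ : Bispan X B).comp (nm k))
    (mkHom (Y := posObj _ _ _ _) F₁ fun a v => ?_) (mkHom (Y := secObj _ _ _) F₂ F₂sm)
    ⟨?_, ?_⟩ ⟨?_, ?_⟩ (fun _ => rfl) (fun _ => rfl) fun _ => rfl
  · refine Pos.ext' ((congrArg F₂ ?_).trans (F₂sm a _)) (ap_smul g a v) rfl
    rw [ap_smul, ap_smul]
  · intro v v' e
    exact congrArg Pos.a e
  · intro (x : Pos k (𝟙 B) g (𝟙 B))
    have h : ap g x.a = x.c := x.ha.trans (x.sh.lies _ x.hc)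
    refine ⟨x.a, Pos.ext' ?_ h rfl⟩
    exact (congrArg F₂ ((congrArg (ap k) h).trans x.hc)).trans (hF _)
  · intro v v' e
    exact congrArg Sec.pt e
  · intro (x : Sec k (𝟙 B) (𝟙 B))
    exact ⟨x.pt, hF x⟩

/-- The polynomial `X ⨿ Y ← (X × Y) ⨿ (X × Y) → X × Y` giving the external multiplication. -/
def extMul (X Y : FinGSet G) : Bispan (sum X Y) (FinGSet.prod X Y) :=
  ⟨sum (FinGSet.prod X Y) (FinGSet.prod X Y), FinGSet.prod X Y, sumMap (fst X Y) (snd X Y), fold _, 𝟙 _⟩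

/-- Base change: fold maps are stable under pullback along `prodMap f g`. -/
lemma extMul_res {X X' Y Y' : FinGSet G} (f : X ⟶ X') (g : Y ⟶ Y') :
    IsIso ((res (sumMap f g)).comp (extMul X Y)) ((extMul X' Y').comp (res (prodMap f g))) := by
  refine (res_comp _ _).trans ?_
  refine comp_res (extMul X' Y') (prodMap f g) _ (sumMap (prodMap f g) (prodMap f g))
    (prodMap f g) ?_ (isPullback_fold _).flip.flip ?_
  · exact sum_hom_ext rfl rfl
  · exact IsPullback.of_id_snd

/-- The distributive law for the fold map of `X' × Y'`. A section over `(x', y')` chooses a point of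
`X ⨿ Y` above `inl x'` and one above `inr y'`, that is, a point of `X` over `x'` and a point of `Y`
over `y'`. So the dependent product is `X × Y`, lying over `X' × Y'` by `prodMap f g`. -/
lemma tr_extMul {X X' Y Y' : FinGSet G} (f : X ⟶ X') (g : Y ⟶ Y') :
    IsIso ⟨_, _, (extMul X Y).f, (extMul X Y).g, prodMap f g⟩
      ((tr (sumMap f g)).comp (extMul X' Y')) := by
  let E := extMul X' Y'
  -- The section belonging to `v`: its first coordinate on the first sheet of the fold map, its
  -- second coordinate on the second sheet.
  let s : (FinGSet.prod X Y).V → E.U₁.V → (sum X Y).V := fun v c =>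
    Sum.elim (fun _ => Sum.inl v.1) (fun _ => Sum.inr v.2) c
  have hs : ∀ (v : (FinGSet.prod X Y).V) c, ap E.g c = ap (prodMap f g) v →
      ap (sumMap f g) (s v c) = ap E.f c := by
    intro v c hc
    rcases c with c | c
    · exact congrArg Sum.inl (congrArg Prod.fst hc).symm
    · exact congrArg Sum.inr (congrArg Prod.snd hc).symm
  let F₂ : (FinGSet.prod X Y).V → Sec E.g E.f (sumMap f g) := fun v =>
    ⟨ap (prodMap f g) v, fun c _ => s v c, hs v⟩
  have F₂sm : ∀ (a : G) v, F₂ (a • v) = a • F₂ v := fun a v =>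
    Sec.ext' (ap_smul (prodMap f g) a v) fun c _ _ => by
      rcases c with c | c <;> rfl
  have b₂ : Function.Bijective F₂ := by
    constructor
    · intro v v' e
      have h₁ := Sec.sec_congr' e (c := ap (inl _ _) (ap (prodMap f g) v)) rfl rfl
        (congrArg Sec.pt e)
      have h₂ := Sec.sec_congr' e (c := ap (inr _ _) (ap (prodMap f g) v)) rfl rfl
        (congrArg Sec.pt e)
      exact Prod.ext (Sum.inl_injective h₁) (Sum.inr_injective h₂)
    · intro x
      have h₁ := x.lies (ap (inl _ _) x.pt) rfl
      have h₂ := x.lies (ap (inr _ _) x.pt) rfl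
      -- A point above `inl x'` must lie in `X`, and below, a point above `inr y'` must lie in `Y`,
      -- since `sumMap f g` preserves the summands.
      rcases sum_cases (x.sec (ap (inl _ _) x.pt) rfl) with ⟨v, hv⟩ | ⟨v, hv⟩
      swap
      · rw [hv] at h₁
        exact (inl_ne_inr h₁.symm).elim
      rcases sum_cases (x.sec (ap (inr _ _) x.pt) rfl) with ⟨v', hv'⟩ | ⟨v', hv'⟩
      · rw [hv'] at h₂
        exact (inl_ne_inr h₂).elim
      rw [hv] at h₁
      rw [hv'] at h₂
      have e₁ : ap f v = x.pt.1 := inl_inj h₁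
      have e₂ : ap g v' = x.pt.2 := inr_inj h₂
      refine ⟨(v, v'), Sec.ext' (Prod.ext e₁ e₂) fun c _ hc => ?_⟩
      rcases c with c | c
      · exact hv.symm.trans (x.sec_congr (congrArg Sum.inl hc.symm) _ _)
      · exact hv'.symm.trans (x.sec_congr (congrArg Sum.inr hc.symm) _ _)
  let F₁ : (extMul X Y).U₁.V → Pos E.g E.f (𝟙 _) (sumMap f g) := fun v =>
    ⟨F₂ (ap (fold _) v), ap (sumMap (prodMap f g) (prodMap f g)) v,
      by rcases v with v | v <;> rfl, ap (sumMap (fst X Y) (snd X Y)) v,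
      by rcases v with v | v <;> rfl⟩
  refine IsIso.of_bijective (P := ⟨_, _, (extMul X Y).f, (extMul X Y).g, prodMap f g⟩)
    (Q := (tr (sumMap f g)).comp (extMul X' Y'))
    (mkHom (Y := posObj _ _ _ _) F₁ fun a v => ?_) (mkHom (Y := secObj _ _ _) F₂ F₂sm)
    ⟨?_, ?_⟩ b₂ (fun _ => rfl) (fun _ => rfl) fun _ => rfl
  · refine Pos.ext' ((congrArg F₂ ?_).trans (F₂sm a _)) (ap_smul _ a v) (ap_smul _ a v)
    exact ap_smul _ a v
  · intro v v' e
    have e₁ := b₂.1 (congrArg Pos.sh e)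
    have e₂ : ap (sumMap (prodMap f g) (prodMap f g)) v =
      ap (sumMap (prodMap f g) (prodMap f g)) v' := congrArg Pos.c e
    rcases v with v | v <;> rcases v' with v' | v'
    · exact congrArg Sum.inl e₁
    · exact (inl_ne_inr e₂).elim
    · exact (inl_ne_inr e₂.symm).elim
    · exact congrArg Sum.inr e₁
  · intro (x : Pos E.g E.f (𝟙 _) (sumMap f g))
    obtain ⟨v, hv⟩ := b₂.2 x.sh
    have hv' : ap (prodMap f g) v = ap E.g x.c := (congrArg Sec.pt hv).trans x.hc.symm
    have ha : x.a = s v x.c := x.ha.trans (Sec.sec_congr' hv rfl hv'.symm x.hc).symm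
    obtain ⟨x, c, hc, a, ha'⟩ := x
    rcases c with c | c
    · exact ⟨Sum.inl v, Pos.ext' hv (congrArg Sum.inl hv') ha.symm⟩
    · exact ⟨Sum.inr v, Pos.ext' hv (congrArg Sum.inr hv') ha.symm⟩

end Bispan
end

/-! ### The calculus of norms, restrictions and transfers in `BiPoly`. -/

section
variable {G : Type u} [Group G]

namespace SpanCat

variable {O : MorphismProperty (FinGSet G)} [IsIndexingCategory O]

lemma ofSpan_eq_res_tr {S T A : FinGSet G} (l : A ⟶ S) (r : A ⟶ T) (hr : O r) :
    ofSpan l r hr = res O l ≫ tr r hr := by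
  rw [res, ofSpan_tr]
  exact ofSpan_eq (Iso.refl _) rfl (by simp)

/-- The cartesian product of two morphisms of `A_O`. -/
noncomputable def prodHom {X X' Y Y' : FinGSet G} (t : (⟨X⟩ : SpanCat O) ⟶ ⟨X'⟩)
    (s : (⟨Y⟩ : SpanCat O) ⟶ ⟨Y'⟩) : (⟨FinGSet.prod X Y⟩ : SpanCat O) ⟶ ⟨FinGSet.prod X' Y'⟩ :=
  (prodFunctor O).map (X := (⟨X⟩, ⟨Y⟩)) (Y := (⟨X'⟩, ⟨Y'⟩)) (t, s)

lemma prodHom_ofSpan {X X' Y Y' A B : FinGSet G} (l : A ⟶ X) (r : A ⟶ X') (hr : O r) (l' : B ⟶ Y)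
    (r' : B ⟶ Y') (hr' : O r') :
    prodHom (ofSpan l r hr) (ofSpan l' r' hr') =
      ofSpan (prodMap l l') (prodMap r r') (IsIndexingCategory.prodMap_mem hr hr') := rfl

end SpanCat

namespace BiPoly

open MonoidalCategory CartesianMonoidalCategory

variable {Oa Om : MorphismProperty (FinGSet G)} [IsIndexingCategory Oa] [IsIndexingCategory Om]
    [Compatible Oa Om]

/-- With this choice `mk Oa Om X ⊗ mk Oa Om Y` unfolds to `mk Oa Om (sum X Y)`; the proofs below
pass freely between the two. -/
noncomputable instance : CartesianMonoidalCategory (BiPoly Oa Om) :=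
  .ofChosenFiniteProducts ⟨_, isTerminalEmpty⟩ fun X Y => ⟨_, isLimitSum X.obj.obj Y.obj.obj⟩

lemma exists_ofBispan {X Y : FinGSet G} (φ : mk Oa Om X ⟶ mk Oa Om Y) :
    ∃ (P : Bispan X Y) (hg : Om P.g) (hh : Oa P.h), φ = ofBispan P hg hh := by
  obtain ⟨_, P, hg, hh, rfl⟩ := φ
  exact ⟨P, hg, hh, rfl⟩

lemma ofBispan_eq_iff {X Y : FinGSet G} {P Q : Bispan X Y} {hg : Om P.g} {hh : Oa P.h}
    {hg' : Om Q.g} {hh' : Oa Q.h} :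
    (ofBispan P hg hh : mk Oa Om X ⟶ mk Oa Om Y) = ofBispan Q hg' hh' ↔ P.IsIso Q :=
  ⟨fun h => Quotient.exact (congrArg (fun f => f.hom) h),
    fun h => WideSubcategory.hom_ext _ (Quotient.sound h)⟩

lemma ofBispan_eq {X Y : FinGSet G} {P Q : Bispan X Y} {hg : Om P.g} {hh : Oa P.h}
    {hg' : Om Q.g} {hh' : Oa Q.h} (h : P.IsIso Q) :
    (ofBispan P hg hh : mk Oa Om X ⟶ mk Oa Om Y) = ofBispan Q hg' hh' :=
  ofBispan_eq_iff.2 h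

/-- Reduces identities between composites in `BiPoly` to isomorphisms of polynomials: a composite of
classes unfolds to the class of `Bispan.comp`, so the two default proofs apply. -/
lemma hom_ext_of_isIso {X Y : FinGSet G} {φ ψ : mk Oa Om X ⟶ mk Oa Om Y} {P Q : Bispan X Y}
    (h : P.IsIso Q) (hφ : φ.hom = PolyCat.ofBispan P := by rfl)
    (hψ : ψ.hom = PolyCat.ofBispan Q := by rfl) : φ = ψ :=
  WideSubcategory.hom_ext _ (hφ.trans ((Quotient.sound h).trans hψ.symm))

variable (Om) in
/-- The transfer `T_h`. -/
def tr {X Y : FinGSet G} (h : X ⟶ Y) (hh : Oa h) : mk Oa Om X ⟶ mk Oa Om Y :=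
  ofBispan (Bispan.tr h) (Om.id_mem _) hh

variable (Om) in
/-- A morphism of `A_Oa`, as a morphism of `BiPoly Oa Om`. -/
noncomputable def span {X Y : FinGSet G} (t : (⟨X⟩ : SpanCat Oa) ⟶ ⟨Y⟩) : mk Oa Om X ⟶ mk Oa Om Y :=
  (SpanCat.toBiPoly Oa Om).map t

lemma span_comp {X Y Z : FinGSet G} (t : (⟨X⟩ : SpanCat Oa) ⟶ ⟨Y⟩) (s : (⟨Y⟩ : SpanCat Oa) ⟶ ⟨Z⟩) :
    span Om (t ≫ s) = span Om t ≫ span Om s :=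
  (SpanCat.toBiPoly Oa Om).map_comp t s

lemma span_tr {X Y : FinGSet G} (h : X ⟶ Y) (hh : Oa h) :
    span Om (SpanCat.tr h hh) = tr Om h hh := rfl

lemma span_res {X Y : FinGSet G} (f : X ⟶ Y) :
    span Om (SpanCat.res Oa f) = res Oa Om f := rfl

variable (Oa) in
/-- The morphism `N_g R_f`. -/
def nr {X A U : FinGSet G} (f : A ⟶ X) (g : A ⟶ U) (hg : Om g) : mk Oa Om X ⟶ mk Oa Om U :=
  ofBispan ⟨A, U, f, g, 𝟙 U⟩ hg (Oa.id_mem _)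

lemma nr_tr {X A U Y : FinGSet G} (f : A ⟶ X) (g : A ⟶ U) (hg : Om g) (h : U ⟶ Y) (hh : Oa h) :
    nr Oa f g hg ≫ tr Om h hh = ofBispan ⟨A, U, f, g, h⟩ hg hh := by
  exact hom_ext_of_isIso (Bispan.comp_tr _ _)

lemma nr_nm {X A U V : FinGSet G} (f : A ⟶ X) (g : A ⟶ U) (hg : Om g) (k : U ⟶ V) (hk : Om k) :
    nr Oa f g hg ≫ nm Oa k hk = nr Oa f (g ≫ k) (Om.comp_mem _ _ hg hk) := by
  exact hom_ext_of_isIso (Bispan.comp_nm _ _ _).symm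

lemma nr_res {X A U V B : FinGSet G} {f : A ⟶ X} {g : A ⟶ U} {hg : Om g} {i : V ⟶ U} {j : B ⟶ A}
    {g' : B ⟶ V} (h : IsPullback j g' g i) :
    nr Oa f g hg ≫ res Oa Om i = nr Oa (j ≫ f) g' (Om.of_isPullback h hg) := by
  exact hom_ext_of_isIso (Bispan.comp_res ⟨A, U, f, g, 𝟙 U⟩ i ⟨B, V, j ≫ f, g', 𝟙 V⟩ j i rfl h
    IsPullback.of_id_snd).symm

lemma exists_nr_tr {X Y : FinGSet G} (φ : mk Oa Om X ⟶ mk Oa Om Y) :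
    ∃ (A U : FinGSet G) (f : A ⟶ X) (g : A ⟶ U) (hg : Om g) (h : U ⟶ Y) (hh : Oa h),
      φ = nr Oa f g hg ≫ tr Om h hh := by
  obtain ⟨P, hg, hh, rfl⟩ := exists_ofBispan φ
  exact ⟨_, _, _, _, hg, _, hh, (nr_tr _ _ _ _ _).symm⟩

lemma exists_nr_res {X A U V : FinGSet G} (f : A ⟶ X) (g : A ⟶ U) (hg : Om g) (i : V ⟶ U) :
    ∃ (B : FinGSet G) (f' : B ⟶ X) (g' : B ⟶ V) (hg' : Om g'),
      nr Oa f g hg ≫ res Oa Om i = nr Oa f' g' hg' :=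
  ⟨_, _, _, _, nr_res (isPullback_pb g i)⟩

lemma eq_tensorHom {X X' Y Y' : FinGSet G} {a : mk Oa Om X ⟶ mk Oa Om X'}
    {b : mk Oa Om Y ⟶ mk Oa Om Y'} {c : mk Oa Om (sum X Y) ⟶ mk Oa Om (sum X' Y')}
    (h₁ : c ≫ res Oa Om (inl X' Y') = res Oa Om (inl X Y) ≫ a)
    (h₂ : c ≫ res Oa Om (inr X' Y') = res Oa Om (inr X Y) ≫ b) : c = a ⊗ₘ b := by
  refine CartesianMonoidalCategory.hom_ext (X := mk Oa Om X') (Y := mk Oa Om Y') _ _ ?_ ?_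
  · rw [tensorHom_fst]
    exact h₁
  · rw [tensorHom_snd]
    exact h₂

/-- Restricting the disjoint union of `P` and `Q` to a summand of the target recovers `P` or `Q`,
because the relevant squares of inclusions are pullbacks. -/
lemma ofBispan_sum {X X' Y Y' : FinGSet G} (P : Bispan X X') (Q : Bispan Y Y') (hP : Om P.g)
    (hP' : Oa P.h) (hQ : Om Q.g) (hQ' : Oa Q.h) :
    ((ofBispan P hP hP' : mk Oa Om X ⟶ mk Oa Om X') ⊗ₘ (ofBispan Q hQ hQ' : mk Oa Om Y ⟶ mk Oa Om Y')) =
      (ofBispan ⟨sum P.U₁ Q.U₁, sum P.U₂ Q.U₂, sumMap P.f Q.f, sumMap P.g Q.g, sumMap P.h Q.h⟩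
        (IsIndexingCategory.sumMap_mem hP hQ) (IsIndexingCategory.sumMap_mem hP' hQ') :
        mk Oa Om (sum X Y) ⟶ mk Oa Om (sum X' Y')) := by
  refine (eq_tensorHom ?_ ?_).symm
  · refine hom_ext_of_isIso (Bispan.IsIso.trans (.symm ?_) (Bispan.res_comp _ _).symm)
    exact Bispan.comp_res _ _ _ (inl _ _) (inl _ _) rfl (isPullback_inl _ _) (isPullback_inl _ _)
  · refine hom_ext_of_isIso (Bispan.IsIso.trans (.symm ?_) (Bispan.res_comp _ _).symm)
    exact Bispan.comp_res _ _ _ (inr _ _) (inr _ _) rfl (isPullback_inr _ _) (isPullback_inr _ _)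

lemma tr_sum {X X' Y Y' : FinGSet G} (f : X ⟶ X') (g : Y ⟶ Y') (hf : Oa f) (hg : Oa g) :
    (tr Om f hf ⊗ₘ tr Om g hg) = tr Om (sumMap f g) (IsIndexingCategory.sumMap_mem hf hg) := by
  refine (ofBispan_sum _ _ _ _ _ _).trans (ofBispan_eq ?_)
  exact ⟨Iso.refl _, Iso.refl _, sum_hom_ext rfl rfl, sum_hom_ext rfl rfl, sum_hom_ext rfl rfl⟩

lemma res_sum {X X' Y Y' : FinGSet G} (f : X ⟶ X') (g : Y ⟶ Y') :
    (res Oa Om f ⊗ₘ res Oa Om g) = res Oa Om (sumMap f g) := by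
  refine (ofBispan_sum _ _ _ _ _ _).trans (ofBispan_eq ?_)
  exact ⟨Iso.refl _, Iso.refl _, sum_hom_ext rfl rfl, sum_hom_ext rfl rfl, sum_hom_ext rfl rfl⟩

lemma nr_sum {X Y A B U V : FinGSet G} (f : A ⟶ X) (g : A ⟶ U) (hg : Om g) (f' : B ⟶ Y) (g' : B ⟶ V)
    (hg' : Om g') :
    (nr Oa f g hg ⊗ₘ nr Oa f' g' hg') =
      nr Oa (sumMap f f') (sumMap g g') (IsIndexingCategory.sumMap_mem hg hg') := by
  refine (ofBispan_sum _ _ _ _ _ _).trans (ofBispan_eq ?_)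
  exact ⟨Iso.refl _, Iso.refl _, sum_hom_ext rfl rfl, sum_hom_ext rfl rfl, sum_hom_ext rfl rfl⟩

variable (Oa Om) in
/-- The external multiplication `X ⨿ Y ⟶ X × Y`. -/
noncomputable def extMul (X Y : FinGSet G) : mk Oa Om X ⊗ mk Oa Om Y ⟶ mk Oa Om (FinGSet.prod X Y) :=
  (ofBispan (Bispan.extMul X Y) (IsIndexingCategory.fold_mem Om _) (Oa.id_mem _) :
    mk Oa Om (sum X Y) ⟶ _)

lemma res_extMul {X X' Y Y' : FinGSet G} (f : X ⟶ X') (g : Y ⟶ Y') :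
    (res Oa Om f ⊗ₘ res Oa Om g) ≫ extMul Oa Om X Y = extMul Oa Om X' Y' ≫ res Oa Om (prodMap f g) := by
  rw [res_sum]
  exact hom_ext_of_isIso (Bispan.extMul_res f g)

lemma tr_extMul {X X' Y Y' : FinGSet G} (f : X ⟶ X') (g : Y ⟶ Y') (hf : Oa f) (hg : Oa g) :
    (tr Om f hf ⊗ₘ tr Om g hg) ≫ extMul Oa Om X' Y' =
      extMul Oa Om X Y ≫ tr Om (prodMap f g) (IsIndexingCategory.prodMap_mem hf hg) := by
  rw [tr_sum]
  exact hom_ext_of_isIso ((Bispan.tr_extMul f g).symm.trans (Bispan.comp_tr _ _).symm)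

/-- A span is a restriction followed by a transfer, so `res_extMul` and `tr_extMul` together give
naturality for all Mackey operations. -/
lemma extMul_naturality {X X' Y Y' : FinGSet G} (t : (⟨X⟩ : SpanCat Oa) ⟶ ⟨X'⟩)
    (s : (⟨Y⟩ : SpanCat Oa) ⟶ ⟨Y'⟩) :
    (span Om t ⊗ₘ span Om s) ≫ extMul Oa Om X' Y' =
      extMul Oa Om X Y ≫ span Om (SpanCat.prodHom t s) := by
  obtain ⟨A, l, r, hr, rfl⟩ := SpanCat.exists_ofSpan t
  obtain ⟨B, l', r', hr', rfl⟩ := SpanCat.exists_ofSpan s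
  rw [SpanCat.prodHom_ofSpan, SpanCat.ofSpan_eq_res_tr l, SpanCat.ofSpan_eq_res_tr l',
    SpanCat.ofSpan_eq_res_tr (prodMap l l'), span_comp, span_comp, span_comp, span_res, span_tr,
    span_res, span_tr, span_res, span_tr, ← reassoc_of% (res_extMul l l'),
    ← tr_extMul r r' hr hr', tensorHom_comp_tensorHom_assoc]

end BiPoly
end

/-! ### Factoring polynomials through the external multiplication; values of natural pairings. -/

section
variable {G : Type u} [Group G]

namespace FinGSet

/-- Each summand is the pullback of the union along `inl X Y` or `inr X Y`, so an isomorphism over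
`X ⨿ Y` respects the summands. -/
lemma exists_sum_isos {X Y A B A' B' : FinGSet G} {f₁ : A ⟶ X} {f₂ : B ⟶ Y} {f₁' : A' ⟶ X}
    {f₂' : B' ⟶ Y} (e : sum A B ≅ sum A' B') (he : e.hom ≫ sumMap f₁' f₂' = sumMap f₁ f₂) :
    ∃ (eA : A ≅ A') (eB : B ≅ B'), inl A B ≫ e.hom = eA.hom ≫ inl A' B' ∧
      inr A B ≫ e.hom = eB.hom ≫ inr A' B' := by
  have h₁ := isPullback_inl f₁ f₂
  have h₁' := isPullback_inl f₁' f₂'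
  have h₂ := isPullback_inr f₁ f₂
  have h₂' := isPullback_inr f₁' f₂'
  have k₁ : IsPullback (inl A B ≫ e.hom) f₁ (sumMap f₁' f₂') (inl X Y) :=
    h₁.of_iso (Iso.refl _) e (Iso.refl _) (Iso.refl _) (by simp) (by simp) (by simp [he]) (by simp)
  have k₂ : IsPullback (inr A B ≫ e.hom) f₂ (sumMap f₁' f₂') (inr X Y) :=
    h₂.of_iso (Iso.refl _) e (Iso.refl _) (Iso.refl _) (by simp) (by simp) (by simp [he]) (by simp)
  exact ⟨k₁.isoIsPullback _ _ h₁', k₂.isoIsPullback _ _ h₂',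
    (k₁.isoIsPullback_hom_fst _ _ h₁').symm, (k₂.isoIsPullback_hom_fst _ _ h₂').symm⟩

end FinGSet

namespace BiPoly

open MonoidalCategory CartesianMonoidalCategory

variable {Oa Om : MorphismProperty (FinGSet G)} [IsIndexingCategory Oa] [IsIndexingCategory Om]
    [Compatible Oa Om]

lemma extMul_res_diag (U : FinGSet G) :
    extMul Oa Om U U ≫ res Oa Om (prodLift (𝟙 U) (𝟙 U)) =
      nm Oa (fold U) (IsIndexingCategory.fold_mem Om U) := by
  refine hom_ext_of_isIso (Bispan.comp_res (Bispan.extMul U U) _ (Bispan.nm (fold U))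
    (sumMap (prodLift (𝟙 U) (𝟙 U)) (prodLift (𝟙 U) (𝟙 U))) (prodLift (𝟙 U) (𝟙 U)) ?_
    (isPullback_fold _) IsPullback.of_id_snd).symm
  exact sum_hom_ext rfl rfl

/-- The normal form of a factorization: two norms with the same target `U`, multiplied inside `U`
(the external product restricted to the diagonal) and then transferred along `h`. -/
lemma nr_extMul_span {X Y Z U A B : FinGSet G} (f₁ : A ⟶ X) (g₁ : A ⟶ U) (hg₁ : Om g₁)
    (f₂ : B ⟶ Y) (g₂ : B ⟶ U) (hg₂ : Om g₂) (h : U ⟶ Z) (hh : Oa h) :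
    (nr Oa f₁ g₁ hg₁ ⊗ₘ nr Oa f₂ g₂ hg₂) ≫ extMul Oa Om U U ≫
      span Om (SpanCat.ofSpan (prodLift (𝟙 U) (𝟙 U)) h hh) =
    ofBispan ⟨sum A B, U, sumMap f₁ f₂, desc g₁ g₂, h⟩
      (IsIndexingCategory.desc_mem _ _ hg₁ hg₂) hh := by
  rw [SpanCat.ofSpan_eq_res_tr, span_comp, span_res, span_tr, ← Category.assoc (extMul Oa Om U U),
    extMul_res_diag, nr_sum]
  refine (Category.assoc _ _ _).symm.trans ?_
  refine (congrArg (· ≫ tr Om h hh) (nr_nm _ _ _ _ _)).trans ((nr_tr _ _ _ _ _).trans ?_)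
  refine ofBispan_eq ⟨Iso.refl _, Iso.refl _, sum_hom_ext rfl rfl, sum_hom_ext rfl rfl, rfl⟩

/-- Splitting `U₁` into its parts over `X` and `Y` writes the norm as a product of two norms into
`U₂`. After `p` and `q` only one multiplication and a span remain, and these a natural pairing can
see. -/
lemma exists_factorization {X Y Z : FinGSet G} (φ : mk Oa Om X ⊗ mk Oa Om Y ⟶ mk Oa Om Z) :
    ∃ (V W : FinGSet G) (p : mk Oa Om X ⟶ mk Oa Om V) (q : mk Oa Om Y ⟶ mk Oa Om W)
      (k : (⟨FinGSet.prod V W⟩ : SpanCat Oa) ⟶ ⟨Z⟩),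
      φ = (p ⊗ₘ q) ≫ extMul Oa Om V W ≫ span Om k := by
  obtain ⟨P, hg, hh, rfl⟩ := exists_ofBispan (X := sum X Y) φ
  obtain ⟨A, B, f₁, f₂, e, he⟩ := exists_sum_iso P.f
  have hm : Om (e.hom ≫ P.g) := Om.comp_mem _ _ (MorphismProperty.of_isIso Om _) hg
  refine ⟨P.U₂, P.U₂, nr Oa f₁ (inl A B ≫ e.hom ≫ P.g)
    (Om.comp_mem _ _ (IsIndexingCategory.inl_mem _ _) hm), nr Oa f₂ (inr A B ≫ e.hom ≫ P.g)
    (Om.comp_mem _ _ (IsIndexingCategory.inr_mem _ _) hm),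
    SpanCat.ofSpan (prodLift (𝟙 _) (𝟙 _)) P.h hh, ?_⟩
  rw [nr_extMul_span]
  exact ofBispan_eq ⟨e.symm, Iso.refl _, (Iso.inv_comp_eq e).2 he.symm,
    (Iso.inv_comp_eq e).2 (sum_hom_ext rfl rfl), Category.id_comp _⟩

/-- Natural pairings `R X × S Y ⟶ H (X × Y)`. -/
structure ExtPairing (R S : BiPoly Oa Om ⥤ Type w) (H : SpanCat Oa ⥤ Type w) where
  ofFun ::
  /-- The pairing. -/
  toFun : ∀ {X Y : FinGSet G}, R.obj (mk Oa Om X) → S.obj (mk Oa Om Y) → H.obj ⟨FinGSet.prod X Y⟩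
  map_toFun : ∀ {X X' Y Y' : FinGSet G} (t : (⟨X⟩ : SpanCat Oa) ⟶ ⟨X'⟩)
    (s : (⟨Y⟩ : SpanCat Oa) ⟶ ⟨Y'⟩) (x : R.obj (mk Oa Om X)) (y : S.obj (mk Oa Om Y)),
    H.map (SpanCat.prodHom t s) (toFun x y) = toFun (R.map (span Om t) x) (S.map (span Om s) y)

namespace ExtPairing

variable {R S : BiPoly Oa Om ⥤ Type w} {H : SpanCat Oa ⥤ Type w} (β : ExtPairing R S H)

/-- The relation between `φ : X ⨿ Y ⟶ Z`, elements `x`, `y` and the element of `H Z` obtained by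
applying the pairing after a factorization of `φ` through the external multiplication. -/
def IsValue {X Y Z : FinGSet G} (φ : mk Oa Om X ⊗ mk Oa Om Y ⟶ mk Oa Om Z)
    (x : R.obj (mk Oa Om X)) (y : S.obj (mk Oa Om Y)) (v : H.obj ⟨Z⟩) : Prop :=
  ∃ (V W : FinGSet G) (p : mk Oa Om X ⟶ mk Oa Om V) (q : mk Oa Om Y ⟶ mk Oa Om W)
    (k : (⟨FinGSet.prod V W⟩ : SpanCat Oa) ⟶ ⟨Z⟩), φ = (p ⊗ₘ q) ≫ extMul Oa Om V W ≫ span Om k ∧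
      v = H.map k (β.toFun (R.map p x) (S.map q y))

/-- The multiplication and `β` are natural for the same spans, so any span can be moved across both
at once, changing neither `φ` nor `v`. The transfers in `p` and `q` are moved into `k`; then the
left leg of `k` is moved back as restrictions, leaving a diagonal leg. -/
lemma IsValue.exists_normalForm {β : ExtPairing R S H} {X Y Z : FinGSet G}
    {φ : mk Oa Om X ⊗ mk Oa Om Y ⟶ mk Oa Om Z}
    {x : R.obj (mk Oa Om X)} {y : S.obj (mk Oa Om Y)} {v : H.obj ⟨Z⟩} (hv : β.IsValue φ x y v) :
    ∃ (U A B : FinGSet G) (f₁ : A ⟶ X) (g₁ : A ⟶ U) (hg₁ : Om g₁) (f₂ : B ⟶ Y) (g₂ : B ⟶ U)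
      (hg₂ : Om g₂) (h : U ⟶ Z) (hh : Oa h),
      φ = ofBispan ⟨sum A B, U, sumMap f₁ f₂, desc g₁ g₂, h⟩
        (IsIndexingCategory.desc_mem _ _ hg₁ hg₂) hh ∧
      v = H.map (SpanCat.ofSpan (prodLift (𝟙 U) (𝟙 U)) h hh)
        (β.toFun (R.map (nr Oa f₁ g₁ hg₁) x) (S.map (nr Oa f₂ g₂ hg₂) y)) := by
  obtain ⟨V, W, p, q, k, rfl, rfl⟩ := hv
  obtain ⟨A, V', f₁, g₁, hg₁, h₁, hh₁, rfl⟩ := exists_nr_tr p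
  obtain ⟨B, W', f₂, g₂, hg₂, h₂, hh₂, rfl⟩ := exists_nr_tr q
  obtain ⟨U, l, r, hr, hk⟩ := SpanCat.exists_ofSpan
    (SpanCat.prodHom (SpanCat.tr h₁ hh₁) (SpanCat.tr h₂ hh₂) ≫ k)
  -- A map `l` into `V' × W'` is the diagonal of `U` followed by the product of its two components.
  have hk' : SpanCat.prodHom (SpanCat.tr h₁ hh₁) (SpanCat.tr h₂ hh₂) ≫ k =
      SpanCat.prodHom (SpanCat.res Oa (l ≫ FinGSet.fst V' W'))
        (SpanCat.res Oa (l ≫ FinGSet.snd V' W')) ≫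
          SpanCat.ofSpan (prodLift (𝟙 U) (𝟙 U)) r hr := by
    rw [hk]
    symm
    exact SpanCat.res_ofSpan (prodMap (l ≫ FinGSet.fst V' W') (l ≫ FinGSet.snd V' W'))
  obtain ⟨A', f₁', g₁', hg₁', e₁⟩ := exists_nr_res (Oa := Oa) f₁ g₁ hg₁ (l ≫ FinGSet.fst V' W')
  obtain ⟨B', f₂', g₂', hg₂', e₂⟩ := exists_nr_res (Oa := Oa) f₂ g₂ hg₂ (l ≫ FinGSet.snd V' W')
  refine ⟨U, A', B', f₁', g₁', hg₁', f₂', g₂', hg₂', r, hr, ?_, ?_⟩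
  · rw [← nr_extMul_span _ _ hg₁' _ _ hg₂', ← e₁, ← e₂, ← tensorHom_comp_tensorHom_assoc,
      ← tensorHom_comp_tensorHom_assoc, ← span_tr, ← span_tr, ← span_res, ← span_res,
      reassoc_of% (extMul_naturality (Om := Om) (SpanCat.tr h₁ hh₁) (SpanCat.tr h₂ hh₂)),
      reassoc_of% (extMul_naturality (Om := Om) (SpanCat.res Oa (l ≫ FinGSet.fst V' W'))
        (SpanCat.res Oa (l ≫ FinGSet.snd V' W'))), ← span_comp, ← span_comp, hk']
  · rw [Functor.map_comp_apply, Functor.map_comp_apply, ← span_tr, ← span_tr, ← β.map_toFun,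
      ← e₁, ← e₂, Functor.map_comp_apply, Functor.map_comp_apply, ← span_res, ← span_res,
      ← β.map_toFun, ← Functor.map_comp_apply, ← Functor.map_comp_apply, hk']

/-- Two normal forms of one polynomial differ by isomorphisms of `U₁` and `U₂`. The first respects
the summands, so the two pairs of norms differ by the restriction along `e₂ : U ≅ U'`. Naturality of
`β` moves it into the final span, where `e₂` identifies the two spans. -/
lemma IsValue.unique {β : ExtPairing R S H} {X Y Z : FinGSet G}
    {φ : mk Oa Om X ⊗ mk Oa Om Y ⟶ mk Oa Om Z}
    {x : R.obj (mk Oa Om X)} {y : S.obj (mk Oa Om Y)} {v v' : H.obj ⟨Z⟩} (hv : β.IsValue φ x y v)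
    (hv' : β.IsValue φ x y v') : v = v' := by
  obtain ⟨U, A, B, f₁, g₁, hg₁, f₂, g₂, hg₂, h, hh, rfl, rfl⟩ := hv.exists_normalForm
  obtain ⟨U', A', B', f₁', g₁', hg₁', f₂', g₂', hg₂', h', hh', hφ, rfl⟩ := hv'.exists_normalForm
  obtain ⟨e, e₂, ef, eg, eh⟩ := ofBispan_eq_iff.1 hφ
  obtain ⟨eA, eB, hA, hB⟩ := exists_sum_isos e ef
  have ef' := ap_congr ef
  have eg' := ap_congr eg
  have k₁ : nr Oa f₁ g₁ hg₁ = nr Oa f₁' g₁' hg₁' ≫ span Om (SpanCat.res Oa e₂.hom) := by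
    have hp : IsPullback eA.hom g₁ g₁' e₂.hom := by
      refine IsPullback.of_horiz_isIso ⟨hom_ext fun a => ?_⟩
      have := eg' (ap (inl A B) a)
      simp only [ap_comp, ap_desc_inl] at this
      rw [← ap_comp (inl A B), hA] at this
      exact this
    refine (Eq.symm ((nr_res hp).trans ?_))
    congr 1
    ext a
    have := ef' (ap (inl A B) a)
    rw [ap_comp, ← ap_comp (inl A B), hA] at this
    exact inl_inj this
  have k₂ : nr Oa f₂ g₂ hg₂ = nr Oa f₂' g₂' hg₂' ≫ span Om (SpanCat.res Oa e₂.hom) := by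
    have hp : IsPullback eB.hom g₂ g₂' e₂.hom := by
      refine IsPullback.of_horiz_isIso ⟨hom_ext fun a => ?_⟩
      have := eg' (ap (inr A B) a)
      simp only [ap_comp, ap_desc_inr] at this
      rw [← ap_comp (inr A B), hB] at this
      exact this
    refine (Eq.symm ((nr_res hp).trans ?_))
    congr 1
    ext a
    have := ef' (ap (inr A B) a)
    rw [ap_comp, ← ap_comp (inr A B), hB] at this
    exact inr_inj this
  rw [k₁, k₂, Functor.map_comp_apply, Functor.map_comp_apply, ← β.map_toFun,
    ← Functor.map_comp_apply]
  congr 3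
  refine Eq.trans (SpanCat.res_ofSpan (prodMap e₂.hom e₂.hom)) ?_
  exact SpanCat.ofSpan_eq e₂ rfl eh

lemma exists_isValue {X Y Z : FinGSet G} (φ : mk Oa Om X ⊗ mk Oa Om Y ⟶ mk Oa Om Z)
    (x : R.obj (mk Oa Om X)) (y : S.obj (mk Oa Om Y)) : ∃ v, β.IsValue φ x y v := by
  obtain ⟨V, W, p, q, k, h⟩ := exists_factorization φ
  exact ⟨_, V, W, p, q, k, h, rfl⟩

end ExtPairing

end BiPoly
end

/-! ### The left Kan extension of `R X × S Y` along the product of a cartesian category. -/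

section

open MonoidalCategory CartesianMonoidalCategory

lemma preservesLimit_pair_of_bijective {C : Type*} [Category* C] {F : C ⥤ Type w} {X Y Z : C}
    {p : Z ⟶ X} {q : Z ⟶ Y} (h : IsLimit (BinaryFan.mk p q))
    (hF : ∀ x y, ∃! z, F.map p z = x ∧ F.map q z = y) : PreservesLimit (pair X Y) F := by
  refine preservesLimit_of_preserves_limit_cone h ((isLimitMapConeBinaryFanEquiv _ _ _).symm ?_)
  refine BinaryFan.IsLimit.mk _
    (fun f g => ↾fun t => (hF (f t) (g t)).choose) (fun f g => ?_) (fun f g => ?_)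
    fun f g m h₁ h₂ => ?_
  · ext t
    exact (hF (f t) (g t)).choose_spec.1.1
  · ext t
    exact (hF (f t) (g t)).choose_spec.1.2
  · ext t
    exact (hF (f t) (g t)).choose_spec.2 _
      ⟨ConcreteCategory.congr_hom h₁ t, ConcreteCategory.congr_hom h₂ t⟩

lemma preservesTerminal_of_unique {C : Type*} [Category* C] {F : C ⥤ Type w} {T : C}
    (h : IsTerminal T) (hF : Nonempty (Unique (F.obj T))) :
    PreservesLimitsOfShape (Discrete PEmpty.{1}) F := by
  have : PreservesLimit (Functor.empty.{0} C) F := by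
    refine preservesLimit_of_preserves_limit_cone h ?_
    exact (isLimitMapConeEmptyConeEquiv _ _).symm ((Types.isTerminalEquivUnique _).symm hF.some)
  exact preservesLimitsOfShape_pempty_of_preservesTerminal _

variable {C : Type*} [Category* C] [CartesianMonoidalCategory C]

lemma preservesFiniteProducts_of_existsUnique (F : C ⥤ Type w)
    (h₀ : Nonempty (Unique (F.obj (𝟙_ C))))
    (h : ∀ {X Y : C} (x : F.obj X) (y : F.obj Y), ∃! z, F.map (fst X Y) z = x ∧ F.map (snd X Y) z = y) :
    PreservesFiniteProducts F := by
  have : PreservesLimitsOfShape (Discrete WalkingPair) F :=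
    ⟨fun {K} => by
      have := preservesLimit_pair_of_bijective (F := F)
        (tensorProductIsBinaryProduct (K.obj ⟨.left⟩) (K.obj ⟨.right⟩)) h
      exact preservesLimit_of_iso_diagram _ (diagramIsoPair K).symm⟩
  have := preservesTerminal_of_unique isTerminalTensorUnit h₀
  exact PreservesFiniteProducts.of_preserves_binary_and_terminal _

section

variable (F : C ⥤ Type w) [PreservesFiniteProducts F]

/-- A product preserving functor sends the terminal object to a point. -/
noncomputable abbrev uniqueObjUnit : Unique (F.obj (𝟙_ C)) :=
  Types.isTerminalEquivUnique _ (isTerminalTensorUnit.isTerminalObj F)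

lemma existsUnique_prodPair {X Y : C} (x : F.obj X) (y : F.obj Y) :
    ∃! z : F.obj (X ⊗ Y), F.map (fst X Y) z = x ∧ F.map (snd X Y) z = y :=
  existsUnique_of_isLimit_binaryFan
    (mapIsLimitOfPreservesOfIsLimit F _ _ (tensorProductIsBinaryProduct X Y)) x y

/-- The element of `F (X ⊗ Y)` with given projections. -/
noncomputable def prodPair {X Y : C} (x : F.obj X) (y : F.obj Y) : F.obj (X ⊗ Y) :=
  (existsUnique_prodPair F x y).choose

@[simp] lemma map_fst_prodPair {X Y : C} (x : F.obj X) (y : F.obj Y) :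
    F.map (fst X Y) (prodPair F x y) = x := (existsUnique_prodPair F x y).choose_spec.1.1

@[simp] lemma map_snd_prodPair {X Y : C} (x : F.obj X) (y : F.obj Y) :
    F.map (snd X Y) (prodPair F x y) = y := (existsUnique_prodPair F x y).choose_spec.1.2

variable {F} in
lemma eq_prodPair {X Y : C} {z : F.obj (X ⊗ Y)} {x : F.obj X} {y : F.obj Y}
    (h₁ : F.map (fst X Y) z = x) (h₂ : F.map (snd X Y) z = y) : z = prodPair F x y :=
  (existsUnique_prodPair F x y).choose_spec.2 z ⟨h₁, h₂⟩

lemma map_tensorHom_prodPair {X X' Y Y' : C} (a : X ⟶ X') (b : Y ⟶ Y') (x : F.obj X)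
    (y : F.obj Y) : F.map (a ⊗ₘ b) (prodPair F x y) = prodPair F (F.map a x) (F.map b y) := by
  apply eq_prodPair
  · rw [← Functor.map_comp_apply, tensorHom_fst, Functor.map_comp_apply, map_fst_prodPair]
  · rw [← Functor.map_comp_apply, tensorHom_snd, Functor.map_comp_apply, map_snd_prodPair]

lemma map_lift_prodPair {W X Y : C} (a : W ⟶ X) (b : W ⟶ Y) (z : F.obj W) :
    F.map (lift a b) z = prodPair F (F.map a z) (F.map b z) := by
  apply eq_prodPair
  · rw [← Functor.map_comp_apply, lift_fst]
  · rw [← Functor.map_comp_apply, lift_snd]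

variable {F} in
lemma app_prodPair {F' : C ⥤ Type w} [PreservesFiniteProducts F'] (η : F ⟶ F') {X Y : C}
    (x : F.obj X) (y : F.obj Y) :
    η.app _ (prodPair F x y) = prodPair F' (η.app _ x) (η.app _ y) := by
  apply eq_prodPair
  · rw [← NatTrans.naturality_apply, map_fst_prodPair]
  · rw [← NatTrans.naturality_apply, map_snd_prodPair]

end

variable (R S : C ⥤ Type w)

/-- Representatives of the elements of the coproduct of `R` and `S` at `Z`. -/
structure JointElement (Z : C) where
  {X Y : C}
  hom : X ⊗ Y ⟶ Z
  left : R.obj X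
  right : S.obj Y

/-- The relation identifying representatives that differ by morphisms of `C`. -/
inductive JointRel (Z : C) : JointElement R S Z → JointElement R S Z → Prop
  | map {X X' Y Y' : C} (a : X ⟶ X') (b : Y ⟶ Y') (φ : X' ⊗ Y' ⟶ Z) (x : R.obj X) (y : S.obj Y) :
    JointRel Z ⟨(a ⊗ₘ b) ≫ φ, x, y⟩ ⟨φ, R.map a x, S.map b y⟩

/-- The left Kan extension of `(X, Y) ↦ R X × S Y` along the product of `C`, at `Z`. -/
abbrev JointQuot (Z : C) := Quot (JointRel R S Z)

/-- A representative can be moved along isomorphisms to objects of the family `o`, which leaves a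
`w`-small set of choices. -/
lemma small_jointQuot [LocallySmall.{w} C] {ι : Type w} (o : ι → C)
    (ho : ∀ X, ∃ i, Nonempty (X ≅ o i)) (Z : C) : Small.{w} (JointQuot R S Z) := by
  let f : (Σ i j : ι, (o i ⊗ o j ⟶ Z) × R.obj (o i) × S.obj (o j)) → JointQuot R S Z :=
    fun t => Quot.mk _ ⟨t.2.2.1, t.2.2.2.1, t.2.2.2.2⟩
  refine small_of_surjective (f := f) ?_
  rintro ⟨@⟨X, Y, φ, x, y⟩⟩
  obtain ⟨i, ⟨e⟩⟩ := ho X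
  obtain ⟨j, ⟨e'⟩⟩ := ho Y
  refine ⟨⟨i, j, (e.inv ⊗ₘ e'.inv) ≫ φ, R.map e.hom x, S.map e'.hom y⟩, ?_⟩
  refine (Quot.sound (JointRel.map e.inv e'.inv φ _ _)).trans ?_
  rw [← Functor.map_comp_apply, ← Functor.map_comp_apply, e.hom_inv_id, e'.hom_inv_id,
    Functor.map_id_apply, Functor.map_id_apply]

/-- The functoriality of `JointQuot`. -/
def JointQuot.map {Z Z' : C} (ψ : Z ⟶ Z') : JointQuot R S Z → JointQuot R S Z' :=
  Quot.map (fun t => ⟨t.hom ≫ ψ, t.left, t.right⟩) (by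
    rintro _ _ ⟨a, b, φ, x, y⟩
    simpa using JointRel.map a b (φ ≫ ψ) x y)

lemma JointQuot.map_id (Z : C) (z : JointQuot R S Z) : JointQuot.map R S (𝟙 Z) z = z := by
  obtain ⟨t⟩ := z
  simp [JointQuot.map, Quot.map]

lemma JointQuot.map_comp {Z Z' Z'' : C} (f : Z ⟶ Z') (g : Z' ⟶ Z'') (z : JointQuot R S Z) :
    JointQuot.map R S (f ≫ g) z = JointQuot.map R S g (JointQuot.map R S f z) := by
  obtain ⟨t⟩ := z
  simp [JointQuot.map, Quot.map]

variable [∀ Z, Small.{w} (JointQuot R S Z)]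

/-- The left Kan extension of `(X, Y) ↦ R X × S Y` along the product of `C`. -/
noncomputable def joint : C ⥤ Type w where
  obj Z := Shrink.{w} (JointQuot R S Z)
  map ψ := ↾fun z => equivShrink _ (JointQuot.map R S ψ ((equivShrink _).symm z))
  map_id Z := by
    ext z
    simp [JointQuot.map_id]
  map_comp f g := by
    ext z
    simp [JointQuot.map_comp]

namespace joint

variable {R S}

/-- The element of `joint R S` represented by `φ`, `x` and `y`. -/
noncomputable def mk {X Y Z : C} (φ : X ⊗ Y ⟶ Z) (x : R.obj X) (y : S.obj Y) : (joint R S).obj Z :=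
  equivShrink (JointQuot R S Z) (Quot.mk _ ⟨φ, x, y⟩)

lemma map_mk {X Y Z Z' : C} (φ : X ⊗ Y ⟶ Z) (x : R.obj X) (y : S.obj Y) (ψ : Z ⟶ Z') :
    (joint R S).map ψ (mk φ x y) = mk (φ ≫ ψ) x y := by
  change equivShrink _ (JointQuot.map R S ψ ((equivShrink (JointQuot R S Z)).symm
    (equivShrink (JointQuot R S Z) _))) = _
  rw [Equiv.symm_apply_apply]
  rfl

lemma mk_comp {X X' Y Y' Z : C} (a : X ⟶ X') (b : Y ⟶ Y') (φ : X' ⊗ Y' ⟶ Z) (x : R.obj X)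
    (y : S.obj Y) : mk ((a ⊗ₘ b) ≫ φ) x y = mk φ (R.map a x) (S.map b y) :=
  congrArg (equivShrink (JointQuot R S Z)) (Quot.sound (JointRel.map a b φ x y))

lemma exists_mk {Z : C} (z : (joint R S).obj Z) :
    ∃ (X Y : C) (φ : X ⊗ Y ⟶ Z) (x : R.obj X) (y : S.obj Y), z = mk φ x y := by
  obtain ⟨⟨t⟩, rfl⟩ := (equivShrink _).surjective z
  exact ⟨_, _, t.hom, t.left, t.right, rfl⟩

lemma exists_lift {Z : C} {T : Type*} (f : ∀ {X Y : C}, (X ⊗ Y ⟶ Z) → R.obj X → S.obj Y → T)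
    (hf : ∀ {X X' Y Y' : C} (a : X ⟶ X') (b : Y ⟶ Y') (φ : X' ⊗ Y' ⟶ Z) x y,
      f ((a ⊗ₘ b) ≫ φ) x y = f φ (R.map a x) (S.map b y)) :
    ∃ F : (joint R S).obj Z → T, ∀ {X Y : C} (φ : X ⊗ Y ⟶ Z) x y, F (mk φ x y) = f φ x y := by
  refine ⟨fun z => Quot.lift (fun t => f t.hom t.left t.right) ?_ ((equivShrink (JointQuot R S Z)).symm z), ?_⟩
  · rintro _ _ ⟨a, b, φ, x, y⟩
    exact hf a b φ x y
  · intro X Y φ x y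
    exact congrArg (Quot.lift _ _) ((equivShrink (JointQuot R S Z)).symm_apply_apply _)

variable [PreservesFiniteProducts R] [PreservesFiniteProducts S]

/-- The candidate inverse of `joint (Z ⊗ Z') → joint Z × joint Z'`. Both elements are represented on
`(X ⊗ X') ⊗ (Y ⊗ Y')` by pairs, which exist since `R` and `S` preserve products. -/
lemma exists_pairing (Z Z' : C) :
    ∃ F : (joint R S).obj Z → (joint R S).obj Z' → (joint R S).obj (Z ⊗ Z'),
      ∀ {X Y X' Y' : C} (φ : X ⊗ Y ⟶ Z) (φ' : X' ⊗ Y' ⟶ Z') x y x' y',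
        F (mk φ x y) (mk φ' x' y') =
          mk (lift ((fst X X' ⊗ₘ fst Y Y') ≫ φ) ((snd X X' ⊗ₘ snd Y Y') ≫ φ'))
            (prodPair R x x') (prodPair S y y') := by
  -- The second argument descends to the quotient for each fixed representative of the first; then
  -- the first argument descends.
  have h₁ : ∀ {X Y : C} (φ : X ⊗ Y ⟶ Z) (x : R.obj X) (y : S.obj Y),
      ∃ F : (joint R S).obj Z' → (joint R S).obj (Z ⊗ Z'),
      ∀ {X' Y' : C} (φ' : X' ⊗ Y' ⟶ Z') x' y', F (mk φ' x' y') =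
          mk (lift ((fst X X' ⊗ₘ fst Y Y') ≫ φ) ((snd X X' ⊗ₘ snd Y Y') ≫ φ'))
            (prodPair R x x') (prodPair S y y') := by
    intro X Y φ x y
    refine exists_lift (fun {X' Y'} φ' x' y' =>
      mk (lift ((fst X X' ⊗ₘ fst Y Y') ≫ φ) ((snd X X' ⊗ₘ snd Y Y') ≫ φ'))
            (prodPair R x x') (prodPair S y y')) fun {X' X'' Y' Y''} a b φ' x' y' => ?_
    have e := map_tensorHom_prodPair R (𝟙 X) a x x'
    have e' := map_tensorHom_prodPair S (𝟙 Y) b y y'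
    rw [Functor.map_id_apply] at e e'
    rw [← e, ← e', ← mk_comp]
    congr 1
    ext <;> simp
  choose f hf using @h₁
  obtain ⟨F, hF⟩ := exists_lift (R := R) (S := S) (Z := Z) (fun {X Y} φ x y => f φ x y)
    fun {X X' Y Y'} a b φ x y => by
      funext z
      obtain ⟨X₁, Y₁, φ', x', y', rfl⟩ := exists_mk z
      rw [hf, hf]
      have e := map_tensorHom_prodPair R a (𝟙 X₁) x x'
      have e' := map_tensorHom_prodPair S b (𝟙 Y₁) y y'
      rw [Functor.map_id_apply] at e e'
      rw [← e, ← e', ← mk_comp]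
      congr 1
      ext <;> simp
  exact ⟨F, fun φ φ' x y x' y' => by rw [hF, hf]⟩

instance : PreservesFiniteProducts (joint R S) := by
  refine preservesFiniteProducts_of_existsUnique _ ⟨⟨⟨mk (toUnit _) (uniqueObjUnit R).default
    (uniqueObjUnit S).default⟩, fun z => ?_⟩⟩ fun {Z Z'} z z' => ?_
  · obtain ⟨X, Y, φ, x, y, rfl⟩ := exists_mk z
    -- Over the terminal object every representative is equivalent to one on `𝟙_ C` and `𝟙_ C`,
    -- where `R` and `S` are points.
    have h : φ = (toUnit X ⊗ₘ toUnit Y) ≫ toUnit _ := toUnit_unique _ _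
    have := (uniqueObjUnit R).instSubsingleton
    have := (uniqueObjUnit S).instSubsingleton
    rw [h, mk_comp]
    congr 1 <;> exact Subsingleton.elim _ _
  · obtain ⟨F, hF⟩ := exists_pairing (R := R) (S := S) Z Z'
    refine ⟨F z z', ⟨?_, ?_⟩, ?_⟩
    · obtain ⟨X, Y, φ, x, y, rfl⟩ := exists_mk z
      obtain ⟨X', Y', φ', x', y', rfl⟩ := exists_mk z'
      rw [hF, map_mk, lift_fst, mk_comp, map_fst_prodPair, map_fst_prodPair]
    · obtain ⟨X, Y, φ, x, y, rfl⟩ := exists_mk z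
      obtain ⟨X', Y', φ', x', y', rfl⟩ := exists_mk z'
      rw [hF, map_mk, lift_snd, mk_comp, map_snd_prodPair, map_snd_prodPair]
    · rintro t ⟨rfl, rfl⟩
      obtain ⟨X, Y, φ, x, y, rfl⟩ := exists_mk t
      rw [map_mk, map_mk, hF]
      -- The pair `(x, x)` is the image of `x` under the diagonal, so the doubled representative is
      -- equivalent to the original one.
      have e := map_lift_prodPair R (𝟙 X) (𝟙 X) x
      have e' := map_lift_prodPair S (𝟙 Y) (𝟙 Y) y
      rw [Functor.map_id_apply] at e e'
      rw [← e, ← e', ← mk_comp]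
      congr 1
      ext <;> simp

variable (R S)

/-- The inclusion of the first summand. -/
noncomputable def inl : R ⟶ joint R S where
  app X := ↾fun x => mk (fst X (𝟙_ C)) x (uniqueObjUnit S).default
  naturality X X' a := by
    ext x
    change mk _ _ _ = (joint R S).map a (mk _ _ _)
    rw [map_mk, ← tensorHom_fst a (𝟙 _), mk_comp, Functor.map_id_apply]
    rfl

/-- The inclusion of the second summand. -/
noncomputable def inr : S ⟶ joint R S where
  app X := ↾fun y => mk (snd (𝟙_ C) X) (uniqueObjUnit R).default y
  naturality X X' a := by
    ext x
    change mk _ _ _ = (joint R S).map a (mk _ _ _)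
    rw [map_mk, ← tensorHom_snd (𝟙 _) a, mk_comp, Functor.map_id_apply]
    rfl

variable {R S}

/-- The images of `inl` and `inr` generate `joint R S`, so a natural transformation into a product
preserving functor is determined by its restrictions to `R` and `S`. -/
lemma mk_eq {X Y Z : C} (φ : X ⊗ Y ⟶ Z) (x : R.obj X) (y : S.obj Y) :
    mk φ x y = (joint R S).map φ (prodPair _ ((inl R S).app X x) ((inr R S).app Y y)) := by
  rw [← Category.id_comp φ, ← map_mk, Category.id_comp]
  congr 1
  apply eq_prodPair
  · rw [map_mk, Category.id_comp]
    have h : fst X Y = (𝟙 X ⊗ₘ toUnit Y) ≫ fst X (𝟙_ C) := by simp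
    have := (uniqueObjUnit S).instSubsingleton
    rw [h, mk_comp, Functor.map_id_apply, Subsingleton.elim (S.map (toUnit Y) y)]
    rfl
  · rw [map_mk, Category.id_comp]
    have h : snd X Y = (toUnit X ⊗ₘ 𝟙 Y) ≫ snd (𝟙_ C) Y := by simp
    have := (uniqueObjUnit R).instSubsingleton
    rw [h, mk_comp, Functor.map_id_apply, Subsingleton.elim (R.map (toUnit X) x)]
    rfl

end joint

end

/-! ### Smallness; addition and external product in a product preserving functor. -/

section
variable {G : Type u} [Group G]

namespace FinGSet

/-- A finite `G`-set is an action on some `Fin n`, and a finite group has finitely many of these for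
each `n`. So there are countably many representatives, and they shrink to any universe. -/
lemma exists_representatives (G : Type u) [Group G] [Finite G] :
    ∃ (ι : Type w) (o : ι → FinGSet G), ∀ X, ∃ i, Nonempty (X ≅ o i) := by
  have (n : ℕ) : Finite (MulAction G (Fin n)) :=
    Finite.of_injective (fun a : MulAction G (Fin n) => a.smul) fun a b h => by
      apply MulAction.ext
      exact h
  let o (t : Σ n : ℕ, MulAction G (Fin n)) : FinGSet G :=
    letI := t.2
    of (Fin t.1)
  refine ⟨Shrink.{w} (Σ n : ℕ, MulAction G (Fin n)), fun i => o ((equivShrink _).symm i),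
    fun X => ?_⟩
  obtain ⟨n, ⟨e⟩⟩ := Finite.exists_equiv_fin X.V
  let a : MulAction G (Fin n) := e.symm.mulAction G
  refine ⟨equivShrink _ ⟨n, a⟩, ?_⟩
  change Nonempty (X ≅ o _)
  rw [Equiv.symm_apply_apply]
  have h : ∀ (g : G) x, e (g • x) = g • e x := fun g x =>
    congrArg (fun y => e (g • y)) (e.symm_apply_apply x).symm
  exact ⟨mkIso (Y := of (Fin n)) (mkHom (Y := of (Fin n)) e h) e.symm e.symm_apply_apply e.apply_symm_apply⟩

end FinGSet

namespace BiPoly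

open MonoidalCategory CartesianMonoidalCategory

variable {Oa Om : MorphismProperty (FinGSet G)} [IsIndexingCategory Oa] [IsIndexingCategory Om]
    [Compatible Oa Om]

instance [Finite G] : LocallySmall.{w} (BiPoly Oa Om) where
  hom_small X Y := by
    obtain ⟨ι, o, ho⟩ := exists_representatives.{u, w} G
    let f : (Σ i j : ι, (o i ⟶ X.obj.obj) × (o i ⟶ o j) × (o j ⟶ Y.obj.obj)) → (X.obj ⟶ Y.obj) :=
      fun t => PolyCat.ofBispan ⟨o t.1, o t.2.1, t.2.2.1, t.2.2.2.1, t.2.2.2.2⟩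
    have : Small.{w} (X.obj ⟶ Y.obj) := by
      refine small_of_surjective (f := f) ?_
      rintro ⟨P⟩
      obtain ⟨i, ⟨e⟩⟩ := ho P.U₁
      obtain ⟨j, ⟨e'⟩⟩ := ho P.U₂
      refine ⟨⟨i, j, e.inv ≫ P.f, e.inv ≫ P.g ≫ e'.hom, e'.inv ≫ P.h⟩, Quotient.sound ?_⟩
      exact ⟨e.symm, e'.symm, rfl, by simp, rfl⟩
    exact small_of_injective (f := fun φ : X ⟶ Y => φ.hom) fun _ _ => WideSubcategory.hom_ext _

lemma nonempty_iso {X Y : FinGSet G} (e : X ≅ Y) : Nonempty (mk Oa Om X ≅ mk Oa Om Y) := by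
  have h : ∀ {X Y Z : FinGSet G} (f : X ⟶ Y) (g : Y ⟶ Z),
      res Oa Om g ≫ res Oa Om f = res Oa Om (f ≫ g) := fun f g =>
    hom_ext_of_isIso (Bispan.res_comp _ _)
  refine ⟨⟨res Oa Om e.inv, res Oa Om e.hom, ?_, ?_⟩⟩
  · rw [h, e.hom_inv_id]
    rfl
  · rw [h, e.inv_hom_id]
    rfl

instance [Finite G] (R S : BiPoly Oa Om ⥤ Type w) (Z : BiPoly Oa Om) :
    Small.{w} (JointQuot R S Z) := by
  obtain ⟨ι, o, ho⟩ := exists_representatives.{u, w} G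
  refine small_jointQuot R S (fun i => mk Oa Om (o i)) (fun X => ?_) Z
  obtain ⟨i, ⟨e⟩⟩ := ho X.obj.obj
  exact ⟨i, nonempty_iso e⟩

section

variable (F : BiPoly Oa Om ⥤ Type w) [PreservesFiniteProducts F]

/-- The addition on `F X`. -/
noncomputable def add {X : FinGSet G} (x y : F.obj (mk Oa Om X)) : F.obj (mk Oa Om X) :=
  SpanCat.add (SpanCat.toBiPoly Oa Om ⋙ F) x y

/-- The zero of `F X`. -/
noncomputable def zero (X : FinGSet G) : F.obj (mk Oa Om X) :=
  SpanCat.zero (SpanCat.toBiPoly Oa Om ⋙ F) X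

/-- Identifies the pairs used to define the addition with those of the cartesian structure on
`BiPoly`. -/
lemma pair_eq {X Y : FinGSet G} (x : F.obj (mk Oa Om X)) (y : F.obj (mk Oa Om Y)) :
    SpanCat.pair (SpanCat.toBiPoly Oa Om ⋙ F) x y = prodPair F x y :=
  eq_prodPair (X := mk Oa Om X) (Y := mk Oa Om Y) (SpanCat.pair_inl (SpanCat.toBiPoly Oa Om ⋙ F) x y)
    (SpanCat.pair_inr (SpanCat.toBiPoly Oa Om ⋙ F) x y)

lemma add_eq {X : FinGSet G} (x y : F.obj (mk Oa Om X)) :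
    add F x y = F.map (tr Om (fold X) (IsIndexingCategory.fold_mem Oa X) : mk Oa Om X ⊗ mk Oa Om X ⟶ _)
      (prodPair F x y) :=
  congrArg (F.map (tr Om (fold X) (IsIndexingCategory.fold_mem Oa X))) (pair_eq F x y)

lemma zero_eq {X : FinGSet G} (z : F.obj (mk Oa Om (empty G))) :
    zero F X = F.map (tr Om (fromEmpty X) (IsIndexingCategory.fromEmpty_mem X)) z :=
  congrArg (F.map (tr Om (fromEmpty X) (IsIndexingCategory.fromEmpty_mem X)))
    ((SpanCat.uniqueEmpty (SpanCat.toBiPoly Oa Om ⋙ F)).uniq z).symm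

lemma map_span_add {X Y : FinGSet G} (t : (⟨X⟩ : SpanCat Oa) ⟶ ⟨Y⟩) (x y : F.obj (mk Oa Om X)) :
    F.map (span Om t) (add F x y) = add F (F.map (span Om t) x) (F.map (span Om t) y) :=
  SpanCat.map_add (SpanCat.toBiPoly Oa Om ⋙ F) t x y

lemma map_span_zero {X Y : FinGSet G} (t : (⟨X⟩ : SpanCat Oa) ⟶ ⟨Y⟩) :
    F.map (span Om t) (zero F X) = zero F Y :=
  SpanCat.map_zero (SpanCat.toBiPoly Oa Om ⋙ F) t

variable {F} in
lemma app_add {F' : BiPoly Oa Om ⥤ Type w} [PreservesFiniteProducts F'] (η : F ⟶ F')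
    {X : FinGSet G} (x y : F.obj (mk Oa Om X)) :
    η.app _ (add F x y) = add F' (η.app _ x) (η.app _ y) := by
  rw [add_eq, add_eq]
  exact (NatTrans.naturality_apply η _ _).trans (congrArg (F'.map _) (app_prodPair η x y))

variable {F} in
lemma app_zero {F' : BiPoly Oa Om ⥤ Type w} [PreservesFiniteProducts F'] (η : F ⟶ F')
    {X : FinGSet G} : η.app _ (zero F X) = zero F' X := by
  rw [zero_eq F (uniqueObjUnit F).default, NatTrans.naturality_apply, ← zero_eq]

/-- The external product of `x` and `y`. -/
noncomputable def ext {X Y : FinGSet G} (x : F.obj (mk Oa Om X)) (y : F.obj (mk Oa Om Y)) :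
    F.obj (mk Oa Om (FinGSet.prod X Y)) := F.map (extMul Oa Om X Y) (prodPair F x y)

lemma map_prodHom_ext {X X' Y Y' : FinGSet G} (t : (⟨X⟩ : SpanCat Oa) ⟶ ⟨X'⟩)
    (s : (⟨Y⟩ : SpanCat Oa) ⟶ ⟨Y'⟩) (x : F.obj (mk Oa Om X)) (y : F.obj (mk Oa Om Y)) :
    F.map (span Om (SpanCat.prodHom t s)) (ext F x y) =
      ext F (F.map (span Om t) x) (F.map (span Om s) y) := by
  rw [ext, ext, ← map_tensorHom_prodPair, ← Functor.map_comp_apply, ← Functor.map_comp_apply,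
    extMul_naturality]

end

end BiPoly
end

/-! ### Biadditivity of the external product. -/

section
variable {G : Type u} [Group G]

namespace SpanCat

variable {O : MorphismProperty (FinGSet G)} [IsIndexingCategory O]

lemma subsingleton_obj (M : SpanCat O ⥤ Type w) [PreservesFiniteProducts M] (X : FinGSet G)
    [IsEmpty X.V] : Subsingleton (M.obj ⟨X⟩) := by
  let e : X ≅ empty G := mkIso (mkHom (fun x => isEmptyElim x) fun _ x => isEmptyElim x)
    (fun x => isEmptyElim x) (fun x => isEmptyElim x) fun x => isEmptyElim x
  have h : res O e.inv ≫ res O e.hom = 𝟙 _ := by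
    change res O e.inv ≫ ofSpan e.hom (𝟙 X) (O.id_mem X) = _
    rw [res_ofSpan, e.hom_inv_id]
    rfl
  have := (uniqueEmpty M).instSubsingleton
  constructor
  intro x y
  rw [← Functor.map_id_apply M _ x, ← Functor.map_id_apply M _ y, ← h, Functor.map_comp_apply,
    Functor.map_comp_apply, Subsingleton.elim (M.map (res O e.inv) x) (M.map (res O e.inv) y)]

/-- The bijection `X × Y ⨿ X × Y ≅ (X ⨿ X) × Y` carries the fold map of `X × Y` to the fold map of
`X` times `Y`. -/
lemma prodHom_tr_fold_left (X Y : FinGSet G) :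
    prodHom (tr (fold X) (IsIndexingCategory.fold_mem O X)) (𝟙 (⟨Y⟩ : SpanCat O)) =
      res O (desc (prodMap (inl X X) (𝟙 Y)) (prodMap (inr X X) (𝟙 Y))) ≫
        tr (fold _) (IsIndexingCategory.fold_mem O _) := by
  rw [← ofSpan_eq_res_tr]
  have h : IsIso (desc (prodMap (inl X X) (𝟙 Y)) (prodMap (inr X X) (𝟙 Y))) := by
    apply isIso_of_bijective
    refine Bispan.desc_bijective _ _ ?_ ?_ ?_ ?_
    · rintro ⟨x, y⟩ ⟨x', y'⟩ h
      exact Prod.ext (inl_inj (congrArg Prod.fst h)) (congrArg (ap (FinGSet.snd _ _)) h)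
    · rintro ⟨x, y⟩ ⟨x', y'⟩ h
      exact Prod.ext (inr_inj (congrArg Prod.fst h)) (congrArg (ap (FinGSet.snd _ _)) h)
    · rintro ⟨x, y⟩ ⟨x', y'⟩ h
      exact inl_ne_inr (congrArg Prod.fst h)
    · rintro ⟨z, y⟩
      rcases sum_cases z with ⟨x, rfl⟩ | ⟨x, rfl⟩
      · exact Or.inl ⟨(x, y), rfl⟩
      · exact Or.inr ⟨(x, y), rfl⟩
  refine (ofSpan_eq (asIso (desc (prodMap (inl X X) (𝟙 Y)) (prodMap (inr X X) (𝟙 Y)))) ?_ ?_).symm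
  · exact Category.comp_id _
  · exact sum_hom_ext rfl rfl

lemma prodHom_tr_fold_right (X Y : FinGSet G) :
    prodHom (𝟙 (⟨X⟩ : SpanCat O)) (tr (fold Y) (IsIndexingCategory.fold_mem O Y)) =
      res O (desc (prodMap (𝟙 X) (inl Y Y)) (prodMap (𝟙 X) (inr Y Y))) ≫
        tr (fold _) (IsIndexingCategory.fold_mem O _) := by
  rw [← ofSpan_eq_res_tr]
  have h : IsIso (desc (prodMap (𝟙 X) (inl Y Y)) (prodMap (𝟙 X) (inr Y Y))) := by
    apply isIso_of_bijective
    refine Bispan.desc_bijective _ _ ?_ ?_ ?_ ?_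
    · rintro ⟨x, y⟩ ⟨x', y'⟩ h
      exact Prod.ext (congrArg (ap (FinGSet.fst _ _)) h) (inl_inj (congrArg Prod.snd h))
    · rintro ⟨x, y⟩ ⟨x', y'⟩ h
      exact Prod.ext (congrArg (ap (FinGSet.fst _ _)) h) (inr_inj (congrArg Prod.snd h))
    · rintro ⟨x, y⟩ ⟨x', y'⟩ h
      exact inl_ne_inr (congrArg Prod.snd h)
    · rintro ⟨y, z⟩
      rcases sum_cases z with ⟨x, rfl⟩ | ⟨x, rfl⟩
      · exact Or.inl ⟨(y, x), rfl⟩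
      · exact Or.inr ⟨(y, x), rfl⟩
  refine (ofSpan_eq (asIso (desc (prodMap (𝟙 X) (inl Y Y)) (prodMap (𝟙 X) (inr Y Y)))) ?_ ?_).symm
  · exact Category.comp_id _
  · exact sum_hom_ext rfl rfl

end SpanCat

namespace BiPoly

open MonoidalCategory CartesianMonoidalCategory

variable {Oa Om : MorphismProperty (FinGSet G)} [IsIndexingCategory Oa] [IsIndexingCategory Om]
    [Compatible Oa Om]

section

variable (F : BiPoly Oa Om ⥤ Type w) [PreservesFiniteProducts F]

lemma map_res_ext {X X' Y Y' : FinGSet G} (f : X ⟶ X') (g : Y ⟶ Y') (x : F.obj (mk Oa Om X'))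
    (y : F.obj (mk Oa Om Y')) :
    F.map (res Oa Om (prodMap f g)) (ext F x y) =
      ext F (F.map (res Oa Om f) x) (F.map (res Oa Om g) y) :=
  map_prodHom_ext F (SpanCat.res Oa f) (SpanCat.res Oa g) x y

lemma span_id (X : FinGSet G) : span Om (𝟙 (⟨X⟩ : SpanCat Oa)) = 𝟙 (mk Oa Om X) := rfl

lemma eq_sumPair {X Y : FinGSet G} {z : F.obj (mk Oa Om (sum X Y))} {x : F.obj (mk Oa Om X)}
    {y : F.obj (mk Oa Om Y)} (h₁ : F.map (res Oa Om (inl X Y)) z = x)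
    (h₂ : F.map (res Oa Om (inr X Y)) z = y) : z = prodPair F x y :=
  eq_prodPair (X := mk Oa Om X) (Y := mk Oa Om Y) h₁ h₂

omit [PreservesFiniteProducts F] in
lemma map_res_res {X Y Z : FinGSet G} (f : X ⟶ Y) (g : Y ⟶ Z) (z : F.obj (mk Oa Om Z)) :
    F.map (res Oa Om f) (F.map (res Oa Om g) z) = F.map (res Oa Om (f ≫ g)) z := by
  have h : res Oa Om g ≫ res Oa Om f = res Oa Om (f ≫ g) :=
    hom_ext_of_isIso (Bispan.res_comp _ _)
  rw [← h, Functor.map_comp_apply]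

/-- The sum is the transfer of the pair `(x, x')` along the fold map. Naturality of `ext` and
distributivity turn this into a transfer along the fold map of `X × Y`; restricting to each copy
identifies the pair being transferred. -/
lemma ext_add_left {X Y : FinGSet G} (x x' : F.obj (mk Oa Om X)) (y : F.obj (mk Oa Om Y)) :
    ext F (add F x x') y = add F (ext F x y) (ext F x' y) := by
  have h := map_prodHom_ext F (SpanCat.tr (fold X) (IsIndexingCategory.fold_mem Oa X)) (𝟙 (⟨Y⟩ : SpanCat Oa))
    (prodPair F x x') y
  rw [SpanCat.prodHom_tr_fold_left, span_comp, Functor.map_comp_apply, span_id,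
    Functor.map_id_apply] at h
  rw [add_eq, add_eq]
  refine h.symm.trans (congrArg (F.map (tr Om _ _)) (eq_sumPair F ?_ ?_))
  · rw [span_res]
    refine (map_res_res F _ _ _).trans ((map_res_ext F (inl X X) (𝟙 Y) _ _).trans ?_)
    exact congrArg₂ (ext F) (map_fst_prodPair F x x') (Functor.map_id_apply F _ _)
  · rw [span_res]
    refine (map_res_res F _ _ _).trans ((map_res_ext F (inr X X) (𝟙 Y) _ _).trans ?_)
    exact congrArg₂ (ext F) (map_snd_prodPair F x x') (Functor.map_id_apply F _ _)

lemma ext_add_right {X Y : FinGSet G} (x : F.obj (mk Oa Om X)) (y y' : F.obj (mk Oa Om Y)) :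
    ext F x (add F y y') = add F (ext F x y) (ext F x y') := by
  have h := map_prodHom_ext F (𝟙 (⟨X⟩ : SpanCat Oa)) (SpanCat.tr (fold Y) (IsIndexingCategory.fold_mem Oa Y))
    x (prodPair F y y')
  rw [SpanCat.prodHom_tr_fold_right, span_comp, Functor.map_comp_apply, span_id,
    Functor.map_id_apply] at h
  rw [add_eq, add_eq]
  refine h.symm.trans (congrArg (F.map (tr Om _ _)) (eq_sumPair F ?_ ?_))
  · rw [span_res]
    refine (map_res_res F _ _ _).trans ((map_res_ext F (𝟙 X) (inl Y Y) _ _).trans ?_)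
    exact congrArg₂ (ext F) (Functor.map_id_apply F _ _) (map_fst_prodPair F y y')
  · rw [span_res]
    refine (map_res_res F _ _ _).trans ((map_res_ext F (𝟙 X) (inr Y Y) _ _).trans ?_)
    exact congrArg₂ (ext F) (Functor.map_id_apply F _ _) (map_snd_prodPair F y y')

/-- Zero is transferred from `∅`, and `∅ × Y` is empty, so `F` has only one element there. -/
lemma zero_ext {X Y : FinGSet G} (y : F.obj (mk Oa Om Y)) :
    ext F (zero F X) y = zero F (FinGSet.prod X Y) := by
  have h := map_prodHom_ext F (SpanCat.tr (fromEmpty X) (IsIndexingCategory.fromEmpty_mem X))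
    (𝟙 (⟨Y⟩ : SpanCat Oa)) (uniqueObjUnit F).default y
  have : IsEmpty (FinGSet.prod (empty G) Y).V := ⟨fun z => isEmptyElim z.1⟩
  have := SpanCat.subsingleton_obj (SpanCat.toBiPoly Oa Om ⋙ F) (FinGSet.prod (empty G) Y)
  rw [Subsingleton.elim (α := (SpanCat.toBiPoly Oa Om ⋙ F).obj ⟨FinGSet.prod (empty G) Y⟩)
    (ext F (uniqueObjUnit F).default y) (zero F (FinGSet.prod (empty G) Y))] at h
  rw [zero_eq F (uniqueObjUnit F).default]
  refine Eq.trans ?_ (h.symm.trans (map_span_zero F _))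
  exact congrArg (ext F _) (Functor.map_id_apply F _ _).symm

/-- Restriction along the two projections followed by the norm along the fold map is the polynomial
defining the external multiplication. -/
lemma nm_fold_prodPair {X Y : FinGSet G} (x : F.obj (mk Oa Om X)) (y : F.obj (mk Oa Om Y)) :
    F.map (nm Oa (fold _) (IsIndexingCategory.fold_mem Om _))
      (prodPair F (F.map (res Oa Om (FinGSet.fst X Y)) x) (F.map (res Oa Om (FinGSet.snd X Y)) y)) =
      ext F x y := by
  have h : res Oa Om (sumMap (FinGSet.fst X Y) (FinGSet.snd X Y)) ≫
      nm Oa (fold _) (IsIndexingCategory.fold_mem Om _) = extMul Oa Om X Y :=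
    hom_ext_of_isIso ((Bispan.res_comp _ _).trans (Bispan.IsIso.refl _))
  rw [ext, ← map_tensorHom_prodPair, res_sum]
  exact (Functor.map_comp_apply F _ _ _).symm.trans
    (congrArg (fun ψ => F.map ψ (prodPair F x y)) h)

end

end BiPoly
end

/-! ### Coproducts of Tambara functors as Kan extensions. -/

section

open MonoidalCategory CartesianMonoidalCategory

variable {C : Type*} [Category* C] [CartesianMonoidalCategory C] {R S T : C ⥤ Type w}
  [PreservesFiniteProducts R] [PreservesFiniteProducts S] [PreservesFiniteProducts T]
  [∀ Z, Small.{w} (JointQuot R S Z)]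

/-- The formula is forced by `joint.mk_eq`; it respects the relation because `T` preserves products
and `i`, `j` are natural. -/
lemma joint.exists_desc (i : R ⟶ T) (j : S ⟶ T) :
    ∃ e : joint R S ⟶ T, inl R S ≫ e = i ∧ inr R S ≫ e = j ∧
      ∀ {X Y Z : C} (φ : X ⊗ Y ⟶ Z) (x : R.obj X) (y : S.obj Y),
        e.app Z (mk φ x y) = T.map φ (prodPair T (i.app X x) (j.app Y y)) := by
  have h : ∀ Z, ∃ e : (joint R S).obj Z → T.obj Z, ∀ {X Y : C} (φ : X ⊗ Y ⟶ Z) (x : R.obj X)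
      (y : S.obj Y), e (mk φ x y) = T.map φ (prodPair T (i.app X x) (j.app Y y)) := fun Z =>
    joint.exists_lift (fun φ x y => T.map φ (prodPair T (i.app _ x) (j.app _ y)))
      fun a b φ x y => by
        rw [Functor.map_comp_apply, map_tensorHom_prodPair, NatTrans.naturality_apply,
          NatTrans.naturality_apply]
  choose e he using h
  refine ⟨{ app := fun Z => ↾e Z, naturality := fun Z Z' ψ => ?_ }, ?_, ?_, he _⟩
  · ext z
    obtain ⟨X, Y, φ, x, y, rfl⟩ := joint.exists_mk z
    change e Z' ((joint R S).map ψ _) = T.map ψ (e Z _)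
    rw [joint.map_mk, he, he, Functor.map_comp_apply]
  · ext Z x
    exact (he _ _ _ _).trans (map_fst_prodPair T _ _)
  · ext Z x
    exact (he _ _ _ _).trans (map_snd_prodPair T _ _)

end

section
variable {G : Type u} [Group G]

namespace BiPoly

open MonoidalCategory CartesianMonoidalCategory

variable {Oa Om : MorphismProperty (FinGSet G)} [IsIndexingCategory Oa] [IsIndexingCategory Om]
    [Compatible Oa Om]

/-- The factorization of `φ` lets `R` and `S` absorb `p` and `q`, so only the external product and a
span act in `J`. -/
lemma exists_map_prodPair_eq {R S J : BiPoly Oa Om ⥤ Type w} [PreservesFiniteProducts J]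
    (i : R ⟶ J) (j : S ⟶ J) {X Y Z : FinGSet G} (φ : mk Oa Om X ⊗ mk Oa Om Y ⟶ mk Oa Om Z)
    (x : R.obj (mk Oa Om X)) (y : S.obj (mk Oa Om Y)) :
    ∃ (V W : FinGSet G) (u : R.obj (mk Oa Om V)) (v : S.obj (mk Oa Om W))
      (k : (⟨FinGSet.prod V W⟩ : SpanCat Oa) ⟶ ⟨Z⟩),
      J.map φ (prodPair J (i.app _ x) (j.app _ y)) =
        J.map (span Om k) (ext J (i.app _ u) (j.app _ v)) := by
  obtain ⟨V, W, p, q, k, rfl⟩ := exists_factorization φ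
  refine ⟨V, W, R.map p x, S.map q y, k, ?_⟩
  rw [Functor.map_comp_apply, Functor.map_comp_apply, map_tensorHom_prodPair,
    NatTrans.naturality_apply, NatTrans.naturality_apply]
  rfl

/-- Every element is `k (u ⊠ v)` for a span `k`. Spans are additive and `⊠` is additive in `u`, so
`k (-u ⊠ v)` is a negative and no group completion is needed. -/
instance isTambara_joint [Finite G] (R S : BiPoly Oa Om ⥤ Type w) [IsTambara Oa Om R]
    [IsTambara Oa Om S] : IsTambara Oa Om (joint R S) where
  toPreservesFiniteProducts := inferInstance
  exists_neg X z := by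
    obtain ⟨A, B, φ, x, y, rfl⟩ := joint.exists_mk z
    rw [joint.mk_eq]
    obtain ⟨V, W, u, v, k, h⟩ := exists_map_prodPair_eq (X := A.obj.obj) (Y := B.obj.obj)
      (joint.inl R S) (joint.inr R S) φ x y
    obtain ⟨u', hu⟩ := IsTambara.exists_neg V u
    refine ⟨(joint R S).map (span Om k) (ext (joint R S) ((joint.inl R S).app _ u')
      ((joint.inr R S).app _ v)), ?_⟩
    refine (congrArg (fun t => add (joint R S) t _) h).trans ?_
    rw [← map_span_add, ← ext_add_left]
    refine Eq.trans ?_ (map_span_zero (joint R S) k)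
    refine congrArg _ (Eq.trans ?_ (zero_ext (joint R S) ((joint.inr R S).app _ v)))
    refine congrArg (fun t => ext (joint R S) t _) ?_
    exact (app_add (joint.inl R S) u u').symm.trans ((congrArg _ hu).trans (app_zero (joint.inl R S)))

end BiPoly

namespace TambaraFunctor

open MonoidalCategory CartesianMonoidalCategory BiPoly

variable {Oa Om : MorphismProperty (FinGSet G)} [IsIndexingCategory Oa] [IsIndexingCategory Om]
    [Compatible Oa Om] [Finite G] {R S Q : TambaraFunctor.{u, w} Oa Om} {i : R ⟶ Q} {j : S ⟶ Q}
    (hQ : IsColimit (BinaryCofan.mk i j))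

include hQ

lemma exists_desc_joint : ∃ d : Q.obj ⟶ joint R.obj S.obj, i.hom ≫ d = joint.inl R.obj S.obj ∧
    j.hom ≫ d = joint.inr R.obj S.obj := by
  let B : TambaraFunctor.{u, w} Oa Om := ⟨joint R.obj S.obj, isTambara_joint R.obj S.obj⟩
  let l : R ⟶ B := ⟨joint.inl R.obj S.obj⟩
  let r : S ⟶ B := ⟨joint.inr R.obj S.obj⟩
  obtain ⟨d, h₁, h₂⟩ := BinaryCofan.IsColimit.desc' hQ l r
  exact ⟨d.hom, congrArg (fun t => t.hom) h₁, congrArg (fun t => t.hom) h₂⟩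

lemma exists_lift_of_isColimit {Z : BiPoly Oa Om} {T : Type*}
    (f : ∀ {X Y : BiPoly Oa Om}, (X ⊗ Y ⟶ Z) → R.obj.obj X → S.obj.obj Y → T)
    (hf : ∀ {X X' Y Y' : BiPoly Oa Om} (a : X ⟶ X') (b : Y ⟶ Y') (φ : X' ⊗ Y' ⟶ Z) x y,
      f ((a ⊗ₘ b) ≫ φ) x y = f φ (R.obj.map a x) (S.obj.map b y)) :
    ∃ F : Q.obj.obj Z → T, ∀ {X Y : BiPoly Oa Om} (φ : X ⊗ Y ⟶ Z) x y,
      F (Q.obj.map φ (prodPair Q.obj (i.hom.app X x) (j.hom.app Y y))) = f φ x y := by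
  obtain ⟨d, h₁, h₂⟩ := exists_desc_joint hQ
  obtain ⟨F, hF⟩ := joint.exists_lift f hf
  refine ⟨fun q => F (d.app Z q), fun φ x y => ?_⟩
  rw [← hF, joint.mk_eq, ← h₁, ← h₂]
  exact congrArg F ((NatTrans.naturality_apply d φ _).trans
    (congrArg _ (app_prodPair d _ _)))

/-- The universal property of `Q` makes the composite `Q ⟶ joint R S ⟶ Q` the identity. This
retraction suffices to carry generation by representatives over to `Q`. -/
lemma exists_map_prodPair_of_isColimit {Z : BiPoly Oa Om} (q : Q.obj.obj Z) :
    ∃ (X Y : BiPoly Oa Om) (φ : X ⊗ Y ⟶ Z) (x : R.obj.obj X) (y : S.obj.obj Y),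
      q = Q.obj.map φ (prodPair Q.obj (i.hom.app X x) (j.hom.app Y y)) := by
  obtain ⟨d, h₁, h₂⟩ := exists_desc_joint hQ
  obtain ⟨e, he₁, he₂, he⟩ := joint.exists_desc i.hom j.hom
  have h : d ≫ e = 𝟙 Q.obj := by
    let e' : Q ⟶ Q := ⟨d ≫ e⟩
    have h₃ : e' = 𝟙 Q := by
      apply BinaryCofan.IsColimit.hom_ext hQ
      · apply ObjectProperty.hom_ext
        change i.hom ≫ d ≫ e = i.hom ≫ 𝟙 _
        rw [reassoc_of% h₁, he₁, Category.comp_id]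
      · apply ObjectProperty.hom_ext
        change j.hom ≫ d ≫ e = j.hom ≫ 𝟙 _
        rw [reassoc_of% h₂, he₂, Category.comp_id]
    exact congrArg (fun t => t.hom) h₃
  have hq : q = e.app Z (d.app Z q) := by
    have h' := ConcreteCategory.congr_hom (NatTrans.congr_app h.symm Z) q
    exact h'
  obtain ⟨X, Y, φ, x, y, hz⟩ := joint.exists_mk (d.app Z q)
  exact ⟨X, Y, φ, x, y, by rw [← he, ← hz, ← hq]⟩

end TambaraFunctor
end

/-! ### External tensor products of Mackey functors and sums of pure elements. -/

section
variable {G : Type u} [Group G]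

namespace MackeyFunctor

open SpanCat hiding map_add map_zero add_zero zero_add

variable {O : MorphismProperty (FinGSet G)} [IsIndexingCategory O] (M N : MackeyFunctor.{u, w} O)

lemma tensor_induction {Z : SpanCat O × SpanCat O} {p : (tensor M N).obj Z → Prop} (h₀ : p 0)
    (h : ∀ x y, p (tmul M N (X := Z.1.obj) (Y := Z.2.obj) x y)) (ha : ∀ x y, p x → p y → p (x + y))
    (z : (tensor M N).obj Z) : p z :=
  TensorProduct.induction_on (R := ℤ) (M := (toAb M).obj Z.1) (N := (toAb N).obj Z.2) z h₀ h ha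

variable {M N} in
lemma tensor_hom_ext {F : SpanCat O × SpanCat O ⥤ AddCommGrpCat.{w}} {α β : tensor M N ⟶ F}
    (h : ∀ (X Y : FinGSet G) x y, α.app (⟨X⟩, ⟨Y⟩) (tmul M N x y) = β.app (⟨X⟩, ⟨Y⟩) (tmul M N x y)) :
    α = β := by
  ext Z z
  refine tensor_induction M N (p := fun z => α.app Z z = β.app Z z) ?_ (h _ _) ?_ z
  · rw [map_zero, map_zero]
  · intro x y hx hy
    rw [map_add, map_add, hx, hy]

lemma add_tmul {X Y : FinGSet G} (x x' : M.obj.obj ⟨X⟩) (y : N.obj.obj ⟨Y⟩) :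
    tmul M N (add M.obj x x') y = tmul M N x y + tmul M N x' y :=
  TensorProduct.add_tmul (R := ℤ) (M := (toAb M).obj ⟨X⟩) (N := (toAb N).obj ⟨Y⟩) x x' y

lemma tmul_add {X Y : FinGSet G} (x : M.obj.obj ⟨X⟩) (y y' : N.obj.obj ⟨Y⟩) :
    tmul M N x (add N.obj y y') = tmul M N x y + tmul M N x y' :=
  TensorProduct.tmul_add (R := ℤ) (M := (toAb M).obj ⟨X⟩) (N := (toAb N).obj ⟨Y⟩) x y y'

lemma zero_tmul {X Y : FinGSet G} (y : N.obj.obj ⟨Y⟩) :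
    tmul M N (zero M.obj X) y = 0 :=
  TensorProduct.zero_tmul (R := ℤ) (N := (toAb N).obj ⟨Y⟩) ((toAb M).obj ⟨X⟩) y

lemma exists_hom_of_biadditive {H : SpanCat O ⥤ AddCommGrpCat.{w}}
    (b : ∀ {X Y : FinGSet G}, M.obj.obj ⟨X⟩ → N.obj.obj ⟨Y⟩ → H.obj ⟨FinGSet.prod X Y⟩)
    (h₁ : ∀ {X Y : FinGSet G} (x x' : M.obj.obj ⟨X⟩) (y : N.obj.obj ⟨Y⟩),
      b (add M.obj x x') y = b x y + b x' y)
    (h₂ : ∀ {X Y : FinGSet G} (x : M.obj.obj ⟨X⟩) (y y' : N.obj.obj ⟨Y⟩),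
      b x (add N.obj y y') = b x y + b x y')
    (h : ∀ {X X' Y Y' : FinGSet G} (t : (⟨X⟩ : SpanCat O) ⟶ ⟨X'⟩) (s : (⟨Y⟩ : SpanCat O) ⟶ ⟨Y'⟩)
      (x : M.obj.obj ⟨X⟩) (y : N.obj.obj ⟨Y⟩),
      H.map (prodHom t s) (b x y) = b (M.obj.map t x) (N.obj.map s y)) :
    ∃ α : tensor M N ⟶ prodFunctor O ⋙ H, ∀ (X Y : FinGSet G) (x : M.obj.obj ⟨X⟩)
      (y : N.obj.obj ⟨Y⟩), α.app (⟨X⟩, ⟨Y⟩) (tmul M N x y) = b x y := by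
  let B (Z : SpanCat O × SpanCat O) :
      (toAb M).obj Z.1 →+ (toAb N).obj Z.2 →+ H.obj ((prodFunctor O).obj Z) :=
    AddMonoidHom.mk' (fun x => AddMonoidHom.mk' (fun y => b (X := Z.1.obj) (Y := Z.2.obj) x y)
      (h₂ (X := Z.1.obj) (Y := Z.2.obj) x))
      fun x x' => AddMonoidHom.ext (h₁ (X := Z.1.obj) (Y := Z.2.obj) x x')
  let α (Z : SpanCat O × SpanCat O) : (tensor M N).obj Z ⟶ H.obj ((prodFunctor O).obj Z) :=
    AddCommGrpCat.ofHom (TensorProduct.liftAddHom (R := ℤ) (B Z) fun r m n => by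
      rw [map_zsmul, map_zsmul]
      rfl)
  have hα (Z : SpanCat O × SpanCat O) (x : M.obj.obj Z.1) (y : N.obj.obj Z.2) :
    α Z (tmul M N (X := Z.1.obj) (Y := Z.2.obj) x y) = b (X := Z.1.obj) (Y := Z.2.obj) x y := rfl
  refine ⟨{ app := α, naturality := fun Z Z' f => ?_ }, fun X Y x y => hα (⟨X⟩, ⟨Y⟩) x y⟩
  ext z
  refine tensor_induction M N (p := fun z => (((tensor M N).map f ≫ α Z') z) =
    ((α Z ≫ H.map ((prodFunctor O).map f)) z)) ?_ (fun x y => ?_) ?_ z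
  · rw [map_zero, map_zero]
  · exact ((h f.1 f.2 x y)).symm
  · intro x y hx hy
    rw [map_add, map_add, hx, hy]

variable {M N}

/-- The value on a pure tensor of a natural transformation out of the external tensor product. -/
noncomputable def pairing {H : SpanCat O ⥤ AddCommGrpCat.{w}} (β : tensor M N ⟶ prodFunctor O ⋙ H)
    {X Y : FinGSet G} (x : M.obj.obj ⟨X⟩) (y : N.obj.obj ⟨Y⟩) : H.obj ⟨FinGSet.prod X Y⟩ :=
  β.app (⟨X⟩, ⟨Y⟩) (tmul M N x y)

section

variable {H : SpanCat O ⥤ AddCommGrpCat.{w}} (β : tensor M N ⟶ prodFunctor O ⋙ H)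

lemma map_pairing {X X' Y Y' : FinGSet G} (t : (⟨X⟩ : SpanCat O) ⟶ ⟨X'⟩)
    (s : (⟨Y⟩ : SpanCat O) ⟶ ⟨Y'⟩) (x : M.obj.obj ⟨X⟩) (y : N.obj.obj ⟨Y⟩) :
    H.map (prodHom t s) (pairing β x y) = pairing β (M.obj.map t x) (N.obj.map s y) :=
  (ConcreteCategory.congr_hom (β.naturality (X := (⟨X⟩, ⟨Y⟩)) (Y := (⟨X'⟩, ⟨Y'⟩)) (t, s))
    (tmul M N x y)).symm

lemma pairing_add_left {X Y : FinGSet G} (x x' : M.obj.obj ⟨X⟩) (y : N.obj.obj ⟨Y⟩) :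
    pairing β (add M.obj x x') y = pairing β x y + pairing β x' y :=
  (congrArg (β.app (⟨X⟩, ⟨Y⟩)) (add_tmul M N x x' y)).trans (map_add (β.app (⟨X⟩, ⟨Y⟩)).hom _ _)

lemma pairing_add_right {X Y : FinGSet G} (x : M.obj.obj ⟨X⟩) (y y' : N.obj.obj ⟨Y⟩) :
    pairing β x (add N.obj y y') = pairing β x y + pairing β x y' :=
  (congrArg (β.app (⟨X⟩, ⟨Y⟩)) (tmul_add M N x y y')).trans (map_add (β.app (⟨X⟩, ⟨Y⟩)).hom _ _)

lemma pairing_zero_left {X Y : FinGSet G} (y : N.obj.obj ⟨Y⟩) :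
    pairing β (zero M.obj X) y = 0 :=
  (congrArg (β.app (⟨X⟩, ⟨Y⟩)) (zero_tmul M N y)).trans (map_zero (β.app (⟨X⟩, ⟨Y⟩)).hom)

/-- The span first restricts both arguments to the empty set `E`, where `M` has only its zero. -/
lemma map_ofSpan_pairing_of_isEmpty {X Y Z E : FinGSet G} [IsEmpty E.V] (l : E ⟶ FinGSet.prod X Y)
    (r : E ⟶ Z) (hr : O r) (x : M.obj.obj ⟨X⟩) (y : N.obj.obj ⟨Y⟩) :
    H.map (ofSpan l r hr) (pairing β x y) = 0 := by
  have h : ofSpan l r hr = prodHom (res O (l ≫ FinGSet.fst X Y)) (res O (l ≫ FinGSet.snd X Y)) ≫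
      ofSpan (prodLift (𝟙 E) (𝟙 E)) r hr := by
    symm
    exact res_ofSpan (prodMap (l ≫ FinGSet.fst X Y) (l ≫ FinGSet.snd X Y))
  have := subsingleton_obj M.obj E
  rw [h, Functor.map_comp_apply, map_pairing, Subsingleton.elim (M.obj.map _ x) (zero M.obj E),
    pairing_zero_left, map_zero]

end

/-- Extend `x` and `x'` by zero to `X ⨿ X'` and add them, and likewise `y` and `y'`. The product of
the two sums has four terms on the four blocks of `(X ⨿ X') × (Y ⨿ Y')`; the span `k''` acts as `k`
and `k'` on the two diagonal blocks and kills the others. The data do not depend on `H` or `β`, so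
sums for two different pairings can be compared. -/
lemma exists_add_pairing {X Y X' Y' Z : FinGSet G} (k : (⟨FinGSet.prod X Y⟩ : SpanCat O) ⟶ ⟨Z⟩)
    (k' : (⟨FinGSet.prod X' Y'⟩ : SpanCat O) ⟶ ⟨Z⟩) (x : M.obj.obj ⟨X⟩) (y : N.obj.obj ⟨Y⟩)
    (x' : M.obj.obj ⟨X'⟩) (y' : N.obj.obj ⟨Y'⟩) :
    ∃ (V W : FinGSet G) (k'' : (⟨FinGSet.prod V W⟩ : SpanCat O) ⟶ ⟨Z⟩) (u : M.obj.obj ⟨V⟩)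
      (v : N.obj.obj ⟨W⟩), ∀ {H : SpanCat O ⥤ AddCommGrpCat.{w}}
        (β : tensor M N ⟶ prodFunctor O ⋙ H),
        H.map k (pairing β x y) + H.map k' (pairing β x' y') = H.map k'' (pairing β u v) := by
  obtain ⟨A, l, r, hr, rfl⟩ := exists_ofSpan k
  obtain ⟨B, l', r', hr', rfl⟩ := exists_ofSpan k'
  let iX : (⟨X⟩ : SpanCat O) ⟶ ⟨sum X X'⟩ := tr (inl X X') (IsIndexingCategory.inl_mem _ _)
  let jX : (⟨X'⟩ : SpanCat O) ⟶ ⟨sum X X'⟩ := tr (inr X X') (IsIndexingCategory.inr_mem _ _)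
  let iY : (⟨Y⟩ : SpanCat O) ⟶ ⟨sum Y Y'⟩ := tr (inl Y Y') (IsIndexingCategory.inl_mem _ _)
  let jY : (⟨Y'⟩ : SpanCat O) ⟶ ⟨sum Y Y'⟩ := tr (inr Y Y') (IsIndexingCategory.inr_mem _ _)
  -- The left leg meets only the blocks `X × Y` and `X' × Y'`.
  let l'' := desc (l ≫ prodMap (inl X X') (inl Y Y')) (l' ≫ prodMap (inr X X') (inr Y Y'))
  let k'' := ofSpan l'' (desc r r') (IsIndexingCategory.desc_mem r r' hr hr')
  have h₁ : prodHom iX iY ≫ k'' = ofSpan l r hr := by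
    refine (tr_ofSpan (p := l) (q := inl A B) ?_).trans (ofSpan_eq (Iso.refl _) rfl rfl)
    refine isPullback_of (fun _ => rfl) (fun _ _ _ h => inl_inj h) ?_
    rintro ⟨a, b⟩ z h
    rcases sum_cases z with ⟨z, rfl⟩ | ⟨z, rfl⟩
    · exact ⟨z, Prod.ext (inl_inj (congrArg Prod.fst h)).symm (inl_inj (congrArg Prod.snd h)).symm, rfl⟩
    · exact (inl_ne_inr (congrArg Prod.fst h)).elim
  have h₂ : prodHom jX jY ≫ k'' = ofSpan l' r' hr' := by
    refine (tr_ofSpan (p := l') (q := inr A B) ?_).trans (ofSpan_eq (Iso.refl _) rfl rfl)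
    refine isPullback_of (fun _ => rfl) (fun _ _ _ h => inr_inj h) ?_
    rintro ⟨a, b⟩ z h
    rcases sum_cases z with ⟨z, rfl⟩ | ⟨z, rfl⟩
    · exact (inl_ne_inr (congrArg Prod.fst h).symm).elim
    · exact ⟨z, Prod.ext (inr_inj (congrArg Prod.fst h)).symm (inr_inj (congrArg Prod.snd h)).symm, rfl⟩
  -- On an off-diagonal block the pullback is empty, so the cross term vanishes.
  have h₃ : prodHom iX jY ≫ k'' = ofSpan (fromEmpty _) (fromEmpty _)
      (IsIndexingCategory.fromEmpty_mem Z) := by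
    refine (tr_ofSpan (p := fromEmpty _) (q := fromEmpty _) ?_).trans
      (ofSpan_eq (Iso.refl _) rfl (hom_ext fun z => isEmptyElim z))
    refine isPullback_of (fun z => isEmptyElim z) (fun z => isEmptyElim z) ?_
    rintro ⟨a, b⟩ z h
    rcases sum_cases z with ⟨z, rfl⟩ | ⟨z, rfl⟩
    · exact (inl_ne_inr (congrArg Prod.snd h).symm).elim
    · exact (inl_ne_inr (congrArg Prod.fst h)).elim
  have h₄ : prodHom jX iY ≫ k'' = ofSpan (fromEmpty _) (fromEmpty _)
      (IsIndexingCategory.fromEmpty_mem Z) := by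
    refine (tr_ofSpan (p := fromEmpty _) (q := fromEmpty _) ?_).trans
      (ofSpan_eq (Iso.refl _) rfl (hom_ext fun z => isEmptyElim z))
    refine isPullback_of (fun z => isEmptyElim z) (fun z => isEmptyElim z) ?_
    rintro ⟨a, b⟩ z h
    rcases sum_cases z with ⟨z, rfl⟩ | ⟨z, rfl⟩
    · exact (inl_ne_inr (congrArg Prod.fst h).symm).elim
    · exact (inl_ne_inr (congrArg Prod.snd h)).elim
  refine ⟨_, _, k'', add M.obj (M.obj.map iX x) (M.obj.map jX x'),
    add N.obj (N.obj.map iY y) (N.obj.map jY y'), fun {H} β => ?_⟩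
  rw [pairing_add_left, pairing_add_right, pairing_add_right, ← map_pairing, ← map_pairing,
    ← map_pairing, ← map_pairing, map_add, map_add, map_add, ← Functor.map_comp_apply,
    ← Functor.map_comp_apply, ← Functor.map_comp_apply, ← Functor.map_comp_apply, h₁, h₂, h₃, h₄,
    map_ofSpan_pairing_of_isEmpty β (fromEmpty (FinGSet.prod X Y')),
    map_ofSpan_pairing_of_isEmpty β (fromEmpty (FinGSet.prod X' Y)), add_zero, zero_add]

end MackeyFunctor
end

/-! ### The coproduct as a box product. -/

section
variable {G : Type u} [Group G]

namespace TambaraFunctor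

open MonoidalCategory CartesianMonoidalCategory BiPoly

variable {Oa Om : MorphismProperty (FinGSet G)} [IsIndexingCategory Oa] [IsIndexingCategory Om]
    [Compatible Oa Om] {R S Q : TambaraFunctor.{u, w} Oa Om}

lemma exists_span_ext_of_isColimit [Finite G] {i : R ⟶ Q} {j : S ⟶ Q}
    (hQ : IsColimit (BinaryCofan.mk i j)) {Z : FinGSet G} (q : Q.obj.obj (mk Oa Om Z)) :
    ∃ (V W : FinGSet G) (u : R.obj.obj (mk Oa Om V)) (v : S.obj.obj (mk Oa Om W))
      (k : (⟨FinGSet.prod V W⟩ : SpanCat Oa) ⟶ ⟨Z⟩),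
      q = Q.obj.map (span Om k) (ext Q.obj (i.hom.app _ u) (j.hom.app _ v)) := by
  obtain ⟨X, Y, φ, x, y, rfl⟩ := exists_map_prodPair_of_isColimit hQ q
  exact exists_map_prodPair_eq (X := X.obj.obj) (Y := Y.obj.obj) i.hom j.hom φ x y

/-- A triple `(φ, x, y)` is sent to the value of the pairing on it, which `IsValue.unique` makes
independent of the factorization. Biadditivity of the pairing is not needed at this stage. -/
lemma exists_lift_of_extPairing [Finite G] {i : R ⟶ Q} {j : S ⟶ Q}
    (hQ : IsColimit (BinaryCofan.mk i j)) {H : SpanCat Oa ⥤ Type w} (E : ExtPairing R.obj S.obj H)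
    (Z : FinGSet G) :
    ∃ F : Q.obj.obj (mk Oa Om Z) → H.obj ⟨Z⟩, ∀ (V W : FinGSet G) (u : R.obj.obj (mk Oa Om V))
      (v : S.obj.obj (mk Oa Om W)) (k : (⟨FinGSet.prod V W⟩ : SpanCat Oa) ⟶ ⟨Z⟩),
      F (Q.obj.map (span Om k) (ext Q.obj (i.hom.app _ u) (j.hom.app _ v))) =
        H.map k (E.toFun u v) := by
  have hE {X Y : BiPoly Oa Om} (φ : X ⊗ Y ⟶ mk Oa Om Z) (x : R.obj.obj X) (y : S.obj.obj Y) :=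
    (E.exists_isValue (X := X.obj.obj) (Y := Y.obj.obj) φ x y).choose_spec
  obtain ⟨F, hF⟩ := exists_lift_of_isColimit hQ (fun {X Y} φ x y =>
    (E.exists_isValue (X := X.obj.obj) (Y := Y.obj.obj) φ x y).choose) fun a b φ x y => by
      refine (hE ((a ⊗ₘ b) ≫ φ) x y).unique ?_
      obtain ⟨V, W, p, q, k, h, h'⟩ := hE φ (R.obj.map a x) (S.obj.map b y)
      -- A factorization of `φ` precomposed with `a` and `b` is a factorization of `(a ⊗ₘ b) ≫ φ`
      -- with the same value, so the function respects the Kan extension relation.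
      refine ⟨V, W, a ≫ p, b ≫ q, k, ?_, ?_⟩
      · rw [← tensorHom_comp_tensorHom, Category.assoc, ← h]
      · rw [Functor.map_comp_apply, Functor.map_comp_apply]
        exact h'
  refine ⟨F, fun V W u v k => ?_⟩
  have h := hF (X := mk Oa Om V) (Y := mk Oa Om W) (extMul Oa Om V W ≫ span Om k) u v
  rw [Functor.map_comp_apply] at h
  refine h.trans ((hE (X := mk Oa Om V) (Y := mk Oa Om W) _ u v).unique ⟨V, W, 𝟙 _, 𝟙 _, k, ?_, ?_⟩)
  · rw [id_tensorHom_id, Category.id_comp]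
  · rw [Functor.map_id_apply, Functor.map_id_apply]

lemma exists_tensor_hom (i : R ⟶ Q) (j : S ⟶ Q) :
    ∃ α : MackeyFunctor.tensor (underlying R) (underlying S) ⟶
        SpanCat.prodFunctor Oa ⋙ MackeyFunctor.toAb (underlying Q),
      ∀ (X Y : FinGSet G) (x : R.obj.obj (mk Oa Om X)) (y : S.obj.obj (mk Oa Om Y)),
        MackeyFunctor.pairing α x y = ext Q.obj (i.hom.app _ x) (j.hom.app _ y) := by
  refine MackeyFunctor.exists_hom_of_biadditive (underlying R) (underlying S)
    (H := MackeyFunctor.toAb (underlying Q))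
    (fun x y => ext Q.obj (i.hom.app _ x) (j.hom.app _ y)) (fun {X Y} x x' y => ?_)
    (fun {X Y} x y y' => ?_) (fun {X X' Y Y'} t s x y => ?_)
  · exact (congrArg (fun t => ext Q.obj t _) (app_add i.hom x x')).trans (ext_add_left Q.obj _ _ _)
  · exact (congrArg (ext Q.obj _) (app_add j.hom y y')).trans (ext_add_right Q.obj _ _ _)
  · refine (map_prodHom_ext Q.obj t s _ _).trans (congrArg₂ (ext Q.obj) ?_ ?_)
    · exact (NatTrans.naturality_apply i.hom (span Om t) x).symm
    · exact (NatTrans.naturality_apply j.hom (span Om s) y).symm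

variable [Finite G] {i : R ⟶ Q} {j : S ⟶ Q} (hQ : IsColimit (BinaryCofan.mk i j))
  {α : MackeyFunctor.tensor (underlying R) (underlying S) ⟶
    SpanCat.prodFunctor Oa ⋙ MackeyFunctor.toAb (underlying Q)}
  (hα : ∀ (X Y : FinGSet G) (x : R.obj.obj (mk Oa Om X)) (y : S.obj.obj (mk Oa Om Y)),
    MackeyFunctor.pairing α x y = ext Q.obj (i.hom.app _ x) (j.hom.app _ y))

include hQ hα

lemma exists_map_pairing (Z : SpanCat Oa) (q : (MackeyFunctor.toAb (underlying Q)).obj Z) :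
    ∃ (V W : FinGSet G) (k : (⟨FinGSet.prod V W⟩ : SpanCat Oa) ⟶ Z)
      (u : R.obj.obj (mk Oa Om V)) (v : S.obj.obj (mk Oa Om W)),
      q = (MackeyFunctor.toAb (underlying Q)).map k (MackeyFunctor.pairing α u v) := by
  obtain ⟨V, W, u, v, k, h⟩ := exists_span_ext_of_isColimit hQ (Z := Z.obj) q
  exact ⟨V, W, k, u, v, h.trans (congrArg (Q.obj.map (span Om k)) (hα V W u v).symm)⟩

/-- The map is first built on sets by `k (u ⊠ v) ↦ k (β (u, v))`. As every element of `Q Z` has this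
form, additivity and naturality are checked on such elements. -/
lemma exists_desc_of_pairing {H : SpanCat Oa ⥤ AddCommGrpCat.{w}}
    (β : MackeyFunctor.tensor (underlying R) (underlying S) ⟶ SpanCat.prodFunctor Oa ⋙ H) :
    ∃ γ : MackeyFunctor.toAb (underlying Q) ⟶ H,
      α ≫ Functor.whiskerLeft (SpanCat.prodFunctor Oa) γ = β := by
  let E : ExtPairing R.obj S.obj (H ⋙ forget AddCommGrpCat) :=
    .ofFun (fun x y => MackeyFunctor.pairing β x y) (MackeyFunctor.map_pairing β)
  choose F hF using exists_lift_of_extPairing hQ E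
  have hF' {Z : SpanCat Oa} {V W : FinGSet G} (k : (⟨FinGSet.prod V W⟩ : SpanCat Oa) ⟶ Z)
      (u : R.obj.obj (mk Oa Om V)) (v : S.obj.obj (mk Oa Om W)) :
      F Z.obj ((MackeyFunctor.toAb (underlying Q)).map k (MackeyFunctor.pairing α u v)) =
        H.map k (MackeyFunctor.pairing β u v) :=
    (congrArg (fun t => F Z.obj (Q.obj.map (span Om k) t)) (hα V W u v)).trans
      (hF Z.obj V W u v k)
  have hadd (Z : SpanCat Oa) (q q' : (MackeyFunctor.toAb (underlying Q)).obj Z) :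
      F Z.obj (q + q') = (F Z.obj q + F Z.obj q' : H.obj Z) := by
    obtain ⟨V, W, k, u, v, rfl⟩ := exists_map_pairing hQ hα Z q
    obtain ⟨V', W', k', u', v', rfl⟩ := exists_map_pairing hQ hα Z q'
    -- One triple `k''`, `u''`, `v''` represents the sum for `α` and for `β` simultaneously.
    obtain ⟨V'', W'', k'', u'', v'', h⟩ := MackeyFunctor.exists_add_pairing
      (M := underlying R) (N := underlying S) k k' u v u' v'
    refine (congrArg (F Z.obj) (h α)).trans ((hF' k'' u'' v'').trans ((h β).symm.trans ?_))
    exact (congrArg₂ (fun a b : H.obj Z => a + b) (hF' k u v) (hF' k' u' v')).symm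
  let f (Z : SpanCat Oa) : (MackeyFunctor.toAb (underlying Q)).obj Z →+ H.obj Z :=
    { toFun := F Z.obj
      map_zero' := by
        have h := hadd Z 0 0
        rwa [add_zero, left_eq_add] at h
      map_add' := hadd Z }
  let g (Z : SpanCat Oa) : (MackeyFunctor.toAb (underlying Q)).obj Z ⟶ H.obj Z :=
    ConcreteCategory.ofHom (C := AddCommGrpCat.{w}) (f Z)
  refine ⟨{ app := g
            naturality := fun Z Z' t => ?_ }, MackeyFunctor.tensor_hom_ext fun X Y x y => ?_⟩
  · ext q
    obtain ⟨V, W, k, u, v, rfl⟩ := exists_map_pairing hQ hα Z q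
    refine (congrArg (F Z'.obj) (Functor.map_comp_apply (MackeyFunctor.toAb (underlying Q)) k t
      (MackeyFunctor.pairing α u v)).symm).trans
      ((hF' (k ≫ t) u v).trans ?_)
    rw [Functor.map_comp_apply]
    exact congrArg (H.map t) (hF' k u v).symm
  · have h := hF' (Z := ⟨FinGSet.prod X Y⟩) (𝟙 _) x y
    rw [Functor.map_id_apply, Functor.map_id_apply] at h
    exact h

/-- Existence is `exists_desc_of_pairing`. Uniqueness holds because `Q Z` consists of elements `k (u
⊠ v)`, on which a morphism of extensions is determined by naturality and its effect on pure tensors.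
-/
lemma isBoxProduct_of_isColimit :
    MackeyFunctor.IsBoxProduct (underlying R) (underlying S) (underlying Q) α := by
  choose d hd using fun {H : SpanCat Oa ⥤ AddCommGrpCat.{w}} => exists_desc_of_pairing hQ hα (H := H)
  refine ⟨⟨IsInitial.ofUniqueHom (fun Y => StructuredArrow.homMk (d Y.hom) (hd Y.hom))
    fun Y m => ?_⟩⟩
  ext Z q
  obtain ⟨V, W, k, u, v, rfl⟩ := exists_map_pairing hQ hα Z q
  have h (m' : Functor.LeftExtension.mk (MackeyFunctor.toAb (underlying Q)) α ⟶ Y) :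
      m'.right.app Z ((MackeyFunctor.toAb (underlying Q)).map k (MackeyFunctor.pairing α u v)) =
        Y.right.map k (MackeyFunctor.pairing Y.hom u v) := by
    refine (NatTrans.naturality_apply m'.right k (MackeyFunctor.pairing α u v)).trans ?_
    have := ConcreteCategory.congr_hom (NatTrans.congr_app (StructuredArrow.w m') (⟨V⟩, ⟨W⟩))
      (MackeyFunctor.tmul (underlying R) (underlying S) u v)
    exact congrArg (Y.right.map k) this
  exact (h m).trans (h _).symm

end TambaraFunctor
end

/-! ### The external product in terms of multiplication and restriction. -/

section
variable {G : Type u} [Group G]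

namespace TambaraFunctor

open BiPoly

variable {Oa Om : MorphismProperty (FinGSet G)} [IsIndexingCategory Oa] [IsIndexingCategory Om]
    [Compatible Oa Om]

lemma mul_res_fst_res_snd (Q : TambaraFunctor.{u, w} Oa Om) {X Y : FinGSet G}
    (x : Q.obj.obj (mk Oa Om X)) (y : Q.obj.obj (mk Oa Om Y)) :
    mul Q (res Q (FinGSet.fst X Y) x) (res Q (FinGSet.snd X Y) y) = ext Q.obj x y :=
  (congrArg (Q.obj.map (nm Oa (fold _) (IsIndexingCategory.fold_mem Om _))) (pair_eq Q.obj _ _)).trans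
    (nm_fold_prodPair Q.obj x y)

end TambaraFunctor
end

/-! ### Corepresentable functors, presentability and local objects. -/

section

open Opposite

variable {C : Type*} [Category* C]

/-- A natural transformation is determined by its components on representatives of the isomorphism
classes, so `C` itself need not be small. -/
lemma locallySmall_functor_of_representatives {ι : Type w} (o : ι → C)
    (ho : ∀ X, ∃ i, Nonempty (X ≅ o i)) : LocallySmall.{w} (C ⥤ Type w) where
  hom_small F F' := by
    refine small_of_injective (β := ∀ i, F.obj (o i) → F'.obj (o i))
      (f := fun η i x => η.app (o i) x) fun η η' h => ?_
    ext X x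
    obtain ⟨i, ⟨e⟩⟩ := ho X
    have h' : η.app (o i) (F.map e.hom x) = η'.app (o i) (F.map e.hom x) :=
      congrFun (congrFun h i) _
    rw [NatTrans.naturality_apply, NatTrans.naturality_apply] at h'
    have h'' := congrArg (F'.map e.inv) h'
    simp only [← Functor.map_comp_apply, e.hom_inv_id, Functor.map_id_apply] at h''
    exact h''

/-- By Yoneda, maps out of the corepresentable functor are evaluation at `X`, which preserves
colimits; `uliftFunctor` only adjusts universes. -/
lemma isCardinalPresentable_shrinkCoyoneda [LocallySmall.{w} C] (κ : Cardinal.{w})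
    [Fact κ.IsRegular] (X : C) :
    IsCardinalPresentable (shrinkCoyoneda.{w}.obj (op X)) κ where
  preservesColimitOfShape J _ _ := by
    let e : coyoneda.obj (op (shrinkCoyoneda.{w}.obj (op X))) ≅
        (evaluation C (Type w)).obj X ⋙ uliftFunctor :=
      NatIso.ofComponents (fun P => (shrinkCoyonedaEquiv.trans Equiv.ulift.symm).toIso)
        fun {P P'} f => by
          ext g
          exact congrArg ULift.up (shrinkCoyonedaEquiv_comp g f)
    exact preservesColimitsOfShape_of_natIso e.symm

lemma isCardinalPresentable_coprod [LocallySmall.{w} C] {X Y : C} [HasBinaryCoproduct X Y]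
    (κ : Cardinal.{w}) [Fact κ.IsRegular] [IsCardinalPresentable X κ] [IsCardinalPresentable Y κ] :
    IsCardinalPresentable (X ⨿ Y) κ := by
  have (k : Discrete WalkingPair) : IsCardinalPresentable ((pair X Y).obj k) κ := by
    rcases k with ⟨_ | _⟩
    · assumption
    · assumption
  exact isCardinalPresentable_of_isColimit _ (colimit.isColimit (pair X Y)) κ
    (hasCardinalLT_of_finite _ κ (Cardinal.IsRegular.aleph0_le Fact.out))

lemma isCardinalPresentable_initial [LocallySmall.{w} C] [HasInitial C]
    (κ : Cardinal.{w}) [Fact κ.IsRegular] : IsCardinalPresentable (⊥_ C) κ := by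
  have (k : Discrete PEmpty.{1}) : IsCardinalPresentable ((Functor.empty.{0} C).obj k) κ :=
    k.as.elim
  exact isCardinalPresentable_of_isColimit _ (colimit.isColimit (Functor.empty.{0} C)) κ
    (hasCardinalLT_of_finite _ κ (Cardinal.IsRegular.aleph0_le Fact.out))

/-- The objects orthogonal to a small set of maps between presentable objects form a reflective
subcategory, whose colimits are reflections of those in `C`. -/
lemma hasColimits_isLocal_ofHoms [LocallySmall.{w} C] [HasColimitsOfSize.{w, w} C]
    (κ : Cardinal.{w}) [Fact κ.IsRegular] {ι : Type w} (f : ι → Arrow C)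
    (hf : ∀ i, IsCardinalPresentable (f i).left κ ∧ IsCardinalPresentable (f i).right κ) :
    HasColimitsOfSize.{w, w} (MorphismProperty.ofHoms fun i => (f i).hom).isLocal.FullSubcategory := by
  have := MorphismProperty.isRightAdjoint_ι_isLocal (MorphismProperty.ofHoms fun i => (f i).hom) κ
    (by
      rintro _ _ _ ⟨i⟩
      exact hf i)
  have : Reflective (MorphismProperty.ofHoms fun i => (f i).hom).isLocal.ι :=
    { L := Functor.leftAdjoint _, adj := Adjunction.ofIsRightAdjoint _ }
  exact hasColimits_of_reflective (MorphismProperty.ofHoms fun i => (f i).hom).isLocal.ι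

lemma isLocal_ofHoms_iff {ι : Type*} (f : ι → Arrow C) (Z : C) :
    (MorphismProperty.ofHoms fun i => (f i).hom).isLocal Z ↔
      ∀ i, Function.Bijective fun g : (f i).right ⟶ Z => (f i).hom ≫ g := by
  refine ⟨fun h i => h _ ⟨i⟩, ?_⟩
  rintro h _ _ _ ⟨i⟩
  exact h i

variable [LocallySmall.{w} C] (F : C ⥤ Type w)

lemma bijective_shrinkCoyoneda_map_comp_iff {X Y : C} (f : X ⟶ Y) :
    (Function.Bijective fun g : shrinkCoyoneda.{w}.obj (op X) ⟶ F => shrinkCoyoneda.{w}.map f.op ≫ g) ↔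
      Function.Bijective (F.map f) := by
  have h : (fun g : shrinkCoyoneda.{w}.obj (op X) ⟶ F => shrinkCoyoneda.{w}.map f.op ≫ g) =
      shrinkCoyonedaEquiv.symm ∘ F.map f ∘ shrinkCoyonedaEquiv := by
    funext g
    rw [Function.comp_apply, Equiv.eq_symm_apply]
    exact (shrinkCoyonedaEquiv_naturality g f.op).symm
  rw [h, Equiv.comp_bijective, Equiv.bijective_comp]

/-- By Yoneda, a map from the coproduct of the corepresentables of `X` and `Y` to `F` is a pair in
`F X × F Y`, and precomposition becomes `z ↦ (F p z, F q z)`. -/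
lemma bijective_coprodDesc_comp_iff {X Y Z : C} (p : Z ⟶ X) (q : Z ⟶ Y) :
    (Function.Bijective fun g : shrinkCoyoneda.{w}.obj (op Z) ⟶ F =>
      coprod.desc (shrinkCoyoneda.{w}.map p.op) (shrinkCoyoneda.{w}.map q.op) ≫ g) ↔
      ∀ (x : F.obj X) (y : F.obj Y), ∃! z, F.map p z = x ∧ F.map q z = y := by
  have h (g : shrinkCoyoneda.{w}.obj (op Z) ⟶ F)
      (k : shrinkCoyoneda.{w}.obj (op X) ⨿ shrinkCoyoneda.{w}.obj (op Y) ⟶ F) :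
      coprod.desc (shrinkCoyoneda.{w}.map p.op) (shrinkCoyoneda.{w}.map q.op) ≫ g = k ↔
        F.map p (shrinkCoyonedaEquiv g) = shrinkCoyonedaEquiv (coprod.inl ≫ k) ∧
        F.map q (shrinkCoyonedaEquiv g) = shrinkCoyonedaEquiv (coprod.inr ≫ k) := by
    have h₁ := shrinkCoyonedaEquiv_naturality g p.op
    have h₂ := shrinkCoyonedaEquiv_naturality g q.op
    rw [Quiver.Hom.unop_op] at h₁ h₂
    rw [h₁, h₂, shrinkCoyonedaEquiv.apply_eq_iff_eq, shrinkCoyonedaEquiv.apply_eq_iff_eq]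
    have e₁ := coprod.inl_desc_assoc (shrinkCoyoneda.{w}.map p.op) (shrinkCoyoneda.{w}.map q.op) g
    have e₂ := coprod.inr_desc_assoc (shrinkCoyoneda.{w}.map p.op) (shrinkCoyoneda.{w}.map q.op) g
    constructor
    · rintro rfl
      exact ⟨e₁.symm, e₂.symm⟩
    · rintro ⟨h₁, h₂⟩
      exact coprod.hom_ext (e₁.trans h₁) (e₂.trans h₂)
  rw [Function.bijective_iff_existsUnique]
  simp only [h]
  constructor
  · intro H x y
    obtain ⟨g, hg, hg'⟩ := H (coprod.desc (shrinkCoyonedaEquiv.symm x) (shrinkCoyonedaEquiv.symm y))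
    simp only [coprod.inl_desc, coprod.inr_desc, Equiv.apply_symm_apply] at hg hg'
    refine ⟨_, hg, fun z hz => ?_⟩
    rw [← hg' (shrinkCoyonedaEquiv.symm z) (by simpa using hz), Equiv.apply_symm_apply]
  · intro H k
    obtain ⟨z, hz, hz'⟩ := H (shrinkCoyonedaEquiv (coprod.inl ≫ k)) (shrinkCoyonedaEquiv (coprod.inr ≫ k))
    refine ⟨shrinkCoyonedaEquiv.symm z, by simpa using hz, fun g hg => ?_⟩
    rw [← hz' _ hg, Equiv.symm_apply_apply]

lemma bijective_initial_to_comp_iff (X : C) :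
    (Function.Bijective fun g : shrinkCoyoneda.{w}.obj (op X) ⟶ F => initial.to _ ≫ g) ↔
      Nonempty (Unique (F.obj X)) := by
  constructor
  · intro h
    obtain ⟨g, -⟩ := h.2 (initial.to F)
    refine ⟨⟨⟨shrinkCoyonedaEquiv g⟩, fun z => shrinkCoyonedaEquiv.symm.injective (h.1 ?_)⟩⟩
    exact initialIsInitial.hom_ext _ _
  · rintro ⟨h⟩
    refine ⟨fun g g' _ => shrinkCoyonedaEquiv.injective (h.instSubsingleton.elim _ _), fun k => ?_⟩
    exact ⟨shrinkCoyonedaEquiv.symm h.default, initialIsInitial.hom_ext _ _⟩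

end

/-! ### Tambara functors as local objects, and their colimits. -/

section

open MonoidalCategory CartesianMonoidalCategory

variable {C : Type*} [Category* C] [CartesianMonoidalCategory C]

lemma existsUnique_of_iso (F : C ⥤ Type w) {X X' Y Y' : C} (e : X ≅ X') (e' : Y ≅ Y')
    (h : ∀ (x : F.obj X') (y : F.obj Y'), ∃! z, F.map (fst X' Y') z = x ∧ F.map (snd X' Y') z = y)
    (x : F.obj X) (y : F.obj Y) : ∃! z, F.map (fst X Y) z = x ∧ F.map (snd X Y) z = y := by
  obtain ⟨z, ⟨hz₁, hz₂⟩, hz⟩ := h (F.map e.hom x) (F.map e'.hom y)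
  refine ⟨F.map (e.inv ⊗ₘ e'.inv) z, ⟨?_, ?_⟩, ?_⟩
  · simp only
    rw [← Functor.map_comp_apply, tensorHom_fst, Functor.map_comp_apply, hz₁,
      ← Functor.map_comp_apply, e.hom_inv_id, Functor.map_id_apply]
  · simp only
    rw [← Functor.map_comp_apply, tensorHom_snd, Functor.map_comp_apply, hz₂,
      ← Functor.map_comp_apply, e'.hom_inv_id, Functor.map_id_apply]
  · rintro z' ⟨rfl, rfl⟩
    rw [← hz (F.map (e.hom ⊗ₘ e'.hom) z') ⟨?_, ?_⟩, ← Functor.map_comp_apply,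
      tensorHom_comp_tensorHom, e.hom_inv_id, e'.hom_inv_id, id_tensorHom_id, Functor.map_id_apply]
    · rw [← Functor.map_comp_apply, tensorHom_fst, Functor.map_comp_apply]
    · rw [← Functor.map_comp_apply, tensorHom_snd, Functor.map_comp_apply]

end

section
variable {G : Type u} [Group G]

namespace BiPoly

open MonoidalCategory CartesianMonoidalCategory Opposite

variable (Oa Om : MorphismProperty (FinGSet G)) [IsIndexingCategory Oa] [IsIndexingCategory Om]
    [Compatible Oa Om]

/-- The endomorphism of `X ⨿ X` acting by `(x, y) ↦ (x, x + y)`. -/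
noncomputable def shear (X : FinGSet G) : mk Oa Om X ⊗ mk Oa Om X ⟶ mk Oa Om X ⊗ mk Oa Om X :=
  lift (fst _ _) (tr Om (fold X) (IsIndexingCategory.fold_mem Oa X))

variable {Oa Om}

lemma map_shear (F : BiPoly Oa Om ⥤ Type w) [PreservesFiniteProducts F] {X : FinGSet G}
    (x y : F.obj (mk Oa Om X)) :
    F.map (shear Oa Om X) (prodPair F x y) = prodPair F x (add F x y) := by
  rw [shear, map_lift_prodPair, map_fst_prodPair, add_eq]

lemma eq_prodPair_fst_snd (F : BiPoly Oa Om ⥤ Type w) [PreservesFiniteProducts F] {X : FinGSet G}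
    (z : F.obj (mk Oa Om X ⊗ mk Oa Om X)) :
    z = prodPair F (F.map (fst _ _) z) (F.map (snd _ _) z) := eq_prodPair rfl rfl

lemma prodPair_injective (F : BiPoly Oa Om ⥤ Type w) [PreservesFiniteProducts F] {X : FinGSet G}
    {x x' y y' : F.obj (mk Oa Om X)} (h : prodPair F x y = prodPair F x' y') : x = x' ∧ y = y' := by
  have h₁ := congrArg (F.map (fst _ _)) h
  have h₂ := congrArg (F.map (snd _ _)) h
  rw [map_fst_prodPair, map_fst_prodPair] at h₁
  rw [map_snd_prodPair, map_snd_prodPair] at h₂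
  exact ⟨h₁, h₂⟩

/-- Negatives invert the shear by `(x, y) ↦ (x, -x + y)`; conversely a preimage of `(x, 0)` has the
form `(x, -x)`. The existence of negatives thus becomes the invertibility of one morphism. -/
lemma exists_neg_iff_bijective_map_shear (F : BiPoly Oa Om ⥤ Type w) [PreservesFiniteProducts F]
    (X : FinGSet G) :
    (∀ x : F.obj (mk Oa Om X), ∃ y, add F x y = zero F X) ↔
      Function.Bijective (F.map (shear Oa Om X)) := by
  let _ := SpanCat.addCommMonoid (SpanCat.toBiPoly Oa Om ⋙ F) X
  constructor
  · intro h
    refine ⟨fun z z' hz => ?_, fun z => ?_⟩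
    · rw [eq_prodPair_fst_snd F z, eq_prodPair_fst_snd F z', map_shear, map_shear] at hz
      obtain ⟨h₁, h₂⟩ := prodPair_injective F hz
      rw [eq_prodPair_fst_snd F z, eq_prodPair_fst_snd F z', h₁]
      rw [h₁] at h₂
      obtain ⟨y, hy⟩ := h (F.map (fst _ _) z')
      congr 1
      have h₃ (a b c : (SpanCat.toBiPoly Oa Om ⋙ F).obj ⟨X⟩) (h₀ : a + b = 0) : b + (a + c) = c := by
        rw [← add_assoc, add_comm b, h₀, zero_add]
      exact (h₃ _ _ _ hy).symm.trans ((congrArg (add F y) h₂).trans (h₃ _ _ _ hy))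
    · obtain ⟨y, hy⟩ := h (F.map (fst _ _) z)
      refine ⟨prodPair F (F.map (fst _ _) z) (add F y (F.map (snd _ _) z)), ?_⟩
      have h₃ (a b c : (SpanCat.toBiPoly Oa Om ⋙ F).obj ⟨X⟩) (h₀ : a + b = 0) : a + (b + c) = c := by
        rw [← add_assoc, h₀, zero_add]
      rw [map_shear, eq_prodPair_fst_snd F z]
      congr 1
      · rw [map_fst_prodPair]
      · rw [map_fst_prodPair, map_snd_prodPair]
        exact h₃ _ _ _ hy
  · intro h x
    obtain ⟨z, hz⟩ := h.2 (prodPair F x (zero F X))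
    rw [eq_prodPair_fst_snd F z, map_shear] at hz
    obtain ⟨rfl, h₂⟩ := prodPair_injective F hz
    exact ⟨_, h₂⟩

/-- Both conditions are invariant under isomorphism of `G`-sets, so they need testing only on the
representatives `o`; this makes the set of test maps small. -/
lemma isTambara_iff {ι : Type*} (o : ι → FinGSet G) (ho : ∀ X, ∃ i, Nonempty (X ≅ o i))
    (F : BiPoly Oa Om ⥤ Type w) :
    IsTambara Oa Om F ↔
      (∀ i j (x : F.obj (mk Oa Om (o i))) (y : F.obj (mk Oa Om (o j))),
        ∃! z : F.obj (mk Oa Om (o i) ⊗ mk Oa Om (o j)),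
          F.map (fst _ _) z = x ∧ F.map (snd _ _) z = y) ∧
      (∀ i, Function.Bijective (F.map (shear Oa Om (o i)))) ∧
      Nonempty (Unique (F.obj (𝟙_ (BiPoly Oa Om)))) := by
  constructor
  · intro _
    refine ⟨fun i j => existsUnique_prodPair F, fun i => ?_, ⟨uniqueObjUnit F⟩⟩
    exact (exists_neg_iff_bijective_map_shear F (o i)).1 (IsTambara.exists_neg (o i))
  · rintro ⟨h₁, h₂, h₃⟩
    have : PreservesFiniteProducts F := by
      refine preservesFiniteProducts_of_existsUnique F h₃ fun {X Y} => ?_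
      obtain ⟨i, ⟨e⟩⟩ := ho X.obj.obj
      obtain ⟨j, ⟨e'⟩⟩ := ho Y.obj.obj
      exact existsUnique_of_iso F (nonempty_iso e).some (nonempty_iso e').some (h₁ i j)
    refine { exists_neg := fun X x => ?_ }
    obtain ⟨i, ⟨e⟩⟩ := ho X
    obtain ⟨y, hy⟩ := (exists_neg_iff_bijective_map_shear F (o i)).2 (h₂ i) (F.map (res Oa Om e.inv) x)
    have h : F.map (res Oa Om e.hom) (F.map (res Oa Om e.inv) x) = x := by
      rw [map_res_res, e.hom_inv_id]
      exact Functor.map_id_apply F _ x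
    refine ⟨F.map (res Oa Om e.hom) y, ?_⟩
    refine (congrArg (fun t => add F t _) h).symm.trans ?_
    refine (map_span_add F (SpanCat.res Oa e.hom) _ _).symm.trans ?_
    exact (congrArg _ hy).trans (map_span_zero F (SpanCat.res Oa e.hom))

end BiPoly

namespace TambaraFunctor

open MonoidalCategory CartesianMonoidalCategory Opposite BiPoly

theorem hasColimits [Finite G] (Oa Om : MorphismProperty (FinGSet G)) [IsIndexingCategory Oa]
    [IsIndexingCategory Om] [Compatible Oa Om] :
    HasColimitsOfSize.{w, w} (TambaraFunctor.{u, w} Oa Om) := by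
  obtain ⟨ι, o, ho⟩ := exists_representatives.{u, w} G
  have : LocallySmall.{w} (BiPoly Oa Om ⥤ Type w) :=
    locallySmall_functor_of_representatives (fun i => mk Oa Om (o i)) fun X => by
      obtain ⟨i, ⟨e⟩⟩ := ho X.obj.obj
      exact ⟨i, nonempty_iso e⟩
  -- The test maps express, in order, preservation of binary products, existence of negatives and
  -- preservation of the terminal object.
  let f : (ι × ι) ⊕ ι ⊕ PUnit.{w + 1} → Arrow (BiPoly Oa Om ⥤ Type w) :=
    Sum.elim (fun p => .mk (coprod.desc
        (shrinkCoyoneda.{w}.map (fst (mk Oa Om (o p.1)) (mk Oa Om (o p.2))).op)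
        (shrinkCoyoneda.{w}.map (snd (mk Oa Om (o p.1)) (mk Oa Om (o p.2))).op)))
      (Sum.elim (fun i => .mk (shrinkCoyoneda.{w}.map (shear Oa Om (o i)).op))
        fun _ => .mk (initial.to (shrinkCoyoneda.{w}.obj (op (𝟙_ (BiPoly Oa Om))))))
  have := Cardinal.fact_isRegular_aleph0.{w}
  have hy (X : BiPoly Oa Om) := isCardinalPresentable_shrinkCoyoneda Cardinal.aleph0.{w} X
  have hf : ∀ i, IsCardinalPresentable (f i).left Cardinal.aleph0.{w} ∧
      IsCardinalPresentable (f i).right Cardinal.aleph0.{w} := by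
    rintro (⟨i, j⟩ | i | _)
    · have := hy (mk Oa Om (o i))
      have := hy (mk Oa Om (o j))
      exact ⟨isCardinalPresentable_coprod _, hy _⟩
    · exact ⟨hy _, hy _⟩
    · exact ⟨isCardinalPresentable_initial _, hy _⟩
  have h : (MorphismProperty.ofHoms fun i => (f i).hom).isLocal = fun F => IsTambara Oa Om F := by
    funext F
    rw [isLocal_ofHoms_iff, isTambara_iff o ho, Sum.forall, Sum.forall, Prod.forall]
    refine propext (and_congr (forall₂_congr fun i j => ?_) (and_congr (forall_congr' fun i => ?_) ?_))
    · exact bijective_coprodDesc_comp_iff F _ _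
    · exact bijective_shrinkCoyoneda_map_comp_iff F _
    · exact (forall_const _).trans (bijective_initial_to_comp_iff F _)
  have := hasColimits_isLocal_ofHoms Cardinal.aleph0.{w} f hf
  rwa [h] at this

end TambaraFunctor
end

theorem mainTheorem11 {G : Type u} [Group G] [Finite G]
    (Oa Om : MorphismProperty (FinGSet G)) [IsIndexingCategory Oa] [IsIndexingCategory Om]
    [Compatible Oa Om] :
    HasColimitsOfSize.{w, w} (TambaraFunctor.{u, w} Oa Om) ∧
    ∀ (R S Q : TambaraFunctor.{u, w} Oa Om) (i : R ⟶ Q) (j : S ⟶ Q),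
      IsColimit (BinaryCofan.mk i j) →
        ∃ α : MackeyFunctor.tensor (TambaraFunctor.underlying R) (TambaraFunctor.underlying S) ⟶
            SpanCat.prodFunctor Oa ⋙ MackeyFunctor.toAb (TambaraFunctor.underlying Q),
          MackeyFunctor.IsBoxProduct (TambaraFunctor.underlying R) (TambaraFunctor.underlying S) (TambaraFunctor.underlying Q) α ∧
          ∀ (X Y : FinGSet G) (x : R.obj.obj (BiPoly.mk Oa Om X))
            (y : S.obj.obj (BiPoly.mk Oa Om Y)),
            α.app (⟨X⟩, ⟨Y⟩) (MackeyFunctor.tmul (TambaraFunctor.underlying R) (TambaraFunctor.underlying S) x y) =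
              TambaraFunctor.mul Q (TambaraFunctor.res Q (FinGSet.fst X Y) (i.hom.app _ x))
                (TambaraFunctor.res Q (FinGSet.snd X Y) (j.hom.app _ y)) := by
  refine ⟨TambaraFunctor.hasColimits Oa Om, fun R S Q i j hQ => ?_⟩
  obtain ⟨α, hα⟩ := TambaraFunctor.exists_tensor_hom i j
  exact ⟨α, TambaraFunctor.isBoxProduct_of_isColimit hQ hα, fun X Y x y =>
    (hα X Y x y).trans (TambaraFunctor.mul_res_fst_res_snd Q _ _).symm⟩
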